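/- **Setting.** Let $G$ be a connected Lie group with Lie algebra $\mathfrak g$, acting smoothly, freely and properly on the left on a smooth (finite-dimensional, Hausdorff, second countable) manifold $M$; let $\pi:M\to M/G$ be the resulting principal bundle, $\tau:TM\to M$ the tangent projection, and $\omega$ a principal connection on $M\to M/G$, regarded as a smooth $G$-invariant type $(1,1)$ tensor field that is pointwise a projection of $T_mM$ onto $\ker T_m\pi$. For $\xi\in\mathfrak g$ let $\tilde\xi$ be the fundamental vector field on $M$. For a vector field $Z$ on $M$ let $Z^C$ and $Z^V$ be its complete and vertical lifts to $TM$. Let $L:TM\to\mathbb R$ be a smooth $G$-invariant Lagrangian. Its fibre Hessian $g$ is a symmetric bilinear form on $T_{\tau(v)}M$ depending on $v\in TM$; assume that $g$ is everywhere non-singular and that the bilinear form $(\xi,\eta)\mapsto g(\tilde\xi,\tilde\eta)$ on $\mathfrak g$ is everywhere non-singular. Let $p:TM\to\mathfrak g^*$, $\langle p,\xi\rangle=\tilde\xi^V(L)$, be the momentum map. For $\mu\in\mathfrak g^*$ let $N_\mu=p^{-1}(\mu)$, a submanifold of $TM$ with inclusion $\iota$; let $G_\mu=\{h\in G:\langle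 \mathrm{Ad}_h\xi,\mu\rangle=\langle\xi,\mu\rangle\ \forall\xi\in\mathfrak g\}$ and let $\mathfrak g_\mu$ be its Lie algebra. Assume that $(\xi,\eta)\mapsto g(\tilde\xi,\tilde\eta)$ is non-singular on $\mathfrak g_\mu$ at every point of $N_\mu$. A *principal $G_\mu$-connection* on $N_\mu$ is a smooth $G_\mu$-invariant type $(1,1)$ tensor field on $N_\mu$ that is pointwise a projection onto the tangent space $\{\tilde\xi^C:\xi\in\mathfrak g_\mu\}$ of the $G_\mu$-orbit. For $W\in T_v(TM)$ let $\bar W=W+(\tilde\eta^V)_v$, where $\eta\in\mathfrak g$ is the unique element for which $\bar W$ annihilates all momentum functions $\langle p,\zeta\rangle$, $\zeta\in\mathfrak g$. For a basis $\{E_a\}$ of $\mathfrak g$ and a local basis $\{X_i\}$ of $G$-invariant $\omega$-horizontal vector fields, defined on a $G$-invariant open subset of $M$, write $\bar E_a^C,\bar X_i^C,\bar X_i^V$ for the vector fields obtained in this way from $\tilde E_a^C,X_i^C,X_i^V$, and $\bar E_\xi^C$ for the one obtained from $\tilde\xi^C$. **Claim.** 1. There is exactly one field $\Omega^V$ of projection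 operators on the tangent spaces of $N_\mu$ such that, for every choice of $\{E_a\}$ and $\{X_i\}$, its image is $\mathrm{span}\{\bar E_a^C\}$ at every point, and its kernel is $\mathrm{span}\{\bar X_i^C,\bar X_i^V\}$ at every point where the $X_i$ are defined (in particular these vectors are tangent to $N_\mu$, the two spans are complementary in $TN_\mu$, and they do not depend on the choices). 2. $\Omega^V$ is a connection on $T\pi\circ\iota:N_\mu\to T(M/G)$: this map is a smooth submersion, and $\Omega^V$ is a smooth type $(1,1)$ tensor field, pointwise a projection with image the kernel of $T(T\pi\circ\iota)$. Moreover $\Omega^V$ is $G_\mu$-invariant: each $h\in G_\mu$ acts on $N_\mu$ smoothly through its tangent action, and the tangent map of this action commutes with $\Omega^V$. 3. $\Omega^V(Z)=\omega(T(\tau\circ\iota)Z)$ for all $Z\in TN_\mu$, as an equality in $\mathfrak g$: for each $Z$ there is a unique $\xi\in\mathfrak g$ with $\omega(T(\tau\circ\iota)Z)=\tilde\xi$, and for $\xi\in\mathfrak g$ one has $\Omega^V(Z)=\bar E^C_\xi$ if and only if $\omega(T(\tau\circ\iota)Z)=\tilde\xi$. 4. There is exactly one principal $G_\mu$-connection $\Omega^{\mathrm{mech}}$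 on $N_\mu$ with $\Omega^{\mathrm{mech}}(Z)=0$ if and only if $g(\tilde\xi,T(\tau\circ\iota)Z)=0$ for all $\xi\in\mathfrak g_\mu$; and the composite $\Omega^{N_\mu}=\Omega^{\mathrm{mech}}\circ\Omega^V$ is a principal $G_\mu$-connection on $N_\mu$. 5. In general $\Omega^{N_\mu}\neq\Omega^{\mathrm{mech}}$: there are $M,G,\omega,L,\mu$ satisfying all the assumptions above for which the two connections differ. -/

import Mathlib

open scoped Manifold ContDiff Topology
open Bundle

noncomputable section

/-! ### Connections as tensor fields of type (1,1) -/

section Connections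

variable {EP : Type*} [NormedAddCommGroup EP] [NormedSpace ℝ EP]
  {P : Type*} [TopologicalSpace P] [ChartedSpace EP P] [IsManifold 𝓘(ℝ, EP) ∞ P]
  {EQ : Type*} [NormedAddCommGroup EQ] [NormedSpace ℝ EQ]
  {HQ : Type*} [TopologicalSpace HQ] (IQ : ModelWithCorners ℝ EQ HQ)
  {Q : Type*} [TopologicalSpace Q] [ChartedSpace HQ Q]

/-- A (not necessarily smooth) tensor field of type (1,1) on `P`. -/
abbrev TensorField11 (EP : Type*) [NormedAddCommGroup EP] [NormedSpace ℝ EP]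
    (P : Type*) [TopologicalSpace P] [ChartedSpace EP P] : Type _ :=
  ∀ p : P, TangentSpace 𝓘(ℝ, EP) p →L[ℝ] TangentSpace 𝓘(ℝ, EP) p

/-- Smoothness of a tensor field of type (1,1), as a section of the bundle of endomorphisms of
the tangent bundle. -/
def IsSmoothTensor (Ω : TensorField11 EP P) : Prop :=
  ContMDiff 𝓘(ℝ, EP) (𝓘(ℝ, EP).prod 𝓘(ℝ, EP →L[ℝ] EP)) ∞
    (fun p => TotalSpace.mk' (EP →L[ℝ] EP)
      (E := fun p : P => TangentSpace 𝓘(ℝ, EP) p →L[ℝ] TangentSpace 𝓘(ℝ, EP) p) p (Ω p))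

/-- A connection on `f : P → Q`, that is, a smooth left splitting of the short exact sequence
`0 → ker Tf → TP → P ×_Q TQ → 0`, seen as a tensor field of type (1,1) that is pointwise a
projection onto the vertical space `ker Tf`. -/
structure IsConnection (f : P → Q) (Ω : TensorField11 EP P) : Prop where
  smooth_map : ContMDiff 𝓘(ℝ, EP) IQ ∞ f
  submersion : ∀ p, Function.Surjective (mfderiv 𝓘(ℝ, EP) IQ f p)
  smooth : IsSmoothTensor Ω
  projection : ∀ p, Ω p ∘L Ω p = Ω p
  range_eq : ∀ p, (Ω p).range = (mfderiv 𝓘(ℝ, EP) IQ f p).ker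

end Connections

section Setting

variable {E : Type*} [NormedAddCommGroup E] [NormedSpace ℝ E]
  {M : Type*} [TopologicalSpace M] [ChartedSpace E M] [IsManifold 𝓘(ℝ, E) ∞ M]
  {F : Type*} [NormedAddCommGroup F] [NormedSpace ℝ F]
  {G : Type*} [TopologicalSpace G] [ChartedSpace F G] [Group G] [MulAction G M]

/-! ### Lifts to the tangent bundle

In Mathlib the tangent space of `TM` at `v` is `E × E`; the first component gives the coordinates
of the projection to `T_m M`, `m = v.proj`, and both components are taken with respect to the
chart of `TM` induced by the preferred chart of `M` at `m`, the same one for all `v ∈ T_m M`. -/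

/-- The vertical lift of `w ∈ T_m M` to `v ∈ T_m M`: the velocity at `t = 0` of `t ↦ v + t w`. -/
def verticalLift (v : TangentBundle 𝓘(ℝ, E) M) (w : TangentSpace 𝓘(ℝ, E) v.proj) :
    TangentSpace 𝓘(ℝ, E).tangent v :=
  (mfderiv 𝓘(ℝ, ℝ) 𝓘(ℝ, E).tangent
    (fun t : ℝ => (⟨v.proj, v.2 + t • w⟩ : TangentBundle 𝓘(ℝ, E) M)) 0 (1 : ℝ) : E × E)

/-- The complete lift of a vector field `Z` on `M`, at `v ∈ T_m M`. The derivative of the section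
`Z : M → TM` at `m` in the direction `v` is `(v, D)` in the coordinates described above; the
complete lift is its image `(Z m, D)` under the canonical flip of `T(TM)`. In coordinates,
`Z^C = Z^i ∂/∂x^i + u^j (∂Z^i/∂x^j) ∂/∂u^i`. -/
def completeLift (Z : ∀ m : M, TangentSpace 𝓘(ℝ, E) m) (v : TangentBundle 𝓘(ℝ, E) M) :
    TangentSpace 𝓘(ℝ, E).tangent v :=
  ((Z v.proj, (mfderiv 𝓘(ℝ, E) 𝓘(ℝ, E).tangent
    (fun m => (⟨m, Z m⟩ : TangentBundle 𝓘(ℝ, E) M)) v.proj v.2 : E × E).2) : E × E)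

/-! ### The group action -/

/-- The infinitesimal action `𝔤 → T_m M`, the derivative at `1` of `g ↦ g • m`. -/
def infAction (G : Type*) [TopologicalSpace G] [ChartedSpace F G] [Group G] [MulAction G M]
    (m : M) : GroupLieAlgebra 𝓘(ℝ, F) G →L[ℝ] TangentSpace 𝓘(ℝ, E) m :=
  (mfderiv 𝓘(ℝ, F) 𝓘(ℝ, E) (fun g : G => g • m) 1 : F →L[ℝ] E)

/-- The fundamental vector field `ξ̃` on `M` of `ξ ∈ 𝔤`. -/
def fundamentalField (ξ : GroupLieAlgebra 𝓘(ℝ, F) G) (m : M) : TangentSpace 𝓘(ℝ, E) m :=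
  infAction G m ξ

/-- The tangent action of `G` on `TM`. -/
def tangentAction (g : G) : TangentBundle 𝓘(ℝ, E) M → TangentBundle 𝓘(ℝ, E) M :=
  tangentMap 𝓘(ℝ, E) 𝓘(ℝ, E) (fun m : M => g • m)

/-- The adjoint action of `g` on the Lie algebra. -/
def adjointMap (g : G) : GroupLieAlgebra 𝓘(ℝ, F) G →L[ℝ] GroupLieAlgebra 𝓘(ℝ, F) G :=
  (mfderiv 𝓘(ℝ, F) 𝓘(ℝ, F) (fun h : G => g * h * g⁻¹) 1 : F →L[ℝ] F)

/-- The isotropy group `G_μ` of `μ ∈ 𝔤*` under the coadjoint action. -/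
def isotropyGroup (μ : GroupLieAlgebra 𝓘(ℝ, F) G →L[ℝ] ℝ) : Set G :=
  {g | ∀ ξ, μ (adjointMap g ξ) = μ ξ}

/-- The Lie algebra `𝔤_μ` of `G_μ`: the velocities at the identity of smooth curves in `G_μ`. -/
def isotropyAlgebra (μ : GroupLieAlgebra 𝓘(ℝ, F) G →L[ℝ] ℝ) :
    Set (GroupLieAlgebra 𝓘(ℝ, F) G) :=
  {ξ | ∃ c : ℝ → G, ContMDiff 𝓘(ℝ, ℝ) 𝓘(ℝ, F) ∞ c ∧ c 0 = 1 ∧ (∀ t, c t ∈ isotropyGroup μ) ∧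
    (mfderiv 𝓘(ℝ, ℝ) 𝓘(ℝ, F) c 0 (1 : ℝ) : F) = ξ}

variable (G) in
/-- The orbit space `M/G`, with the quotient topology. -/
abbrev OrbitSpace (M : Type*) [MulAction G M] : Type _ := MulAction.orbitRel.Quotient G M

variable (G) in
/-- The projection `M → M/G`. -/
def orbitProj (m : M) : OrbitSpace G M := Quotient.mk (MulAction.orbitRel G M) m

/-! ### The Lagrangian, its momentum and its Hessian -/

/-- The fibre derivative of `L` at `v`, a linear form on `T_m M`. -/
def fibreDeriv (L : TangentBundle 𝓘(ℝ, E) M → ℝ) (v : TangentBundle 𝓘(ℝ, E) M) :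
    TangentSpace 𝓘(ℝ, E) v.proj →L[ℝ] ℝ :=
  (fderiv ℝ (fun y : E => L ⟨v.proj, y⟩) v.2 : E →L[ℝ] ℝ)

/-- The Hessian of `L` at `v`: the second derivative at `v` of the restriction of `L` to `T_m M`. -/
def hessian (L : TangentBundle 𝓘(ℝ, E) M → ℝ) (v : TangentBundle 𝓘(ℝ, E) M) :
    TangentSpace 𝓘(ℝ, E) v.proj →L[ℝ] TangentSpace 𝓘(ℝ, E) v.proj →L[ℝ] ℝ :=
  (fderiv ℝ (fun x : E => fderiv ℝ (fun y : E => L ⟨v.proj, y⟩) x) v.2 : E →L[ℝ] E →L[ℝ] ℝ)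

variable (G) in
/-- The momentum map `TM → 𝔤*`, `⟨p(v), ξ⟩ = ξ̃^V(L)(v)`. -/
def momentum (L : TangentBundle 𝓘(ℝ, E) M → ℝ) (v : TangentBundle 𝓘(ℝ, E) M) :
    GroupLieAlgebra 𝓘(ℝ, F) G →L[ℝ] ℝ :=
  fibreDeriv L v ∘L infAction G v.proj

variable (G) in
/-- The derivative of the momentum map at `v`. -/
def momentumDeriv (L : TangentBundle 𝓘(ℝ, E) M → ℝ) (v : TangentBundle 𝓘(ℝ, E) M) :
    TangentSpace 𝓘(ℝ, E).tangent v →L[ℝ] (GroupLieAlgebra 𝓘(ℝ, F) G →L[ℝ] ℝ) :=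
  (mfderiv (M' := F →L[ℝ] ℝ) 𝓘(ℝ, E).tangent 𝓘(ℝ, F →L[ℝ] ℝ)
    (fun u : TangentBundle 𝓘(ℝ, E) M => momentum G L u) v : E × E →L[ℝ] F →L[ℝ] ℝ)

variable (G) in
/-- The bilinear form `(g_{ab})` on `𝔤` at `v`: `(ξ, η) ↦ g(ξ̃, η̃)`, `g` the Hessian of `L`. -/
def lockedHessian (L : TangentBundle 𝓘(ℝ, E) M → ℝ) (v : TangentBundle 𝓘(ℝ, E) M) :
    GroupLieAlgebra 𝓘(ℝ, F) G →L[ℝ] GroupLieAlgebra 𝓘(ℝ, F) G →L[ℝ] ℝ :=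
  let h : E →L[ℝ] E →L[ℝ] ℝ := hessian L v
  let σ : F →L[ℝ] E := infAction G v.proj
  let γ : F →L[ℝ] F →L[ℝ] ℝ := h.bilinearComp σ σ
  γ

/-- The level set `N_μ` of the momentum map. -/
def momentumLevel (L : TangentBundle 𝓘(ℝ, E) M → ℝ)
    (μ : GroupLieAlgebra 𝓘(ℝ, F) G →L[ℝ] ℝ) : Set (TangentBundle 𝓘(ℝ, E) M) :=
  {v | momentum G L v = μ}

variable (F G) in
/-- The correction of `W ∈ T_v TM` to a vector tangent to the level sets of momentum: the vector
`W + η̃^V`, with `η ∈ 𝔤` such that the momentum has zero derivative along it, that is,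
`g(η̃, ζ̃) = - W(p_ζ)` for all `ζ ∈ 𝔤`. -/
def barVector (L : TangentBundle 𝓘(ℝ, E) M → ℝ) (v : TangentBundle 𝓘(ℝ, E) M)
    (W : TangentSpace 𝓘(ℝ, E).tangent v) : TangentSpace 𝓘(ℝ, E).tangent v :=
  W + verticalLift v
    (infAction (F := F) G v.proj
      (-((lockedHessian (F := F) G L v).inverse (momentumDeriv G L v W))))

/-! ### Standard bases -/

/-- The `X i` are smooth vector fields on the open `G`-invariant set `U`, invariant under `G` and
forming a basis of the horizontal space of `ωM` at each point of `U`. -/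
structure IsStandardFrame (G : Type*) [Group G] [MulAction G M]
    (ωM : TensorField11 E M) (U : Set M) {k : ℕ}
    (X : Fin k → ∀ m : M, TangentSpace 𝓘(ℝ, E) m) : Prop where
  isOpen : IsOpen U
  smul_mem : ∀ (g : G), ∀ m ∈ U, g • m ∈ U
  smooth : ∀ i, ContMDiffOn 𝓘(ℝ, E) 𝓘(ℝ, E).tangent ∞
    (fun m => (⟨m, X i m⟩ : TangentBundle 𝓘(ℝ, E) M)) U
  invariant : ∀ i (g : G), ∀ m ∈ U,
    mfderiv 𝓘(ℝ, E) 𝓘(ℝ, E) (fun x : M => g • x) m (X i m) = X i (g • m)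
  linearIndependent : ∀ m ∈ U, LinearIndependent ℝ (fun i => X i m)
  span_eq : ∀ m ∈ U, Submodule.span ℝ (Set.range fun i => X i m) = (ωM m).ker

/-- The span at `v` of the vectors `Ē_a^C`. -/
def verticalSpan (L : TangentBundle 𝓘(ℝ, E) M → ℝ) {r : ℕ}
    (b : Module.Basis (Fin r) ℝ (GroupLieAlgebra 𝓘(ℝ, F) G)) (v : TangentBundle 𝓘(ℝ, E) M) :
    Submodule ℝ (TangentSpace 𝓘(ℝ, E).tangent v) :=
  Submodule.span ℝ
    (Set.range fun a => barVector F G L v (completeLift (fundamentalField (b a)) v))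

variable (F G) in
/-- The span at `v` of the vectors `X̄_i^C` and `X̄_i^V`. -/
def horizontalSpan (L : TangentBundle 𝓘(ℝ, E) M → ℝ) {k : ℕ}
    (X : Fin k → ∀ m : M, TangentSpace 𝓘(ℝ, E) m) (v : TangentBundle 𝓘(ℝ, E) M) :
    Submodule ℝ (TangentSpace 𝓘(ℝ, E).tangent v) :=
  Submodule.span ℝ
    ((Set.range fun i => barVector F G L v (completeLift (X i) v)) ∪
      (Set.range fun i => barVector F G L v (verticalLift v (X i v.proj))))

/-! ### Connections on the level set -/

variable {EB : Type*} [NormedAddCommGroup EB] [NormedSpace ℝ EB]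
  [ChartedSpace EB (OrbitSpace G M)] [IsManifold 𝓘(ℝ, EB) ∞ (OrbitSpace G M)]
  {EN : Type*} [NormedAddCommGroup EN] [NormedSpace ℝ EN]
  {L : TangentBundle 𝓘(ℝ, E) M → ℝ} {μ : GroupLieAlgebra 𝓘(ℝ, F) G →L[ℝ] ℝ}
  [ChartedSpace EN (momentumLevel L μ)] [IsManifold 𝓘(ℝ, EN) ∞ (momentumLevel L μ)]

/-- The derivative at `n` of the inclusion `ι : N_μ → TM`. -/
def inclDeriv (n : momentumLevel L μ) :
    TangentSpace 𝓘(ℝ, EN) n →L[ℝ] TangentSpace 𝓘(ℝ, E).tangent n.1 :=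
  mfderiv 𝓘(ℝ, EN) 𝓘(ℝ, E).tangent
    (Subtype.val : momentumLevel L μ → TangentBundle 𝓘(ℝ, E) M) n

/-- The derivative at `n` of `τ ∘ ι : N_μ → M`. -/
def baseDeriv (n : momentumLevel L μ) :
    TangentSpace 𝓘(ℝ, EN) n →L[ℝ] TangentSpace 𝓘(ℝ, E) n.1.proj :=
  mfderiv 𝓘(ℝ, EN) 𝓘(ℝ, E) (fun x : momentumLevel L μ => x.1.proj) n

variable (EB) in
/-- The projection `N_μ → T(M/G)`, the restriction to `N_μ` of the tangent map of `M → M/G`. -/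
def levelProj (n : momentumLevel L μ) : TangentBundle 𝓘(ℝ, EB) (OrbitSpace G M) :=
  tangentMap 𝓘(ℝ, E) 𝓘(ℝ, EB) (orbitProj G) n.1

/-- `G_μ`-invariance of a tensor field on `N_μ`: each element of `G_μ` maps `N_μ` smoothly to
itself, by a map `φ` whose tangent map commutes with `Ω`. -/
def IsIsotropyInvariant (Ω : TensorField11 EN (momentumLevel L μ)) : Prop :=
  ∀ g ∈ isotropyGroup μ, ∃ φ : momentumLevel L μ → momentumLevel L μ,
    ContMDiff 𝓘(ℝ, EN) 𝓘(ℝ, EN) ∞ φ ∧ (∀ n, (φ n).1 = tangentAction g n.1) ∧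
    ∀ n, mfderiv 𝓘(ℝ, EN) 𝓘(ℝ, EN) φ n ∘L Ω n = Ω (φ n) ∘L mfderiv 𝓘(ℝ, EN) 𝓘(ℝ, EN) φ n

/-- A principal `G_μ`-connection on `N_μ`: a smooth `G_μ`-invariant tensor field of type (1,1),
pointwise a projection onto the tangent space of the `G_μ`-orbit, which consists of the values of
the generators `ξ̃^C`, `ξ ∈ 𝔤_μ`, of the action of `G_μ` on `N_μ`. -/
structure IsPrincipalIsotropyConnection (Ω : TensorField11 EN (momentumLevel L μ)) : Prop where
  smooth : IsSmoothTensor Ω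
  projection : ∀ n, Ω n ∘L Ω n = Ω n
  image_range : ∀ n, inclDeriv n '' Set.range (Ω n) =
    (fun ξ => completeLift (fundamentalField ξ) n.1) '' isotropyAlgebra μ
  invariant : IsIsotropyInvariant Ω

/-- The mechanical connection `Ω^mech`: the principal `G_μ`-connection on `N_μ` for which `Z` is
horizontal when `g(ξ̃, τ_* Z) = 0` for all `ξ ∈ 𝔤_μ`, `g` the Hessian of `L`. -/
structure IsMechanicalConnection (Ω : TensorField11 EN (momentumLevel L μ)) : Prop extends
    IsPrincipalIsotropyConnection Ω where
  ker_iff : ∀ n Z, Ω n Z = 0 ↔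
    ∀ ξ ∈ isotropyAlgebra μ, hessian L n.1 (fundamentalField ξ n.1.proj) (baseDeriv n Z) = 0

/-- `Ω` is the splitting of `T N_μ` given by `span {Ē_a^C}` versus `span {X̄_i^C, X̄_i^V}`,
whatever the choice of the basis of `𝔤` and of the local standard frame of horizontal fields. -/
structure IsVerticalLiftSplitting (ωM : TensorField11 E M)
    (Ω : TensorField11 EN (momentumLevel L μ)) : Prop where
  projection : ∀ n, Ω n ∘L Ω n = Ω n
  map_range : ∀ n {r : ℕ} (b : Module.Basis (Fin r) ℝ (GroupLieAlgebra 𝓘(ℝ, F) G)),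
    (Ω n).range.map (inclDeriv n).toLinearMap = verticalSpan L b n.1
  map_ker : ∀ {k : ℕ} (U : Set M) (X : Fin k → ∀ m : M, TangentSpace 𝓘(ℝ, E) m),
    IsStandardFrame G ωM U X → ∀ n : momentumLevel L μ, n.1.proj ∈ U →
      (Ω n).ker.map (inclDeriv n).toLinearMap = horizontalSpan F G L X n.1

/-- The composite of two tensor fields of type (1,1). -/
def TensorField11.comp {P : Type*} [TopologicalSpace P] [ChartedSpace EN P]
    (Ω₁ Ω₂ : TensorField11 EN P) : TensorField11 EN P :=
  fun p => Ω₁ p ∘L Ω₂ p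

variable (EB EN L μ) in
/-- The standing assumptions. -/
structure IsRouthSystem (ωM : TensorField11 E M) : Prop where
  /-- the action of `G` on `M` is free and proper -/
  free : ∀ (g : G) (m : M), g • m = m → g = 1
  proper : ProperSMul G M
  /-- `ωM` is a principal connection on `M → M/G` -/
  connection : IsConnection 𝓘(ℝ, EB) (orbitProj G) ωM
  connection_invariant : ∀ (g : G) (m : M),
    mfderiv 𝓘(ℝ, E) 𝓘(ℝ, E) (fun x : M => g • x) m ∘L ωM m =
      ωM (g • m) ∘L mfderiv 𝓘(ℝ, E) 𝓘(ℝ, E) (fun x : M => g • x) m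
  /-- `L` is smooth and invariant -/
  smooth : ContMDiff 𝓘(ℝ, E).tangent 𝓘(ℝ, ℝ) ∞ L
  invariant : ∀ (g : G) v, L (tangentAction g v) = L v
  /-- `L` is regular -/
  regular : ∀ v u, (∀ w, hessian L v u w = 0) → u = 0
  /-- `(g_{ab})` is non-singular -/
  locked_regular : ∀ v (ξ : GroupLieAlgebra 𝓘(ℝ, F) G), (∀ η, lockedHessian G L v ξ η = 0) → ξ = 0
  /-- the restriction of the Hessian to `N_μ × 𝔤_μ` is non-singular -/
  isotropy_regular : ∀ v ∈ momentumLevel L μ, ∀ ξ ∈ isotropyAlgebra μ,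
    (∀ η ∈ isotropyAlgebra μ, lockedHessian G L v ξ η = 0) → ξ = 0
  /-- the smooth structure of `N_μ` is that of a submanifold of `TM` -/
  submanifold : Manifold.IsSmoothEmbedding 𝓘(ℝ, EN) 𝓘(ℝ, E).tangent ∞
    (Subtype.val : momentumLevel L μ → TangentBundle 𝓘(ℝ, E) M)

end Setting

end

/-! Write `p` for the momentum map and `γ` for the form `(ξ, η) ↦ g(ξ̃, η̃)` on the Lie algebra.
Along a fibre of `TM` the derivative of `p` is given by the Hessian of `L`, so `dp(η̃^V) = γ(η)`
(`lockedHessian_eq_momentumDeriv`). Since `γ` is invertible, `p` is a submersion, the tangent spaces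
of `N_μ` are `ker dp`, and `W ↦ W̄` (`barMap`) is the projection onto `ker dp` along the vertical
lifts of orbit directions. The correction changes neither the velocity in `M` nor the image under
`T(Tπ)`.

Let `ρ` be the Lie algebra valued form of `ω`. The complete lift of `ξ̃` generates the tangent
action (`completeLift_fundamentalField`, by symmetry of second derivatives), and `Ω^V(Z)` is the
corrected generator of `ρ(τ_* Z)`. Therefore `τ_* Ω^V(Z) = ω(τ_* Z)`, which yields idempotence, the
kernel and the formula of part 3. The image is the kernel of `T(Tπ)`: a vector there has some `ξ̃`
as velocity in `M`, hence differs from the generator of `ξ` by a vertical vector, which must be the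
lift of an orbit direction and is removed by the correction. A projection is determined by its image
and kernel, so uniqueness only needs a standard frame near each point; horizontal lifts of
coordinate fields of `M/G` provide one (`isStandardFrame_horizontalLift`).

The mechanical connection is `g`-orthogonal projection of `τ_* Z` to the directions of `𝔤_μ`,
followed by the generator, which is tangent to `N_μ` because `G_μ` preserves `N_μ`. Such generators
need no correction, so `Ω^V ∘ Ω^mech = Ω^mech`; hence `Ω^mech ∘ Ω^V` is idempotent with the image of
`Ω^mech`. Invariance holds because every ingredient is equivariant.

For smoothness, the ingredients are either derivatives of maps depending smoothly on parameters or
solutions `X` of `S ∘ X = T` with `S`, `T` smooth and `S` injective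
(`SmoothHomAt.of_comp_injective`).

For part 5, let the line act on the plane by translations of the second coordinate, with a constant
metric for which the axes are not orthogonal and the flat connection whose horizontal direction is
the first axis. A vector over that axis is killed by `Ω^V` but is not `g`-orthogonal to the orbits.
-/

set_option linter.unusedSectionVars false

noncomputable section

/-! ### Smooth families of linear maps between tangent spaces -/

section SmoothHom

variable {EN : Type*} [NormedAddCommGroup EN] [NormedSpace ℝ EN] {HN : Type*} [TopologicalSpace HN]
  {J : ModelWithCorners ℝ EN HN} {N : Type*} [TopologicalSpace N] [ChartedSpace HN N]
  {E : Type*} [NormedAddCommGroup E] [NormedSpace ℝ E] {H : Type*} [TopologicalSpace H]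
  {I : ModelWithCorners ℝ E H} {M : Type*} [TopologicalSpace M] [ChartedSpace H M]
  [IsManifold I ∞ M]
  {E' : Type*} [NormedAddCommGroup E'] [NormedSpace ℝ E'] {H' : Type*} [TopologicalSpace H']
  {I' : ModelWithCorners ℝ E' H'} {M' : Type*} [TopologicalSpace M'] [ChartedSpace H' M']
  [IsManifold I' ∞ M']
  {E'' : Type*} [NormedAddCommGroup E''] [NormedSpace ℝ E''] {H'' : Type*} [TopologicalSpace H'']
  {I'' : ModelWithCorners ℝ E'' H''} {M'' : Type*} [TopologicalSpace M''] [ChartedSpace H'' M'']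
  [IsManifold I'' ∞ M'']

variable (I I') in
/-- The coordinate expression near `x₀` of a family of linear maps `T_{f x} M → T_{g x} M'`. -/
def homCoord (f : N → M) (g : N → M')
    (A : ∀ x, TangentSpace I (f x) →L[ℝ] TangentSpace I' (g x)) (x₀ x : N) : E →L[ℝ] E' :=
  (trivializationAt E' (TangentSpace I') (g x₀)).continuousLinearMapAt ℝ (g x) ∘L A x ∘L
    (trivializationAt E (TangentSpace I) (f x₀)).symmL ℝ (f x)

variable (J I I') in
/-- Smoothness at `x₀` of a family of linear maps `T_{f x} M → T_{g x} M'`. -/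
def SmoothHomAt (f : N → M) (g : N → M')
    (A : ∀ x, TangentSpace I (f x) →L[ℝ] TangentSpace I' (g x)) (x₀ : N) : Prop :=
  ContMDiffAt J 𝓘(ℝ, E →L[ℝ] E') ∞ (homCoord I I' f g A x₀) x₀

/-- The two coordinate changes at `g x` cancel, but only where the trivialization at `g x₀` is
defined; hence the condition on `x`. -/
lemma homCoord_comp {f : N → M} {g : N → M'} {h : N → M''}
    {A : ∀ x, TangentSpace I (f x) →L[ℝ] TangentSpace I' (g x)}
    {B : ∀ x, TangentSpace I' (g x) →L[ℝ] TangentSpace I'' (h x)} {x₀ x : N}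
    (hx : g x ∈ (chartAt H' (g x₀)).source) :
    homCoord I I'' f h (fun x => B x ∘L A x) x₀ x =
      homCoord I' I'' g h B x₀ x ∘L
        homCoord I I' f g A x₀ x := by
  ext w
  simp only [homCoord, ContinuousLinearMap.comp_apply]
  rw [Trivialization.symmL_continuousLinearMapAt _ hx]

lemma eventually_mem_chart_source {g : N → M'} {x₀ : N} (hg : ContinuousAt g x₀) :
    ∀ᶠ x in 𝓝 x₀, g x ∈ (chartAt H' (g x₀)).source :=
  hg ((chartAt H' (g x₀)).open_source.mem_nhds (mem_chart_source H' (g x₀)))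

lemma SmoothHomAt.comp {f : N → M} {g : N → M'} {h : N → M''}
    {A : ∀ x, TangentSpace I (f x) →L[ℝ] TangentSpace I' (g x)}
    {B : ∀ x, TangentSpace I' (g x) →L[ℝ] TangentSpace I'' (h x)} {x₀ : N}
    (hB : SmoothHomAt J I' I'' g h B x₀) (hA : SmoothHomAt J I I' f g A x₀)
    (hg : ContinuousAt g x₀) : SmoothHomAt J I I'' f h (fun x => B x ∘L A x) x₀ := by
  refine (ContMDiffAt.clm_comp hB hA).congr_of_eventuallyEq ?_
  filter_upwards [eventually_mem_chart_source (H' := H') hg] with x hx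
  exact homCoord_comp hx

lemma SmoothHomAt.congr {f : N → M} {g : N → M'}
    {A B : ∀ x, TangentSpace I (f x) →L[ℝ] TangentSpace I' (g x)} {x₀ : N}
    (hA : SmoothHomAt J I I' f g A x₀) (h : ∀ᶠ x in 𝓝 x₀, B x = A x) :
    SmoothHomAt J I I' f g B x₀ := by
  refine ContMDiffAt.congr_of_eventuallyEq hA ?_
  filter_upwards [h] with x hx
  simp only [homCoord, hx]

lemma SmoothHomAt.add {f : N → M} {g : N → M'}
    {A B : ∀ x, TangentSpace I (f x) →L[ℝ] TangentSpace I' (g x)} {x₀ : N}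
    (hA : SmoothHomAt J I I' f g A x₀) (hB : SmoothHomAt J I I' f g B x₀) :
    SmoothHomAt J I I' f g (fun x => A x + B x) x₀ := by
  refine (ContMDiffAt.add hA hB).congr_of_eventuallyEq (.of_forall fun x => ?_)
  ext w
  simp only [homCoord,
    ContinuousLinearMap.comp_apply, Pi.add_apply, add_apply]
  exact map_add _ _ _

lemma SmoothHomAt.neg {f : N → M} {g : N → M'}
    {A : ∀ x, TangentSpace I (f x) →L[ℝ] TangentSpace I' (g x)} {x₀ : N}
    (hA : SmoothHomAt J I I' f g A x₀) :
    SmoothHomAt J I I' f g (fun x => -A x) x₀ := by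
  refine (contDiff_neg.contMDiff.contMDiffAt.comp x₀ hA).congr_of_eventuallyEq
    (.of_forall fun x => ?_)
  ext w
  simp only [homCoord, Function.comp,
    ContinuousLinearMap.comp_apply, neg_apply]
  exact map_neg _ _

lemma SmoothHomAt.precomp {EN' : Type*} [NormedAddCommGroup EN'] [NormedSpace ℝ EN']
    {HN' : Type*} [TopologicalSpace HN'] {J' : ModelWithCorners ℝ EN' HN'} {N' : Type*}
    [TopologicalSpace N'] [ChartedSpace HN' N'] {f : N → M} {g : N → M'}
    {A : ∀ x, TangentSpace I (f x) →L[ℝ] TangentSpace I' (g x)} {φ : N' → N} {y₀ : N'}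
    (hA : SmoothHomAt J I I' f g A (φ y₀)) (hφ : ContMDiffAt J' J ∞ φ y₀) :
    SmoothHomAt J' I I' (fun y => f (φ y)) (fun y => g (φ y)) (fun y => A (φ y)) y₀ :=
  ContMDiffAt.comp y₀ hA hφ

/-- A partial derivative depends smoothly on parameters. The infinitesimal action, the generators
and the vertical lift are all smooth through this. -/
lemma SmoothHomAt.mfderiv {f : N → M → M'} {g : N → M} {x₀ : N}
    (hf : ContMDiffAt (J.prod I) I' ∞ (Function.uncurry f) (x₀, g x₀))
    (hg : ContMDiffAt J I ∞ g x₀) (hN : IsManifold J ∞ N) :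
    SmoothHomAt J I I' g (fun x => f x (g x)) (fun x => mfderiv I I' (f x) (g x)) x₀ :=
  ContMDiffAt.mfderiv f g hf hg (by simp)

lemma SmoothHomAt.mfderiv_const {f : M → M'} {x₀ : M} (hf : ContMDiffAt I I' ∞ f x₀) :
    SmoothHomAt I I I' id f (fun x => _root_.mfderiv I I' f x) x₀ :=
  ContMDiffAt.mfderiv_const hf (by simp)

/-- Injectivity of a linear map between tangent spaces, read in coordinates. -/
lemma homCoord_injective {f : N → M} {g : N → M'}
    {A : ∀ x, TangentSpace I (f x) →L[ℝ] TangentSpace I' (g x)} {x₀ : N}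
    (h : Function.Injective (A x₀)) :
    Function.Injective (homCoord I I' f g A x₀ x₀) := by
  intro w w' hw
  simp only [homCoord,
    ContinuousLinearMap.comp_apply] at hw
  have h1 := congrArg ((trivializationAt E' (TangentSpace I') (g x₀)).symmL ℝ (g x₀)) hw
  rw [Trivialization.symmL_continuousLinearMapAt _ (mem_chart_source H' (g x₀)),
    Trivialization.symmL_continuousLinearMapAt _ (mem_chart_source H' (g x₀))] at h1
  have h2 := congrArg ((trivializationAt E (TangentSpace I) (f x₀)).continuousLinearMapAt ℝ (f x₀))
    (h h1)
  rwa [Trivialization.continuousLinearMapAt_symmL _ (mem_chart_source H (f x₀)),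
    Trivialization.continuousLinearMapAt_symmL _ (mem_chart_source H (f x₀))] at h2

/-- A family `X` with `S ∘ X = T`, where `S` and `T` are smooth and `S` is injective, is smooth. -/
lemma SmoothHomAt.of_comp_injective [FiniteDimensional ℝ E'] [FiniteDimensional ℝ E'']
    {f : N → M} {g : N → M'} {h : N → M''}
    {X : ∀ x, TangentSpace I (f x) →L[ℝ] TangentSpace I' (g x)}
    {S : ∀ x, TangentSpace I' (g x) →L[ℝ] TangentSpace I'' (h x)}
    {T : ∀ x, TangentSpace I (f x) →L[ℝ] TangentSpace I'' (h x)} {x₀ : N}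
    (hS : SmoothHomAt J I' I'' g h S x₀) (hT : SmoothHomAt J I I'' f h T x₀)
    (hg : ContinuousAt g x₀) (hinj : Function.Injective (S x₀))
    (hX : ∀ᶠ x in 𝓝 x₀, S x ∘L X x = T x) : SmoothHomAt J I I' f g X x₀ := by
  set s := homCoord I' I'' g h S x₀ with hs
  set t := homCoord I I'' f h T x₀ with ht
  -- A left inverse of `S` at the single point `x₀` suffices: `P' ∘ s` is the identity there, hence
  -- invertible nearby, and `X = (P' ∘ s)⁻¹ ∘ P' ∘ t`.
  obtain ⟨P, hP⟩ := LinearMap.exists_leftInverse_of_injective (s x₀).toLinearMap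
    (LinearMap.ker_eq_bot.2 (homCoord_injective hinj))
  let P' : E'' →L[ℝ] E' := LinearMap.toContinuousLinearMap P
  have hP' : P' ∘L s x₀ = (ContinuousLinearEquiv.refl ℝ E' : E' →L[ℝ] E') := by
    ext w
    exact congrArg (fun l : E' →ₗ[ℝ] E' => l w) hP
  have hPs : ContMDiffAt J 𝓘(ℝ, E' →L[ℝ] E') ∞ (fun x => P' ∘L s x) x₀ :=
    ContMDiffAt.clm_comp contMDiffAt_const hS
  have hPt : ContMDiffAt J 𝓘(ℝ, E →L[ℝ] E') ∞ (fun x => P' ∘L t x) x₀ :=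
    ContMDiffAt.clm_comp contMDiffAt_const hT
  have hinv : ContMDiffAt J 𝓘(ℝ, E' →L[ℝ] E') ∞
      (fun x => ContinuousLinearMap.inverse (P' ∘L s x)) x₀ := by
    have h1 : ContDiffAt ℝ ∞ ContinuousLinearMap.inverse (P' ∘L s x₀) := by
      rw [hP']
      exact contDiffAt_map_inverse _
    exact h1.contMDiffAt.comp x₀ hPs
  refine (ContMDiffAt.clm_comp hinv hPt).congr_of_eventuallyEq ?_
  have hnear : ∀ᶠ x in 𝓝 x₀, P' ∘L s x ∈ Set.range
      ((↑) : (E' ≃L[ℝ] E') → E' →L[ℝ] E') := by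
    refine hPs.continuousAt.eventually ?_
    change ∀ᶠ y in 𝓝 (P' ∘L s x₀), y ∈ Set.range ((↑) : (E' ≃L[ℝ] E') → E' →L[ℝ] E')
    rw [hP']
    exact ContinuousLinearEquiv.nhds _
  filter_upwards [hX, eventually_mem_chart_source (H' := H') hg, hnear] with x hx hgx ⟨e, he⟩
  have h2 : t x = s x ∘L homCoord I I' f g X x₀ x := by
    rw [hs, ← homCoord_comp hgx]
    simp only [ht, homCoord, hx]
  rw [h2, ← ContinuousLinearMap.comp_assoc P', ← he, ContinuousLinearMap.inverse_equiv,
    ← ContinuousLinearMap.comp_assoc, ContinuousLinearEquiv.coe_symm_comp_coe,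
    ContinuousLinearMap.id_comp]

/-- A family of maps between fixed vector spaces. -/
lemma smoothHomAt_model_iff {f : N → E} {g : N → E'} {A : N → E →L[ℝ] E'} {x₀ : N} :
    SmoothHomAt J 𝓘(ℝ, E) 𝓘(ℝ, E') f g A x₀ ↔ ContMDiffAt J 𝓘(ℝ, E →L[ℝ] E') ∞ A x₀ := by
  have h : homCoord 𝓘(ℝ, E) 𝓘(ℝ, E') f g A x₀ = A :=
    inTangentCoordinates_model_space (I := 𝓘(ℝ, E)) (I' := 𝓘(ℝ, E')) f g A x₀
  simp only [SmoothHomAt, h]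

lemma smoothHomAt_const {f : N → E} {g : N → E'} (A : E →L[ℝ] E') {x₀ : N} :
    SmoothHomAt J 𝓘(ℝ, E) 𝓘(ℝ, E') f g (fun _ => A) x₀ :=
  smoothHomAt_model_iff.2 contMDiffAt_const

/-- For maps into a fixed vector space the base map of the target is irrelevant. -/
lemma SmoothHomAt.target_model {f : N → M} {g : N → E'} (g' : N → E')
    {A : ∀ x, TangentSpace I (f x) →L[ℝ] TangentSpace 𝓘(ℝ, E') (g x)} {x₀ : N}
    (h : SmoothHomAt J I 𝓘(ℝ, E') f g A x₀) : SmoothHomAt J I 𝓘(ℝ, E') f g' (fun x => A x) x₀ := by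
  refine ContMDiffAt.congr_of_eventuallyEq h (.of_forall fun x => ?_)
  simp only [homCoord]
  erw [TangentBundle.continuousLinearMapAt_model_space,
    TangentBundle.continuousLinearMapAt_model_space]
  rfl

/-- For maps from a fixed vector space the base map of the source is irrelevant. -/
lemma SmoothHomAt.source_model {f : N → E} (f' : N → E) {g : N → M'}
    {A : ∀ x, TangentSpace 𝓘(ℝ, E) (f x) →L[ℝ] TangentSpace I' (g x)} {x₀ : N}
    (h : SmoothHomAt J 𝓘(ℝ, E) I' f g A x₀) :
    SmoothHomAt J 𝓘(ℝ, E) I' f' g (fun x => A x) x₀ := by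
  refine ContMDiffAt.congr_of_eventuallyEq h (.of_forall fun x => ?_)
  simp only [homCoord]
  erw [TangentBundle.symmL_model_space, TangentBundle.symmL_model_space]
  rfl

lemma SmoothHomAt.of_tensor {P : Type*} [TopologicalSpace P] [ChartedSpace E P]
    [IsManifold 𝓘(ℝ, E) ∞ P] {Ω : TensorField11 E P} (h : IsSmoothTensor Ω) (p : P) :
    SmoothHomAt 𝓘(ℝ, E) 𝓘(ℝ, E) 𝓘(ℝ, E) id id Ω p :=
  ((contMDiffAt_hom_bundle _).1 (h p)).2

lemma isSmoothTensor_of_smoothHomAt {P : Type*} [TopologicalSpace P] [ChartedSpace E P]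
    [IsManifold 𝓘(ℝ, E) ∞ P] {Ω : TensorField11 E P}
    (h : ∀ p, SmoothHomAt 𝓘(ℝ, E) 𝓘(ℝ, E) 𝓘(ℝ, E) id id Ω p) : IsSmoothTensor Ω :=
  fun p => (contMDiffAt_hom_bundle _).2 ⟨contMDiffAt_id, h p⟩

/-- Turns a smooth family of maps on a fixed space into smooth vector fields along `g`; this is how
the horizontal frame becomes smooth. -/
lemma SmoothHomAt.apply_model {f : N → E} {g : N → M'}
    {A : ∀ x, TangentSpace 𝓘(ℝ, E) (f x) →L[ℝ] TangentSpace I' (g x)} {x₀ : N}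
    (h : SmoothHomAt J 𝓘(ℝ, E) I' f g A x₀) (hg : ContMDiffAt J I' ∞ g x₀) (w : E) :
    ContMDiffAt J I'.tangent ∞ (fun x => (⟨g x, A x w⟩ : TangentBundle I' M')) x₀ := by
  refine contMDiffAt_totalSpace.2 ⟨hg, ?_⟩
  refine (ContMDiffAt.clm_apply (h.source_model (fun _ => 0)) (contMDiffAt_const (c := w))
    ).congr_of_eventuallyEq ?_
  filter_upwards [eventually_mem_chart_source (H' := H') hg.continuousAt] with x hx
  simp only [homCoord]
  erw [TangentBundle.symmL_model_space]
  exact (congrFun (Trivialization.coe_linearMapAt_of_mem (R := ℝ)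
    (trivializationAt E' (TangentSpace I') (g x₀)) hx) _).symm

end SmoothHom

end

noncomputable section

/-! ### The tangent bundle of a tangent bundle -/

section DoubleTangent

variable {E : Type*} [NormedAddCommGroup E] [NormedSpace ℝ E]
  {M : Type*} [TopologicalSpace M] [ChartedSpace E M] [IsManifold 𝓘(ℝ, E) ∞ M]
  {EX : Type*} [NormedAddCommGroup EX] [NormedSpace ℝ EX] {HX : Type*} [TopologicalSpace HX]
  {J : ModelWithCorners ℝ EX HX} {X : Type*} [TopologicalSpace X] [ChartedSpace HX X]

/-- The fibre coordinates on `TM` over the preferred chart at `m`. -/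
def fibreCoord (m : M) (u : TangentBundle 𝓘(ℝ, E) M) : E :=
  (trivializationAt E (TangentSpace 𝓘(ℝ, E)) m u).2

lemma fibreCoord_self (u : TangentBundle 𝓘(ℝ, E) M) : fibreCoord u.proj u = u.2 :=
  (tangentBundleCore 𝓘(ℝ, E) M).coordChange_self (achart E u.proj) u.proj
    (mem_achart_source E u.proj) u.2

lemma fibreCoord_eq_mfderiv {m : M} {u : TangentBundle 𝓘(ℝ, E) M}
    (hu : u.proj ∈ (chartAt E m).source) :
    fibreCoord m u = mfderiv 𝓘(ℝ, E) 𝓘(ℝ, E) (extChartAt 𝓘(ℝ, E) m) u.proj u.2 := by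
  rw [← TangentBundle.continuousLinearMapAt_trivializationAt hu]
  exact (congrFun (Trivialization.coe_linearMapAt_of_mem (R := ℝ)
    (trivializationAt E (TangentSpace 𝓘(ℝ, E)) m) hu) _).symm

lemma mdifferentiableAt_fibreCoord {s : X → TangentBundle 𝓘(ℝ, E) M} {x : X}
    (hs : MDifferentiableAt J 𝓘(ℝ, E).tangent s x) :
    MDifferentiableAt J 𝓘(ℝ, E) (fun y => fibreCoord (s x).proj (s y)) x :=
  ((mdifferentiableAt_totalSpace 𝓘(ℝ, E) s).1 hs).2

/-- The derivative of a map into `TM` in the coordinates of `T(TM)`. -/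
lemma mfderiv_into_tangentBundle {s : X → TangentBundle 𝓘(ℝ, E) M} {x : X}
    (hs : MDifferentiableAt J 𝓘(ℝ, E).tangent s x) (ζ : TangentSpace J x) :
    (mfderiv J 𝓘(ℝ, E).tangent s x ζ : E × E) =
      ((mfderiv J 𝓘(ℝ, E) (fun y => (s y).proj) x ζ : E),
        (mfderiv J 𝓘(ℝ, E) (fun y => fibreCoord (s x).proj (s y)) x ζ : E)) := by
  have h1 : MDifferentiableAt J 𝓘(ℝ, E) (fun y => (s y).proj) x :=
    ((mdifferentiableAt_totalSpace 𝓘(ℝ, E) s).1 hs).1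
  have h2 := mdifferentiableAt_fibreCoord hs
  have e0 : (mfderiv J 𝓘(ℝ, E).tangent s x : EX →L[ℝ] E × E) =
    fderivWithin ℝ (writtenInExtChartAt J 𝓘(ℝ, E).tangent x s) (Set.range J)
      (extChartAt J x x) := hs.mfderiv
  have e1 : (mfderiv J 𝓘(ℝ, E) (fun y => (s y).proj) x : EX →L[ℝ] E) =
    fderivWithin ℝ (writtenInExtChartAt J 𝓘(ℝ, E) x fun y => (s y).proj) (Set.range J)
      (extChartAt J x x) := h1.mfderiv
  have e2 : (mfderiv J 𝓘(ℝ, E) (fun y => fibreCoord (s x).proj (s y)) x : EX →L[ℝ] E) =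
    fderivWithin ℝ (writtenInExtChartAt J 𝓘(ℝ, E) x fun y => fibreCoord (s x).proj (s y))
      (Set.range J) (extChartAt J x x) := h2.mfderiv
  have d1 := h1.differentiableWithinAt_writtenInExtChartAt
  have d2 := h2.differentiableWithinAt_writtenInExtChartAt
  -- In the charts of `TM` the expression of `s` is the pair of the expressions of its base point
  -- and of its fibre coordinate.
  have key := d1.fderivWithin_prodMk d2 J.uniqueDiffWithinAt_image
  exact congrArg (fun l : EX →L[ℝ] E × E => l ζ)
    (e0.trans (key.trans (congrArg₂ ContinuousLinearMap.prod e1.symm e2.symm)))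

/-- The coordinate formula for maps into `TM`, applied to the identity. -/
lemma mfderiv_tangentBundle_proj (v : TangentBundle 𝓘(ℝ, E) M)
    (W : TangentSpace 𝓘(ℝ, E).tangent v) :
    mfderiv 𝓘(ℝ, E).tangent 𝓘(ℝ, E)
      (fun u : TangentBundle 𝓘(ℝ, E) M => u.proj) v W = (W : E × E).1 := by
  have h := mfderiv_into_tangentBundle (s := (id : TangentBundle 𝓘(ℝ, E) M → _)) (x := v)
    mdifferentiableAt_id W
  rw [mfderiv_id] at h
  exact (congrArg Prod.fst h).symm

/-- The inclusion of a fibre in the tangent bundle. -/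
def fibreIncl (m : M) (y : E) : TangentBundle 𝓘(ℝ, E) M := ⟨m, y⟩

lemma contMDiff_fibreIncl (m : M) :
    ContMDiff 𝓘(ℝ, E) 𝓘(ℝ, E).tangent ∞ (fibreIncl (E := E) m) := by
  intro y
  refine contMDiffAt_totalSpace.2 ⟨contMDiffAt_const, ?_⟩
  refine contMDiffAt_id.congr_of_eventuallyEq (.of_forall fun z => ?_)
  exact fibreCoord_self (fibreIncl m z)

/-- The derivative of the inclusion of a fibre. -/
def fibreInclDeriv (m : M) (y : E) : E →L[ℝ] E × E :=
  mfderiv 𝓘(ℝ, E) 𝓘(ℝ, E).tangent (fibreIncl (E := E) m) y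

/-- The vertical lift as a continuous linear map. -/
def vlift (v : TangentBundle 𝓘(ℝ, E) M) :
    TangentSpace 𝓘(ℝ, E) v.proj →L[ℝ] TangentSpace 𝓘(ℝ, E).tangent v :=
  fibreInclDeriv (E := E) v.proj v.2

lemma hasMFDerivAt_fibreIncl (m : M) (y : E) :
    HasMFDerivAt 𝓘(ℝ, E) 𝓘(ℝ, E).tangent (fibreIncl (E := E) m) y (fibreInclDeriv (E := E) m y) :=
  ((contMDiff_fibreIncl m).mdifferentiable (by simp) _).hasMFDerivAt

lemma fibreInclDeriv_apply (m : M) (y w : E) : fibreInclDeriv (E := E) m y w = (0, w) := by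
  have h := mfderiv_into_tangentBundle (s := fibreIncl (E := E) m) (x := y)
    ((contMDiff_fibreIncl m).mdifferentiable (by simp) _) w
  refine h.trans (Prod.ext ?_ ?_)
  · change mfderiv 𝓘(ℝ, E) 𝓘(ℝ, E) (fun _ : E => m) y w = 0
    rw [mfderiv_const]; rfl
  · have : (fun z : E => fibreCoord (fibreIncl (E := E) m y).proj (fibreIncl m z))
        = id := funext fun z => fibreCoord_self (fibreIncl m z)
    change mfderiv 𝓘(ℝ, E) 𝓘(ℝ, E) (fun z : E =>
      fibreCoord (fibreIncl (E := E) m y).proj (fibreIncl m z)) y w = w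
    rw [this, mfderiv_id]; rfl

lemma vlift_eq (v : TangentBundle 𝓘(ℝ, E) M) (w : TangentSpace 𝓘(ℝ, E) v.proj) :
    (vlift v w : E × E) = (0, w) := fibreInclDeriv_apply (E := E) v.proj v.2 w

lemma mfderiv_fibreIncl_line (m : M) (y w : E) :
    (mfderiv 𝓘(ℝ, ℝ) 𝓘(ℝ, E).tangent (fun t : ℝ => fibreIncl (E := E) m (y + t • w)) 0 (1 : ℝ) :
      E × E) = fibreInclDeriv (E := E) m y w := by
  have hc : HasDerivAt (fun t : ℝ => y + t • w) w 0 := by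
    simpa using ((hasDerivAt_id (0 : ℝ)).smul_const w).const_add y
  have h2 : HasMFDerivAt 𝓘(ℝ, E) 𝓘(ℝ, E).tangent (fibreIncl (E := E) m) (y + (0 : ℝ) • w)
      (fibreInclDeriv (E := E) m y) := by
    rw [zero_smul, add_zero]; exact hasMFDerivAt_fibreIncl m y
  have h3 := (HasMFDerivAt.comp (0 : ℝ) (f := fun t : ℝ => y + t • w) h2
    hc.hasFDerivAt.hasMFDerivAt).mfderiv
  refine (congrArg (fun l : ℝ →L[ℝ] E × E => l 1) h3).trans ?_
  change fibreInclDeriv (E := E) m y ((1 : ℝ) • w) = fibreInclDeriv (E := E) m y w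
  rw [one_smul]

lemma verticalLift_eq_vlift (v : TangentBundle 𝓘(ℝ, E) M) (w : TangentSpace 𝓘(ℝ, E) v.proj) :
    verticalLift v w = vlift v w := mfderiv_fibreIncl_line (E := E) v.proj v.2 w

lemma vlift_injective (v : TangentBundle 𝓘(ℝ, E) M) : Function.Injective (vlift v) := by
  intro a b h
  have h1 := (vlift_eq v a).symm.trans (h.trans (vlift_eq v b))
  exact congrArg Prod.snd h1

lemma mfderiv_proj_vlift (v : TangentBundle 𝓘(ℝ, E) M) (w : TangentSpace 𝓘(ℝ, E) v.proj) :
    mfderiv 𝓘(ℝ, E).tangent 𝓘(ℝ, E)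
      (fun u : TangentBundle 𝓘(ℝ, E) M => u.proj) v (vlift v w) = 0 := by
  rw [mfderiv_tangentBundle_proj, vlift_eq]; rfl

/-- In coordinates vertical vectors and vertical lifts are both the pairs `(0, w)`. Later arguments
produce vertical lifts by subtracting two vectors with the same base velocity. -/
lemma exists_vlift_of_mfderiv_proj_eq_zero (v : TangentBundle 𝓘(ℝ, E) M)
    (W : TangentSpace 𝓘(ℝ, E).tangent v)
    (h : mfderiv 𝓘(ℝ, E).tangent 𝓘(ℝ, E)
      (fun u : TangentBundle 𝓘(ℝ, E) M => u.proj) v W = 0) : ∃ w, W = vlift v w := by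
  rw [mfderiv_tangentBundle_proj] at h
  refine ⟨(W : E × E).2, ?_⟩
  have h2 := vlift_eq v (W : E × E).2
  refine Eq.trans ?_ h2.symm
  exact Prod.ext h rfl

lemma mfderiv_tangentBundle_proj_surjective (v : TangentBundle 𝓘(ℝ, E) M) :
    Function.Surjective (mfderiv 𝓘(ℝ, E).tangent 𝓘(ℝ, E)
      (fun u : TangentBundle 𝓘(ℝ, E) M => u.proj) v) := by
  intro w
  exact ⟨((w, 0) : E × E), mfderiv_tangentBundle_proj v _⟩

/-- The vertical lift is natural. -/
lemma mfderiv_tangentMap_vlift {E' : Type*} [NormedAddCommGroup E'] [NormedSpace ℝ E']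
    {M' : Type*} [TopologicalSpace M'] [ChartedSpace E' M'] [IsManifold 𝓘(ℝ, E') ∞ M']
    {f : M → M'} (hf : ContMDiff 𝓘(ℝ, E) 𝓘(ℝ, E') ∞ f) (v : TangentBundle 𝓘(ℝ, E) M)
    (w : TangentSpace 𝓘(ℝ, E) v.proj) :
    mfderiv 𝓘(ℝ, E).tangent 𝓘(ℝ, E').tangent (tangentMap 𝓘(ℝ, E) 𝓘(ℝ, E') f) v (vlift v w) =
      vlift (tangentMap 𝓘(ℝ, E) 𝓘(ℝ, E') f v) (mfderiv 𝓘(ℝ, E) 𝓘(ℝ, E') f v.proj w) := by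
  have hT : ContMDiff 𝓘(ℝ, E).tangent 𝓘(ℝ, E').tangent ∞ (tangentMap 𝓘(ℝ, E) 𝓘(ℝ, E') f) :=
    hf.contMDiff_tangentMap (by simp)
  obtain ⟨m, y⟩ := v
  change E at y
  let D : E →L[ℝ] E' := mfderiv 𝓘(ℝ, E) 𝓘(ℝ, E') f m
  have h1 := HasMFDerivAt.comp y (f := fibreIncl (E := E) m)
    (g := tangentMap 𝓘(ℝ, E) 𝓘(ℝ, E') f)
    ((hT.mdifferentiable (by simp) _).hasMFDerivAt) (hasMFDerivAt_fibreIncl m y)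
  -- The tangent map is linear on each fibre, so the composites differentiated in `h1` and `h2` are
  -- the same map.
  have h2 := HasMFDerivAt.comp y (f := D) (g := fibreIncl (f m))
    (hasMFDerivAt_fibreIncl (E := E') (f m) (D y)) (D.hasFDerivAt (x := y)).hasMFDerivAt
  exact congrArg (fun l : E →L[ℝ] E' × E' => l w) (hasMFDerivAt_unique h1 h2)

/-- Differentiate `τ' ∘ Tf = f ∘ τ`. -/
lemma mfderiv_proj_tangentMap {E' : Type*} [NormedAddCommGroup E'] [NormedSpace ℝ E']
    {M' : Type*} [TopologicalSpace M'] [ChartedSpace E' M'] [IsManifold 𝓘(ℝ, E') ∞ M']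
    {f : M → M'} (hf : ContMDiff 𝓘(ℝ, E) 𝓘(ℝ, E') ∞ f) (v : TangentBundle 𝓘(ℝ, E) M)
    (W : TangentSpace 𝓘(ℝ, E).tangent v) :
    mfderiv 𝓘(ℝ, E').tangent 𝓘(ℝ, E') (fun u : TangentBundle 𝓘(ℝ, E') M' => u.proj)
        (tangentMap 𝓘(ℝ, E) 𝓘(ℝ, E') f v)
        (mfderiv 𝓘(ℝ, E).tangent 𝓘(ℝ, E').tangent (tangentMap 𝓘(ℝ, E) 𝓘(ℝ, E') f) v W) =
      mfderiv 𝓘(ℝ, E) 𝓘(ℝ, E') f v.proj (mfderiv 𝓘(ℝ, E).tangent 𝓘(ℝ, E)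
        (fun u : TangentBundle 𝓘(ℝ, E) M => u.proj) v W) := by
  have hT : ContMDiff 𝓘(ℝ, E).tangent 𝓘(ℝ, E').tangent ∞ (tangentMap 𝓘(ℝ, E) 𝓘(ℝ, E') f) :=
    hf.contMDiff_tangentMap (by simp)
  have h1 := HasMFDerivAt.comp v
    (((contMDiff_proj (n := ∞) (TangentSpace 𝓘(ℝ, E') : M' → Type _)).mdifferentiable (by simp)
      (tangentMap 𝓘(ℝ, E) 𝓘(ℝ, E') f v)).hasMFDerivAt)
    ((hT.mdifferentiable (by simp) v).hasMFDerivAt)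
  have h2 := HasMFDerivAt.comp v
    ((hf.mdifferentiable (by simp) v.proj).hasMFDerivAt)
    (((contMDiff_proj (n := ∞) (TangentSpace 𝓘(ℝ, E) : M → Type _)).mdifferentiable (by simp)
      v).hasMFDerivAt)
  exact congrArg (fun l : E × E →L[ℝ] E' => l W) (hasMFDerivAt_unique h1 h2)

/-- Permits rewriting the base points of the targets, for instance `1 • m` into `m`. The maps are
typed over the model spaces so that the same family makes sense for both base maps. -/
lemma homCoord_congr_target {EN : Type*} [NormedAddCommGroup EN] [NormedSpace ℝ EN]
    {HN : Type*} [TopologicalSpace HN] {J : ModelWithCorners ℝ EN HN} {N : Type*}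
    [TopologicalSpace N] [ChartedSpace HN N]
    {E₁ : Type*} [NormedAddCommGroup E₁] [NormedSpace ℝ E₁] {H₁ : Type*} [TopologicalSpace H₁]
    {I₁ : ModelWithCorners ℝ E₁ H₁} {M₁ : Type*} [TopologicalSpace M₁] [ChartedSpace H₁ M₁]
    [IsManifold I₁ ∞ M₁]
    {E₂ : Type*} [NormedAddCommGroup E₂] [NormedSpace ℝ E₂] {H₂ : Type*} [TopologicalSpace H₂]
    {I₂ : ModelWithCorners ℝ E₂ H₂} {M₂ : Type*} [TopologicalSpace M₂] [ChartedSpace H₂ M₂]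
    [IsManifold I₂ ∞ M₂] {f : N → M₁} {g g' : N → M₂} {A : N → E₁ →L[ℝ] E₂} {x₀ : N}
    (h : SmoothHomAt J I₁ I₂ f g (fun x => A x) x₀) (hg : g' =ᶠ[𝓝 x₀] g) :
    SmoothHomAt J I₁ I₂ f g' (fun x => A x) x₀ := by
  refine ContMDiffAt.congr_of_eventuallyEq h ?_
  have key : ∀ (z₀ z z₀' z' : M₂) (B : E₁ →L[ℝ] E₂) (x : N), z₀' = z₀ → z' = z →
      ContinuousLinearMap.inCoordinates E₁ (TangentSpace I₁) E₂ (TangentSpace I₂) (f x₀) (f x)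
        z₀' z' B = ContinuousLinearMap.inCoordinates E₁ (TangentSpace I₁) E₂ (TangentSpace I₂)
        (f x₀) (f x) z₀ z B := by
    rintro z₀ z _ _ B x rfl rfl
    rfl
  filter_upwards [hg] with x hx
  exact key _ _ _ _ (A x) x hg.self_of_nhds hx

/-- The vertical lift is smooth. -/
lemma smoothHomAt_vlift (v₀ : TangentBundle 𝓘(ℝ, E) M) :
    SmoothHomAt 𝓘(ℝ, E).tangent 𝓘(ℝ, E) 𝓘(ℝ, E).tangent
      (fun v : TangentBundle 𝓘(ℝ, E) M => v.proj) id vlift v₀ := by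
  let e := trivializationAt E (TangentSpace 𝓘(ℝ, E)) v₀.proj
  -- `Φ v` is the inclusion of the fibre through `v`, read in the trivialization at `v₀`, and is
  -- jointly smooth in both variables. The vertical lift is the derivative of `Φ v` at the
  -- coordinate `z v`, composed with the derivative of the chart.
  let Φ : TangentBundle 𝓘(ℝ, E) M → E → TangentBundle 𝓘(ℝ, E) M :=
    fun v z => e.toOpenPartialHomeomorph.symm (v.proj, z)
  let z : TangentBundle 𝓘(ℝ, E) M → E := fibreCoord v₀.proj
  have hproj : ContMDiff 𝓘(ℝ, E).tangent 𝓘(ℝ, E) ∞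
    (fun v : TangentBundle 𝓘(ℝ, E) M => v.proj) := contMDiff_proj (TangentSpace 𝓘(ℝ, E))
  have hbase : ∀ᶠ v in 𝓝 v₀, v.proj ∈ (chartAt E v₀.proj).source :=
    eventually_mem_chart_source (H' := E) hproj.continuous.continuousAt
  have hz : ContMDiffAt 𝓘(ℝ, E).tangent 𝓘(ℝ, E) ∞ z v₀ :=
    (contMDiffAt_totalSpace.1 (contMDiffAt_id (x := v₀))).2
  have hΦ : ContMDiffAt (𝓘(ℝ, E).tangent.prod 𝓘(ℝ, E)) 𝓘(ℝ, E).tangent ∞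
      (Function.uncurry Φ) (v₀, z v₀) := by
    have h1 : ContMDiffAt (𝓘(ℝ, E).prod 𝓘(ℝ, E)) 𝓘(ℝ, E).tangent ∞
        e.toOpenPartialHomeomorph.symm (v₀.proj, z v₀) :=
      (e.contMDiffOn_symm).contMDiffAt (e.open_target.mem_nhds
        (e.mem_target.2 (mem_chart_source E v₀.proj)))
    exact h1.comp (v₀, z v₀) (f := fun q : TangentBundle 𝓘(ℝ, E) M × E => (q.1.proj, q.2))
      ((hproj.contMDiffAt.comp (v₀, z v₀) contMDiffAt_fst).prodMk contMDiffAt_snd)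
  have hA := SmoothHomAt.mfderiv hΦ hz inferInstance
  have hid : (id : TangentBundle 𝓘(ℝ, E) M → TangentBundle 𝓘(ℝ, E) M) =ᶠ[𝓝 v₀]
      fun v => Φ v (z v) := by
    filter_upwards [hbase] with v hv
    exact (e.symm_apply_mk_proj (e.mem_source.2 hv)).symm
  have hA' := homCoord_congr_target (A := fun v => mfderiv 𝓘(ℝ, E) 𝓘(ℝ, E).tangent (Φ v) (z v))
    hA hid
  have hB : SmoothHomAt 𝓘(ℝ, E).tangent 𝓘(ℝ, E) 𝓘(ℝ, E)
      (fun v : TangentBundle 𝓘(ℝ, E) M => v.proj) z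
      (fun v => mfderiv 𝓘(ℝ, E) 𝓘(ℝ, E) (extChartAt 𝓘(ℝ, E) v₀.proj) v.proj) v₀ :=
    (SmoothHomAt.precomp (SmoothHomAt.mfderiv_const
      (contMDiffAt_extChartAt (I := 𝓘(ℝ, E)) (n := ∞) (x := v₀.proj)))
      hproj.contMDiffAt).target_model z
  refine (SmoothHomAt.comp hA' hB hz.continuousAt).congr ?_
  filter_upwards [hbase] with v hv
  obtain ⟨m, y⟩ := v
  change E at y
  let S : E →L[ℝ] E := e.symmL ℝ m
  -- Over `m` the two descriptions of the fibre inclusion differ by the linear coordinate change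
  -- `S`, which inverts the derivative of the chart.
  have hΦm : Φ ⟨m, y⟩ = fibreIncl m ∘ S := by
    funext t
    change e.toOpenPartialHomeomorph.symm (m, t) = ⟨m, e.symmL ℝ m t⟩
    rw [← e.mk_symm hv, Trivialization.symmL_apply (R := ℝ) e hv]
  have hS : S (z ⟨m, y⟩) = y := by
    change e.symmL ℝ m (e ⟨m, y⟩).2 = y
    rw [Trivialization.symmL_apply (R := ℝ) e hv]
    exact e.symm_apply_apply_mk hv y
  have hi : HasMFDerivAt 𝓘(ℝ, E) 𝓘(ℝ, E).tangent (fibreIncl (E := E) m) (S (z ⟨m, y⟩))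
      (fibreInclDeriv (E := E) m y) := by
    rw [hS]; exact hasMFDerivAt_fibreIncl m y
  have h1 : HasMFDerivAt 𝓘(ℝ, E) 𝓘(ℝ, E).tangent (Φ ⟨m, y⟩) (z ⟨m, y⟩)
      ((fibreInclDeriv (E := E) m y) ∘L S) := by
    rw [hΦm]
    exact HasMFDerivAt.comp (z ⟨m, y⟩) hi (S.hasFDerivAt).hasMFDerivAt
  have h2 : (mfderiv 𝓘(ℝ, E) 𝓘(ℝ, E).tangent (Φ ⟨m, y⟩) (z ⟨m, y⟩) : E →L[ℝ] E × E) =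
      (fibreInclDeriv (E := E) m y) ∘L S := h1.mfderiv
  ext w
  have h3 : S ((mfderiv 𝓘(ℝ, E) 𝓘(ℝ, E) (extChartAt 𝓘(ℝ, E) v₀.proj) m : E →L[ℝ] E) w) = w := by
    have h4 := TangentBundle.continuousLinearMapAt_trivializationAt (I := 𝓘(ℝ, E)) hv
    have h5 := Trivialization.symmL_continuousLinearMapAt (R := ℝ) e hv (w : E)
    rw [h4] at h5
    exact h5
  refine Eq.symm ((congrArg (fun l : E →L[ℝ] E × E =>
    l ((mfderiv 𝓘(ℝ, E) 𝓘(ℝ, E) (extChartAt 𝓘(ℝ, E) v₀.proj) m : E →L[ℝ] E) w)) h2).trans ?_)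
  exact congrArg (fibreInclDeriv (E := E) m y) h3

end DoubleTangent

end

noncomputable section

/-! ### Symmetry of mixed derivatives -/

section Mixed

variable {F : Type*} [NormedAddCommGroup F] [NormedSpace ℝ F]
  {X : Type*} [TopologicalSpace X] [ChartedSpace F X] [IsManifold 𝓘(ℝ, F) ∞ X]
  {E : Type*} [NormedAddCommGroup E] [NormedSpace ℝ E]
  {Y : Type*} [TopologicalSpace Y] [ChartedSpace E Y] [IsManifold 𝓘(ℝ, E) ∞ Y]
  {E' : Type*} [NormedAddCommGroup E'] [NormedSpace ℝ E']

lemma fderiv_partial_right {Ψ : F × E → E'} {s : F} {b : E}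
    (h : DifferentiableAt ℝ Ψ (s, b)) (η : E) :
    fderiv ℝ (fun t => Ψ (s, t)) b η = fderiv ℝ Ψ (s, b) (0, η) := by
  have h1 := h.hasFDerivAt.comp b (hasFDerivAt_prodMk_right s b)
  exact congrArg (fun l : E →L[ℝ] E' => l η) h1.fderiv

lemma fderiv_partial_left {Ψ : F × E → E'} {s : F} {b : E}
    (h : DifferentiableAt ℝ Ψ (s, b)) (ξ : F) :
    fderiv ℝ (fun t => Ψ (t, b)) s ξ = fderiv ℝ Ψ (s, b) (ξ, 0) := by
  have h1 := HasFDerivAt.comp s (f := fun e : F => (e, b)) h.hasFDerivAt (hasFDerivAt_prodMk_left s b)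
  exact congrArg (fun l : F →L[ℝ] E' => l ξ) h1.fderiv

lemma ContDiffAt.eventually_differentiableAt {Ψ : F → E'} {x : F} (h : ContDiffAt ℝ ∞ Ψ x) :
    ∀ᶠ q in 𝓝 x, DifferentiableAt ℝ Ψ q := by
  filter_upwards [(h.of_le (m := 1) (by simp)).eventually (by simp)] with q hq
  exact hq.differentiableAt (by simp)

/-- Near `a` the inner derivative is the total derivative of `Ψ` evaluated at `(0, η)`, so the outer
one is a value of the second derivative. -/
lemma differentiableAt_partial_right {Ψ : F × E → E'} {a : F} {b : E}
    (h : ContDiffAt ℝ ∞ Ψ (a, b)) (η : E) :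
    DifferentiableAt ℝ (fun s => fderiv ℝ (fun t => Ψ (s, t)) b η) a ∧
      ∀ ξ, fderiv ℝ (fun s => fderiv ℝ (fun t => Ψ (s, t)) b η) a ξ =
        fderiv ℝ (fderiv ℝ Ψ) (a, b) (ξ, 0) (0, η) := by
  have h2 : DifferentiableAt ℝ (fderiv ℝ Ψ) (a, b) :=
    (h.fderiv_right (m := ∞) (by simp)).differentiableAt (by simp)
  have h1 : (fun s => fderiv ℝ (fun t => Ψ (s, t)) b η) =ᶠ[𝓝 a]
      fun s => fderiv ℝ Ψ (s, b) (0, η) := by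
    have hc : Filter.Tendsto (fun s : F => (s, b)) (𝓝 a) (𝓝 (a, b)) :=
      (Continuous.prodMk_left b).continuousAt
    filter_upwards [hc.eventually h.eventually_differentiableAt] with s hs
    exact fderiv_partial_right hs η
  have h3 := ((h2.hasFDerivAt.comp a (hasFDerivAt_prodMk_left a b)).clm_apply
    (hasFDerivAt_const ((0, η) : F × E) a)).congr_of_eventuallyEq h1
  refine ⟨h3.differentiableAt, fun ξ => ?_⟩
  rw [h3.fderiv]
  simp

/-- Both sides are values of the second derivative of `Ψ` on the pair `(ξ, 0)`, `(0, η)`, in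
opposite orders; that derivative is symmetric. -/
lemma fderiv_fderiv_comm {Ψ : F × E → E'} {a : F} {b : E}
    (h : ContDiffAt ℝ ∞ Ψ (a, b)) (ξ : F) (η : E) :
    fderiv ℝ (fun s => fderiv ℝ (fun t => Ψ (s, t)) b η) a ξ =
      fderiv ℝ (fun t => fderiv ℝ (fun s => Ψ (s, t)) a ξ) b η := by
  let Ψ' : E × F → E' := fun q => Ψ (q.2, q.1)
  let sw : E × F →L[ℝ] F × E := (ContinuousLinearMap.snd ℝ E F).prod (ContinuousLinearMap.fst ℝ E F)
  have h' : ContDiffAt ℝ ∞ Ψ' (b, a) :=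
    ContDiffAt.comp (g := Ψ) (b, a) h sw.contDiff.contDiffAt
  have h2 : DifferentiableAt ℝ (fderiv ℝ Ψ) (a, b) :=
    (h.fderiv_right (m := ∞) (by simp)).differentiableAt (by simp)
  rw [(differentiableAt_partial_right h η).2 ξ]
  have h1 : (fun t => fderiv ℝ (fun s => Ψ (s, t)) a ξ) =ᶠ[𝓝 b]
      fun t => fderiv ℝ Ψ (a, t) (ξ, 0) := by
    have hc : Filter.Tendsto (fun t : E => (a, t)) (𝓝 b) (𝓝 (a, b)) :=
      (Continuous.prodMk_right a).continuousAt
    filter_upwards [hc.eventually h.eventually_differentiableAt] with s hs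
    exact fderiv_partial_left hs ξ
  have h3 := ((h2.hasFDerivAt.comp b (hasFDerivAt_prodMk_right a b)).clm_apply
    (hasFDerivAt_const ((ξ, 0) : F × E) b)).congr_of_eventuallyEq h1
  rw [h3.fderiv]
  have hs := h.isSymmSndFDerivAt (by simp; exact ENat.LEInfty.out) (ξ, 0) (0, η)
  simpa using hs

lemma mfderiv_eq_fderiv_comp_extChartAt_symm {h : X → E'} {a : X}
    (hh : MDifferentiableAt 𝓘(ℝ, F) 𝓘(ℝ, E') h a) (ξ : F) :
    (mfderiv 𝓘(ℝ, F) 𝓘(ℝ, E') h a ξ : E') =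
      fderiv ℝ (fun s => h ((extChartAt 𝓘(ℝ, F) a).symm s)) (extChartAt 𝓘(ℝ, F) a a) ξ := by
  have e1 : (mfderiv 𝓘(ℝ, F) 𝓘(ℝ, E') h a : F →L[ℝ] E') =
      fderivWithin ℝ (writtenInExtChartAt 𝓘(ℝ, F) 𝓘(ℝ, E') a h) (Set.range 𝓘(ℝ, F))
        (extChartAt 𝓘(ℝ, F) a a) := hh.mfderiv
  rw [modelWithCornersSelf_coe, Set.range_id, fderivWithin_univ] at e1
  exact congrArg (fun l : F →L[ℝ] E' => l ξ) e1

lemma contDiffAt_charts {Φ : X → Y → E'} {a : X} {b : Y}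
    (h : ContMDiffAt (𝓘(ℝ, F).prod 𝓘(ℝ, E)) 𝓘(ℝ, E') ∞ (Function.uncurry Φ) (a, b)) :
    ContDiffAt ℝ ∞ (fun q : F × E =>
      Φ ((extChartAt 𝓘(ℝ, F) a).symm q.1) ((extChartAt 𝓘(ℝ, E) b).symm q.2))
      (extChartAt 𝓘(ℝ, F) a a, extChartAt 𝓘(ℝ, E) b b) := by
  rw [← contMDiffAt_iff_contDiffAt]
  have h1 : ContMDiffAt 𝓘(ℝ, F) 𝓘(ℝ, F) ∞ (extChartAt 𝓘(ℝ, F) a).symm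
      (extChartAt 𝓘(ℝ, F) a a) :=
    (contMDiffOn_extChartAt_symm a).contMDiffAt (extChartAt_target_mem_nhds a)
  have h2 : ContMDiffAt 𝓘(ℝ, E) 𝓘(ℝ, E) ∞ (extChartAt 𝓘(ℝ, E) b).symm
      (extChartAt 𝓘(ℝ, E) b b) :=
    (contMDiffOn_extChartAt_symm b).contMDiffAt (extChartAt_target_mem_nhds b)
  have hq1 : ContMDiffAt 𝓘(ℝ, F × E) 𝓘(ℝ, F) ∞ (Prod.fst : F × E → F)
      (extChartAt 𝓘(ℝ, F) a a, extChartAt 𝓘(ℝ, E) b b) := contDiffAt_fst.contMDiffAt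
  have hq2 : ContMDiffAt 𝓘(ℝ, F × E) 𝓘(ℝ, E) ∞ (Prod.snd : F × E → E)
      (extChartAt 𝓘(ℝ, F) a a, extChartAt 𝓘(ℝ, E) b b) := contDiffAt_snd.contMDiffAt
  have h3 := (ContMDiffAt.comp (extChartAt 𝓘(ℝ, F) a a, extChartAt 𝓘(ℝ, E) b b) h1 hq1).prodMk
    (ContMDiffAt.comp (extChartAt 𝓘(ℝ, F) a a, extChartAt 𝓘(ℝ, E) b b) h2 hq2)
  refine ContMDiffAt.comp (I' := 𝓘(ℝ, F).prod 𝓘(ℝ, E)) _ (g := Function.uncurry Φ) ?_ h3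
  simpa using h

lemma mfderiv_partial_right {Φ : X → Y → E'} {a : X} {b : Y}
    (h : ContMDiffAt (𝓘(ℝ, F).prod 𝓘(ℝ, E)) 𝓘(ℝ, E') ∞ (Function.uncurry Φ) (a, b)) (η : E)
    (ξ : F) :
    (mfderiv 𝓘(ℝ, F) 𝓘(ℝ, E') (fun x => (mfderiv 𝓘(ℝ, E) 𝓘(ℝ, E') (Φ x) b η : E')) a ξ : E') =
      fderiv ℝ (fun s => fderiv ℝ (fun t =>
        Φ ((extChartAt 𝓘(ℝ, F) a).symm s) ((extChartAt 𝓘(ℝ, E) b).symm t))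
        (extChartAt 𝓘(ℝ, E) b b) η) (extChartAt 𝓘(ℝ, F) a a) ξ := by
  have hΨ := contDiffAt_charts h
  set Ψ := fun q : F × E =>
      Φ ((extChartAt 𝓘(ℝ, F) a).symm q.1) ((extChartAt 𝓘(ℝ, E) b).symm q.2) with hΨdef
  obtain ⟨hd, -⟩ := differentiableAt_partial_right hΨ η
  have hev : ∀ᶠ x in 𝓝 a, (mfderiv 𝓘(ℝ, E) 𝓘(ℝ, E') (Φ x) b η : E') =
      fderiv ℝ (fun t => Φ x ((extChartAt 𝓘(ℝ, E) b).symm t)) (extChartAt 𝓘(ℝ, E) b b) η := by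
    have hc : Filter.Tendsto (fun x : X => (x, b)) (𝓝 a) (𝓝 (a, b)) :=
      (Continuous.prodMk_left b).continuousAt
    filter_upwards [hc.eventually ((contMDiffAt_iff_contMDiffAt_nhds (n := 1) (by simp)).1 (h.of_le (by simp)))] with x hx
    refine mfderiv_eq_fderiv_comp_extChartAt_symm ?_ η
    have := ContMDiffAt.comp b (I' := 𝓘(ℝ, F).prod 𝓘(ℝ, E)) (f := fun y : Y => (x, y)) hx
      (contMDiffAt_const.prodMk contMDiffAt_id)
    exact this.mdifferentiableAt (by simp)
  have hcs : Filter.Tendsto (extChartAt 𝓘(ℝ, F) a).symm (𝓝 (extChartAt 𝓘(ℝ, F) a a)) (𝓝 a) := by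
    have := continuousAt_extChartAt_symm (I := 𝓘(ℝ, F)) a
    rwa [ContinuousAt, extChartAt_to_inv] at this
  -- The value of `mfderiv` is computed in a chart only for differentiable maps, so
  -- differentiability is first brought back from the chart expression.
  have hmd : MDifferentiableAt 𝓘(ℝ, F) 𝓘(ℝ, E')
      (fun x => (mfderiv 𝓘(ℝ, E) 𝓘(ℝ, E') (Φ x) b η : E')) a := by
    have h1 := MDifferentiableAt.comp a hd.mdifferentiableAt
      (mdifferentiableAt_extChartAt (I := 𝓘(ℝ, F)) (mem_chart_source F a))
    refine h1.congr_of_eventuallyEq ?_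
    filter_upwards [hev, (chartAt F a).open_source.mem_nhds (mem_chart_source F a)] with x hx hx'
    rw [hx]
    simp only [Function.comp, hΨdef]
    rw [(extChartAt 𝓘(ℝ, F) a).left_inv (by simpa using hx')]
  rw [mfderiv_eq_fderiv_comp_extChartAt_symm hmd]
  have : (fun s => (mfderiv 𝓘(ℝ, E) 𝓘(ℝ, E') (Φ ((extChartAt 𝓘(ℝ, F) a).symm s)) b η : E'))
      =ᶠ[𝓝 (extChartAt 𝓘(ℝ, F) a a)] fun s => fderiv ℝ (fun t =>
        Φ ((extChartAt 𝓘(ℝ, F) a).symm s) ((extChartAt 𝓘(ℝ, E) b).symm t))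
        (extChartAt 𝓘(ℝ, E) b b) η := hcs.eventually hev
  rw [this.fderiv_eq]

/-- Mixed derivatives of a function on a product of manifolds commute. -/
lemma mfderiv_mfderiv_comm {Φ : X → Y → E'} {a : X} {b : Y}
    (h : ContMDiffAt (𝓘(ℝ, F).prod 𝓘(ℝ, E)) 𝓘(ℝ, E') ∞ (Function.uncurry Φ) (a, b)) (η : E)
    (ξ : F) :
    (mfderiv 𝓘(ℝ, F) 𝓘(ℝ, E') (fun x => (mfderiv 𝓘(ℝ, E) 𝓘(ℝ, E') (Φ x) b η : E')) a ξ : E') =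
      (mfderiv 𝓘(ℝ, E) 𝓘(ℝ, E')
        (fun y => (mfderiv 𝓘(ℝ, F) 𝓘(ℝ, E') (fun x => Φ x y) a ξ : E')) b η : E') := by
  have h' : ContMDiffAt (𝓘(ℝ, E).prod 𝓘(ℝ, F)) 𝓘(ℝ, E') ∞
      (Function.uncurry fun y x => Φ x y) (b, a) :=
    ContMDiffAt.comp (I' := 𝓘(ℝ, F).prod 𝓘(ℝ, E)) (b, a) (f := fun q : Y × X => (q.2, q.1)) h
      (contMDiffAt_snd.prodMk contMDiffAt_fst)
  rw [mfderiv_partial_right h η ξ, mfderiv_partial_right h' ξ η]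
  exact fderiv_fderiv_comm (contDiffAt_charts h) ξ η

end Mixed

end

noncomputable section

/-! ### Generators of the tangent action -/

section Action

variable {E : Type*} [NormedAddCommGroup E] [NormedSpace ℝ E]
  {M : Type*} [TopologicalSpace M] [ChartedSpace E M] [IsManifold 𝓘(ℝ, E) ∞ M]
  {F : Type*} [NormedAddCommGroup F] [NormedSpace ℝ F]
  {G : Type*} [TopologicalSpace G] [ChartedSpace F G] [Group G]
  [LieGroup 𝓘(ℝ, F) ∞ G] [MulAction G M] [ContMDiffSMul 𝓘(ℝ, F) 𝓘(ℝ, E) ∞ G M]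

lemma isManifold_of_lieGroup (F G : Type*) [NormedAddCommGroup F] [NormedSpace ℝ F]
    [TopologicalSpace G] [ChartedSpace F G] [Group G] [LieGroup 𝓘(ℝ, F) ∞ G] :
    IsManifold 𝓘(ℝ, F) ∞ G :=
  (inferInstance : LieGroup 𝓘(ℝ, F) ∞ G).toIsManifold

lemma contMDiff_action (F : Type*) [NormedAddCommGroup F] [NormedSpace ℝ F] (E : Type*)
    [NormedAddCommGroup E] [NormedSpace ℝ E] (G M : Type*) [TopologicalSpace M] [ChartedSpace E M]
    [TopologicalSpace G] [ChartedSpace F G] [Group G]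
    [MulAction G M] [ContMDiffSMul 𝓘(ℝ, F) 𝓘(ℝ, E) ∞ G M] :
    ContMDiff (𝓘(ℝ, F).prod 𝓘(ℝ, E)) 𝓘(ℝ, E) ∞ (fun q : G × M => q.1 • q.2) :=
  ContMDiffSMul.contMDiff_smul

lemma contMDiff_smul_left (F : Type*) [NormedAddCommGroup F] [NormedSpace ℝ F] {E : Type*}
    [NormedAddCommGroup E] [NormedSpace ℝ E] {G M : Type*} [TopologicalSpace M] [ChartedSpace E M]
    [TopologicalSpace G] [ChartedSpace F G] [Group G]
    [MulAction G M] [ContMDiffSMul 𝓘(ℝ, F) 𝓘(ℝ, E) ∞ G M] (g : G) :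
    ContMDiff 𝓘(ℝ, E) 𝓘(ℝ, E) ∞ (fun m : M => g • m) :=
  (contMDiff_action F E G M).comp (contMDiff_const.prodMk contMDiff_id)

lemma contMDiff_orbitMap (m : M) :
    ContMDiff 𝓘(ℝ, F) 𝓘(ℝ, E) ∞ (fun g : G => g • m) :=
  (contMDiff_action F E G M).comp (contMDiff_id.prodMk contMDiff_const)

include F in
lemma contMDiff_tangentAction (g : G) :
    ContMDiff 𝓘(ℝ, E).tangent 𝓘(ℝ, E).tangent ∞
      (tangentAction g : TangentBundle 𝓘(ℝ, E) M → TangentBundle 𝓘(ℝ, E) M) :=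
  (contMDiff_smul_left F g).contMDiff_tangentMap (by simp)

/-- The tangent action is the tangent map of `G × M → M` restricted to vectors that vanish in the
group direction. -/
lemma contMDiff_tangentAction_uncurry :
    ContMDiff (𝓘(ℝ, F).prod 𝓘(ℝ, E).tangent) 𝓘(ℝ, E).tangent ∞
      (fun q : G × TangentBundle 𝓘(ℝ, E) M => tangentAction q.1 q.2) := by
  have := isManifold_of_lieGroup F G
  have h1 : ContMDiff (𝓘(ℝ, F).prod 𝓘(ℝ, E)).tangent 𝓘(ℝ, E).tangent ∞
      (tangentMap (𝓘(ℝ, F).prod 𝓘(ℝ, E)) 𝓘(ℝ, E) (fun q : G × M => q.1 • q.2)) :=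
    (contMDiff_action F E G M).contMDiff_tangentMap (by simp)
  have h2 : ContMDiff (𝓘(ℝ, F).prod 𝓘(ℝ, E).tangent) (𝓘(ℝ, F).prod 𝓘(ℝ, E)).tangent ∞
      (fun q : G × TangentBundle 𝓘(ℝ, E) M => (equivTangentBundleProd 𝓘(ℝ, F) G 𝓘(ℝ, E) M).symm
        (zeroSection F (TangentSpace 𝓘(ℝ, F) : G → Type _) q.1, q.2)) :=
    contMDiff_equivTangentBundleProd_symm.comp
      (((contMDiff_zeroSection ℝ (TangentSpace 𝓘(ℝ, F) : G → Type _)).comp contMDiff_fst).prodMk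
        contMDiff_snd)
  have h3 := h1.comp h2
  convert! h3 using 1
  funext ⟨g, v⟩
  obtain ⟨m, y⟩ := v
  change E at y
  have h4 := HasMFDerivAt.comp m (f := fun x : M => (g, x)) (g := fun q : G × M => q.1 • q.2)
    (((contMDiff_action F E G M).mdifferentiable (by simp) (g, m)).hasMFDerivAt)
    ((mdifferentiableAt_const.prodMk mdifferentiableAt_id).hasMFDerivAt)
  have h5 : (mfderiv 𝓘(ℝ, E) 𝓘(ℝ, E) (fun x : M => g • x) m : E →L[ℝ] E) =
    (mfderiv (𝓘(ℝ, F).prod 𝓘(ℝ, E)) 𝓘(ℝ, E) (fun q : G × M => q.1 • q.2) (g, m) :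
      F × E →L[ℝ] E) ∘L (ContinuousLinearMap.inr ℝ F E) := by
    refine h4.mfderiv.trans (congrArg (ContinuousLinearMap.comp (_ : F × E →L[ℝ] E)) ?_)
    exact mfderiv_prod_right
  have h6 := congrArg (fun l : E →L[ℝ] E => (⟨g • m, l y⟩ : TangentBundle 𝓘(ℝ, E) M)) h5
  exact h6

/-- The infinitesimal generators at `v` of the tangent action of `G`. -/
def generator (G : Type*) [TopologicalSpace G] [ChartedSpace F G] [Group G] [MulAction G M]
    (v : TangentBundle 𝓘(ℝ, E) M) :
    GroupLieAlgebra 𝓘(ℝ, F) G →L[ℝ] TangentSpace 𝓘(ℝ, E).tangent v :=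
  (mfderiv 𝓘(ℝ, F) 𝓘(ℝ, E).tangent (fun g : G => tangentAction g v) 1 : F →L[ℝ] E × E)

lemma tangentAction_one (v : TangentBundle 𝓘(ℝ, E) M) : tangentAction (1 : G) v = v := by
  have : (fun m : M => (1 : G) • m) = id := funext fun m => one_smul G m
  rw [tangentAction, this]
  exact congrFun (tangentMap_id (I := 𝓘(ℝ, E)) (M := M)) v

include F in
lemma tangentAction_mul (g h : G) (v : TangentBundle 𝓘(ℝ, E) M) :
    tangentAction (g * h) v = tangentAction g (tangentAction h v) := by
  have : (fun m : M => (g * h) • m) = (fun m : M => g • m) ∘ (fun m : M => h • m) :=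
    funext fun m => mul_smul g h m
  rw [tangentAction, this]
  exact tangentMap_comp_at (I' := 𝓘(ℝ, E)) v
    ((contMDiff_smul_left F g).mdifferentiable (by simp) _)
    ((contMDiff_smul_left F h).mdifferentiable (by simp) _)

lemma smoothHomAt_infAction (m₀ : M) :
    SmoothHomAt 𝓘(ℝ, E) 𝓘(ℝ, F) 𝓘(ℝ, E) (fun _ : M => (1 : G)) id
      (fun m => infAction (F := F) G m) m₀ := by
  have := isManifold_of_lieGroup F G
  have h1 : ContMDiff (𝓘(ℝ, E).prod 𝓘(ℝ, F)) 𝓘(ℝ, E) ∞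
      (Function.uncurry fun (m : M) (g : G) => g • m) :=
    (contMDiff_action F E G M).comp (contMDiff_snd.prodMk contMDiff_fst)
  have h2 := SmoothHomAt.mfderiv (f := fun (m : M) (g : G) => g • m) (g := fun _ : M => (1 : G))
    (x₀ := m₀) h1.contMDiffAt contMDiffAt_const inferInstance
  exact homCoord_congr_target (E₁ := F) (E₂ := E) (A := fun m : M =>
    (mfderiv 𝓘(ℝ, F) 𝓘(ℝ, E) (fun g : G => g • m) 1 : F →L[ℝ] E)) h2
    (.of_forall fun m => (one_smul G m).symm)

lemma smoothHomAt_generator (v₀ : TangentBundle 𝓘(ℝ, E) M) :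
    SmoothHomAt 𝓘(ℝ, E).tangent 𝓘(ℝ, F) 𝓘(ℝ, E).tangent
      (fun _ : TangentBundle 𝓘(ℝ, E) M => (1 : G)) id (fun v => generator (F := F) G v) v₀ := by
  have := isManifold_of_lieGroup F G
  have h1 : ContMDiff (𝓘(ℝ, E).tangent.prod 𝓘(ℝ, F)) 𝓘(ℝ, E).tangent ∞
      (Function.uncurry fun (v : TangentBundle 𝓘(ℝ, E) M) (g : G) => tangentAction g v) :=
    contMDiff_tangentAction_uncurry.comp (contMDiff_snd.prodMk contMDiff_fst)
  have h2 := SmoothHomAt.mfderiv (f := fun (v : TangentBundle 𝓘(ℝ, E) M) (g : G) =>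
    tangentAction g v) (g := fun _ => (1 : G)) (x₀ := v₀) h1.contMDiffAt contMDiffAt_const
    inferInstance
  exact homCoord_congr_target (E₁ := F) (E₂ := E × E) (A := fun v : TangentBundle 𝓘(ℝ, E) M =>
    (mfderiv 𝓘(ℝ, F) 𝓘(ℝ, E).tangent (fun g : G => tangentAction g v) 1 : F →L[ℝ] E × E)) h2
    (.of_forall fun v => (tangentAction_one v).symm)

lemma contMDiff_fundamentalField (ξ : GroupLieAlgebra 𝓘(ℝ, F) G) :
    ContMDiff 𝓘(ℝ, E) 𝓘(ℝ, E).tangent ∞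
      (fun m : M => (⟨m, fundamentalField ξ m⟩ : TangentBundle 𝓘(ℝ, E) M)) := by
  have := isManifold_of_lieGroup F G
  intro m₀
  have h := smoothHomAt_infAction (E := E) (F := F) (G := G) m₀
  refine contMDiffAt_totalSpace.2 ⟨contMDiffAt_id, ?_⟩
  let c : F := (trivializationAt F (TangentSpace 𝓘(ℝ, F)) (1 : G)).continuousLinearMapAt ℝ 1 ξ
  refine (ContMDiffAt.clm_apply h (contMDiffAt_const (c := c))).congr_of_eventuallyEq ?_
  filter_upwards [(chartAt E m₀).open_source.mem_nhds (mem_chart_source E m₀)] with m hm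
  simp only [homCoord, ContinuousLinearMap.comp_apply, c]
  rw [Trivialization.symmL_continuousLinearMapAt _ (mem_chart_source F (1 : G))]
  exact (congrFun (Trivialization.coe_linearMapAt_of_mem (R := ℝ)
    (trivializationAt E (TangentSpace 𝓘(ℝ, E)) m₀) hm) _).symm

/-- This lemma and the next compute the two partial derivatives of `(g, x) ↦ g • x` in a chart: in
`g` the fundamental field, in `x` the tangent action. Differentiating each in the other variable
gives the fibre components compared in `completeLift_fundamentalField`. -/
lemma mfderiv_chart_orbitMap (m₀ : M) (ξ : F) {m : M} (hm : m ∈ (chartAt E m₀).source) :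
    (mfderiv 𝓘(ℝ, F) 𝓘(ℝ, E) (fun g : G => extChartAt 𝓘(ℝ, E) m₀ (g • m)) 1 ξ : E) =
      fibreCoord m₀ (⟨m, fundamentalField (G := G) (F := F) ξ m⟩ : TangentBundle 𝓘(ℝ, E) M) := by
  rw [fibreCoord_eq_mfderiv (by exact hm)]
  have h1 : HasMFDerivAt 𝓘(ℝ, E) 𝓘(ℝ, E) (extChartAt 𝓘(ℝ, E) m₀) ((1 : G) • m)
      (mfderiv 𝓘(ℝ, E) 𝓘(ℝ, E) (extChartAt 𝓘(ℝ, E) m₀) m : E →L[ℝ] E) := by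
    rw [one_smul]
    exact (mdifferentiableAt_extChartAt hm).hasMFDerivAt
  have h2 := HasMFDerivAt.comp (1 : G) (f := fun g : G => g • m) h1
    (((contMDiff_orbitMap (F := F) m).mdifferentiable (by simp) 1).hasMFDerivAt)
  exact congrArg (fun l : F →L[ℝ] E => l ξ) h2.mfderiv

include F in
lemma mfderiv_chart_smul (m₀ : M) (v : TangentBundle 𝓘(ℝ, E) M) {g : G}
    (hg : g • v.proj ∈ (chartAt E m₀).source) :
    (mfderiv 𝓘(ℝ, E) 𝓘(ℝ, E) (fun x : M => extChartAt 𝓘(ℝ, E) m₀ (g • x)) v.proj v.2 : E) =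
      fibreCoord m₀ (tangentAction g v) := by
  rw [fibreCoord_eq_mfderiv (by exact hg)]
  have h2 := HasMFDerivAt.comp v.proj (f := fun x : M => g • x)
    ((mdifferentiableAt_extChartAt hg).hasMFDerivAt)
    (((contMDiff_smul_left F g).mdifferentiable (by simp) v.proj).hasMFDerivAt)
  exact congrArg (fun l : E →L[ℝ] E => l v.2) h2.mfderiv

/-- The complete lift of a fundamental field is the generator of the tangent action. -/
lemma completeLift_fundamentalField (ξ : GroupLieAlgebra 𝓘(ℝ, F) G)
    (v : TangentBundle 𝓘(ℝ, E) M) :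
    completeLift (fundamentalField ξ) v = generator G v ξ := by
  have := isManifold_of_lieGroup F G
  have hs1 : MDifferentiableAt 𝓘(ℝ, F) 𝓘(ℝ, E).tangent (fun g : G => tangentAction g v) 1 :=
    ((contMDiff_tangentAction_uncurry (E := E) (M := M) (F := F) (G := G)).comp
      (contMDiff_id.prodMk contMDiff_const)).mdifferentiable (by simp) 1
  have h1 := mfderiv_into_tangentBundle hs1 ξ
  have h2 := mfderiv_into_tangentBundle
    ((contMDiff_fundamentalField (E := E) (M := M) ξ).mdifferentiable (by simp) v.proj) v.2
  refine Eq.trans ?_ h1.symm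
  refine Prod.ext ?_ ?_
  · rfl
  have hone : (tangentAction (1 : G) v).proj = v.proj := one_smul G v.proj
  have hΦ : ContMDiffAt (𝓘(ℝ, F).prod 𝓘(ℝ, E)) 𝓘(ℝ, E) ∞
      (Function.uncurry fun (g : G) (x : M) => extChartAt 𝓘(ℝ, E) v.proj (g • x))
      (1, v.proj) := by
    refine ContMDiffAt.comp (I' := 𝓘(ℝ, E)) (1, v.proj) (g := extChartAt 𝓘(ℝ, E) v.proj)
      (f := fun q : G × M => q.1 • q.2) ?_ (contMDiff_action F E G M).contMDiffAt
    simp only [one_smul]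
    exact contMDiffAt_extChartAt
  -- The base components agree by definition. For the fibre components, differentiating `ξ̃` along
  -- `v` gives the complete lift and differentiating the tangent action along `ξ` gives the
  -- generator; these are the two mixed derivatives of the action.
  have hcomm := mfderiv_mfderiv_comm hΦ (v.2 : E) (ξ : F)
  have hL : (fun x : M =>
      (mfderiv 𝓘(ℝ, F) 𝓘(ℝ, E) (fun g : G => extChartAt 𝓘(ℝ, E) v.proj (g • x)) 1 ξ : E))
      =ᶠ[𝓝 v.proj] fun x => fibreCoord v.proj
        (⟨x, fundamentalField ξ x⟩ : TangentBundle 𝓘(ℝ, E) M) := by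
    filter_upwards [(chartAt E v.proj).open_source.mem_nhds (mem_chart_source E v.proj)] with m hm
    exact mfderiv_chart_orbitMap (F := F) v.proj ξ hm
  have hR : (fun g : G =>
      (mfderiv 𝓘(ℝ, E) 𝓘(ℝ, E) (fun x : M => extChartAt 𝓘(ℝ, E) v.proj (g • x)) v.proj v.2 : E))
      =ᶠ[𝓝 1] fun g => fibreCoord v.proj (tangentAction g v) := by
    have hc : ContinuousAt (fun g : G => g • v.proj) 1 :=
      (contMDiff_orbitMap (E := E) (F := F) v.proj).continuous.continuousAt
    have hn : (chartAt E v.proj).source ∈ 𝓝 ((1 : G) • v.proj) := by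
      rw [one_smul]
      exact (chartAt E v.proj).open_source.mem_nhds (mem_chart_source E v.proj)
    filter_upwards [hc hn] with g hg
    exact mfderiv_chart_smul (E := E) (F := F) v.proj v hg
  rw [hone]
  refine (congrArg Prod.snd h2).trans ?_
  refine (congrArg (fun l : E →L[ℝ] E => l v.2) hL.mfderiv_eq).symm.trans ?_
  exact hcomm.symm.trans (congrArg (fun l : F →L[ℝ] E => l ξ) hR.mfderiv_eq)

end Action

end

noncomputable section

/-! ### Tangent spaces of level sets -/

section LevelSet

open Filter Asymptotics

/-- If the level set of a strict submersion is parametrized by a differentiable immersion, the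
kernel of the derivative consists of tangent vectors of the parametrization. -/
lemma mem_range_of_parametrized_level {E₀ E₁ E₂ : Type*} [NormedAddCommGroup E₀]
    [NormedSpace ℝ E₀] [FiniteDimensional ℝ E₀] [NormedAddCommGroup E₁] [NormedSpace ℝ E₁]
    [FiniteDimensional ℝ E₁] [NormedAddCommGroup E₂] [NormedSpace ℝ E₂] [FiniteDimensional ℝ E₂]
    {f : E₁ → E₂} {f' : E₁ →L[ℝ] E₂} {y₀ : E₁} (hf : HasStrictFDerivAt f f' y₀)
    (hf' : Function.Surjective f') {ι : E₀ → E₁} {A : E₀ →L[ℝ] E₁} {x₀ : E₀}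
    (hι : HasFDerivAt ι A x₀) (hA : Function.Injective A) (h₀ : ι x₀ = y₀) {s : E₁ → E₀}
    (hs : Tendsto s (𝓝[{y | f y = f y₀}] y₀) (𝓝 x₀))
    (hιs : ∀ᶠ y in 𝓝[{y | f y = f y₀}] y₀, ι (s y) = y) {w : E₁} (hw : f' w = 0) :
    w ∈ A.range := by
  have := FiniteDimensional.complete ℝ E₁
  have hr : f'.range = ⊤ := LinearMap.range_eq_top.2 hf'
  -- A curve in the level set with velocity `w` at `0`.
  let c : ℝ → E₁ := fun t => hf.implicitFunction f f' hr (f y₀) (t • (⟨w, hw⟩ : f'.ker))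
  have hline : HasFDerivAt (fun t : ℝ => t • (⟨w, hw⟩ : f'.ker))
      ((ContinuousLinearMap.toSpanSingleton ℝ (⟨w, hw⟩ : f'.ker))) 0 :=
    (ContinuousLinearMap.toSpanSingleton ℝ (⟨w, hw⟩ : f'.ker)).hasFDerivAt
  have hc0 : c 0 = y₀ := by
    simp only [c, zero_smul]
    exact hf.implicitFunction_apply_image hr
  have hc : HasDerivAt c w 0 := by
    have h1 : HasFDerivAt (hf.implicitFunction f f' hr (f y₀)) f'.ker.subtypeL
        ((0 : ℝ) • (⟨w, hw⟩ : f'.ker)) := by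
      rw [zero_smul]; exact (hf.to_implicitFunction hr).hasFDerivAt
    have h2 := (h1.comp (0 : ℝ) hline).hasDerivAt
    simp only [ContinuousLinearMap.comp_apply, ContinuousLinearMap.toSpanSingleton_apply,
      one_smul] at h2
    exact h2
  have hcont : Tendsto c (𝓝 0) (𝓝 y₀) := by
    have := hc.continuousAt.tendsto
    rwa [hc0] at this
  have hcl : ∀ᶠ t in 𝓝 (0 : ℝ), f (c t) = f y₀ := by
    have h1 := hf.map_implicitFunction_eq hr
    have h2 : Tendsto (fun t : ℝ => (f y₀, t • (⟨w, hw⟩ : f'.ker))) (𝓝 0) (𝓝 (f y₀, 0)) := by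
      have : Continuous fun t : ℝ => (f y₀, t • (⟨w, hw⟩ : f'.ker)) := by fun_prop
      simpa using this.tendsto 0
    exact h2.eventually h1
  have hcw : Tendsto c (𝓝 0) (𝓝[{y | f y = f y₀}] y₀) := tendsto_nhdsWithin_iff.2 ⟨hcont, hcl⟩
  have hx : Tendsto (fun t => s (c t)) (𝓝 0) (𝓝 x₀) := hs.comp hcw
  have hιx : ∀ᶠ t in 𝓝 (0 : ℝ), ι (s (c t)) = c t := hcw.eventually hιs
  obtain ⟨K, -, hK⟩ := A.exists_antilipschitzWith (LinearMap.ker_eq_bot.2 hA)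
  have hlin : (fun t : ℝ => c t - y₀) =O[𝓝 0] fun t => t := by
    have := hc.isBigO_sub
    simpa [hc0] using this
  -- Only convergence of `s` is known, so the order of `s (c t) - x₀` is extracted from `ι`: the
  -- injective map `A` bounds vectors by their images.
  have h1 : (fun t => s (c t) - x₀) =O[𝓝 0] fun t : ℝ => t := by
    have hrev : (fun x => x - x₀) =O[𝓝 x₀] fun x => ι x - ι x₀ := by
      have h2 : (fun x => x - x₀) =O[𝓝 x₀] fun x => A (x - x₀) :=
        IsBigO.of_bound K (.of_forall fun x => by
          simpa [dist_eq_norm] using hK.le_mul_dist (x - x₀) 0)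
      exact h2.trans ((hι.isLittleO.trans_isBigO h2).right_isBigO_add.congr_right fun x => by simp)
    refine (hrev.comp_tendsto hx).trans (hlin.congr' ?_ .rfl)
    filter_upwards [hιx] with t ht
    simp [ht, h₀]
  have h2 : (fun t => c t - y₀ - A (s (c t) - x₀)) =o[𝓝 0] fun t : ℝ => t := by
    refine IsLittleO.trans_isBigO ((hι.isLittleO.comp_tendsto hx).congr' ?_ .rfl) h1
    filter_upwards [hιx] with t ht
    simp [ht, h₀]
  have h3 : (fun t => c t - y₀ - t • w) =o[𝓝 0] fun t : ℝ => t := by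
    have := hc.isLittleO
    simpa [hc0] using this
  have h4 : (fun t => A (s (c t) - x₀) - t • w) =o[𝓝 0] fun t : ℝ => t :=
    (h3.sub h2).congr_left fun t => by abel
  -- After division by `t`, vectors in the range of `A` converge to `w`; the range is closed, being
  -- finite-dimensional.
  have h5 : Tendsto (fun t : ℝ => t⁻¹ • (A (s (c t) - x₀) - t • w)) (𝓝[≠] 0) (𝓝 0) :=
    (h4.mono nhdsWithin_le_nhds).tendsto_inv_smul_nhds_zero
  have h6 : Tendsto (fun t : ℝ => A (t⁻¹ • (s (c t) - x₀))) (𝓝[≠] 0) (𝓝 w) := by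
    have h7 := h5.add_const w
    rw [zero_add] at h7
    refine h7.congr' ?_
    filter_upwards [self_mem_nhdsWithin] with t ht
    rw [smul_sub, smul_smul, inv_mul_cancel₀ ht, one_smul, sub_add_cancel, map_smul]
  exact A.range.closed_of_finiteDimensional.mem_of_tendsto h6 (.of_forall fun t => ⟨_, rfl⟩)

variable {E₀ : Type*} [NormedAddCommGroup E₀] [NormedSpace ℝ E₀] [FiniteDimensional ℝ E₀]
  {H₀ : Type*} [TopologicalSpace H₀] {I₀ : ModelWithCorners ℝ E₀ H₀} [I₀.Boundaryless]
  {N : Type*} [TopologicalSpace N] [ChartedSpace H₀ N] [IsManifold I₀ ∞ N]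
  {E₁ : Type*} [NormedAddCommGroup E₁] [NormedSpace ℝ E₁] [FiniteDimensional ℝ E₁]
  {H₁ : Type*} [TopologicalSpace H₁] {I₁ : ModelWithCorners ℝ E₁ H₁} [I₁.Boundaryless]
  {P : Type*} [TopologicalSpace P] [ChartedSpace H₁ P] [IsManifold I₁ ∞ P]
  {E₂ : Type*} [NormedAddCommGroup E₂] [NormedSpace ℝ E₂] [FiniteDimensional ℝ E₂]
  {H₂ : Type*} [TopologicalSpace H₂] {I₂ : ModelWithCorners ℝ E₂ H₂} [I₂.Boundaryless]
  {Q : Type*} [TopologicalSpace Q] [ChartedSpace H₂ Q] [IsManifold I₂ ∞ Q]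

lemma contDiffAt_writtenInExtChartAt {f : P → Q} {p : P} (hf : ContMDiffAt I₁ I₂ ∞ f p) :
    ContDiffAt ℝ ∞ (writtenInExtChartAt I₁ I₂ p f) (extChartAt I₁ p p) := by
  have h := (contMDiffAt_iff.1 hf).2
  rw [I₁.range_eq_univ] at h
  exact h.contDiffAt univ_mem

lemma fderiv_writtenInExtChartAt {f : P → Q} {p : P} (hf : MDifferentiableAt I₁ I₂ f p) :
    (mfderiv I₁ I₂ f p : E₁ →L[ℝ] E₂) =
      fderiv ℝ (writtenInExtChartAt I₁ I₂ p f) (extChartAt I₁ p p) := by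
  have h : (mfderiv I₁ I₂ f p : E₁ →L[ℝ] E₂) =
    fderivWithin ℝ (writtenInExtChartAt I₁ I₂ p f) (Set.range I₁) (extChartAt I₁ p p) := hf.mfderiv
  rw [h, I₁.range_eq_univ, fderivWithin_univ]

/-- If a level set of a submersion `f` is contained in the image of an inducing immersion `ι`, then
`ker Tf` is contained in the image of `Tι`. -/
lemma ker_mfderiv_le_range_of_level {ι : N → P} {f : P → Q} {n : N}
    (hι : ContMDiffAt I₀ I₁ ∞ ι n) (hinj : Function.Injective (mfderiv I₀ I₁ ι n))
    (hind : Topology.IsInducing ι) (hf : ContMDiffAt I₁ I₂ ∞ f (ι n))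
    (hsurj : Function.Surjective (mfderiv I₁ I₂ f (ι n)))
    (hlevel : ∀ q, f q = f (ι n) → q ∈ Set.range ι) :
    (mfderiv I₁ I₂ f (ι n)).ker ≤ (mfderiv I₀ I₁ ι n).range := by
  intro w hw
  have eι := fderiv_writtenInExtChartAt (hι.mdifferentiableAt (by simp))
  have ef := fderiv_writtenInExtChartAt (hf.mdifferentiableAt (by simp))
  have dι := (contDiffAt_writtenInExtChartAt hι).differentiableAt (by simp) |>.hasFDerivAt
  have df := (contDiffAt_writtenInExtChartAt hf).hasStrictFDerivAt (by simp)
  rw [← eι] at dι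
  rw [← ef] at df
  have : Nonempty N := ⟨n⟩
  -- `r` is a set-theoretic inverse of `ι` on the level set; its continuity at `ι n` comes from `ι`
  -- being inducing.
  choose! r hr using hlevel
  have hx₀ : writtenInExtChartAt I₀ I₁ n ι (extChartAt I₀ n n) = extChartAt I₁ (ι n) (ι n) := by
    simp [writtenInExtChartAt]
  set ψ := extChartAt I₁ (ι n) with hψ
  set y₀ := ψ (ι n) with hy₀
  have hsymm : Tendsto ψ.symm (𝓝 y₀) (𝓝 (ι n)) := by
    have := (continuousAt_extChartAt_symm (I := I₁) (ι n)).tendsto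
    rwa [extChartAt_to_inv] at this
  have hlev : ∀ᶠ y in 𝓝[{y | writtenInExtChartAt I₁ I₂ (ι n) f y =
      writtenInExtChartAt I₁ I₂ (ι n) f y₀}] y₀, f (ψ.symm y) = f (ι n) := by
    -- Equal chart values of `f` mean equal values of `f` only inside the source of the chart of the
    -- target.
    have h1 : ∀ᶠ y in 𝓝 y₀, f (ψ.symm y) ∈ (extChartAt I₂ (f (ι n))).source :=
      (hf.continuousAt.tendsto.comp hsymm) (extChartAt_source_mem_nhds _)
    filter_upwards [self_mem_nhdsWithin, nhdsWithin_le_nhds h1] with y hy hy1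
    simp only [writtenInExtChartAt, Function.comp_apply] at hy
    rw [hy₀, hψ, extChartAt_to_inv] at hy
    exact (extChartAt I₂ (f (ι n))).injOn hy1 (mem_extChartAt_source _) hy
  have hrt : Tendsto (fun y => r (ψ.symm y)) (𝓝[{y | writtenInExtChartAt I₁ I₂ (ι n) f y =
      writtenInExtChartAt I₁ I₂ (ι n) f y₀}] y₀) (𝓝 n) := by
    rw [hind.nhds_eq_comap, tendsto_comap_iff]
    refine (hsymm.mono_left nhdsWithin_le_nhds).congr' ?_
    filter_upwards [hlev] with y hy
    exact (hr _ hy).symm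
  have htgt : ∀ᶠ y in 𝓝 y₀, y ∈ ψ.target := extChartAt_target_mem_nhds (ι n)
  refine mem_range_of_parametrized_level df hsurj dι hinj hx₀
    (s := fun y => extChartAt I₀ n (r (ψ.symm y)))
    ((continuousAt_extChartAt n).tendsto.comp hrt) ?_ hw
  filter_upwards [hlev, nhdsWithin_le_nhds htgt,
    hrt (extChartAt_source_mem_nhds (I := I₀) n)] with y hy hyt hys
  simp only [writtenInExtChartAt, Function.comp_apply]
  rw [(extChartAt I₀ n).left_inv hys, hr _ hy, ← hψ, ψ.right_inv hyt]

/-- In the charts of the immersion `f` is the injective linear map `x ↦ h.equiv (x, 0)`. The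
derivative of the source chart is injective too, so `df` is injective by the chain rule. -/
lemma mfderiv_injective_of_isImmersionAt {f : N → P} {n : N}
    (h : Manifold.IsImmersionAt I₀ I₁ ∞ f n) : Function.Injective (mfderiv I₀ I₁ f n) := by
  have hd : ContMDiffAt I₀ 𝓘(ℝ, E₀) ∞ (h.domChart.extend I₀) n :=
    OpenPartialHomeomorph.contMDiffAt_extend h.domChart_mem_maximalAtlas h.mem_domChart_source
  have hc : ContMDiffAt I₁ 𝓘(ℝ, E₁) ∞ (h.codChart.extend I₁) (f n) :=
    OpenPartialHomeomorph.contMDiffAt_extend h.codChart_mem_maximalAtlas h.mem_codChart_source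
  have hds : ContMDiffAt 𝓘(ℝ, E₀) I₀ ∞ (h.domChart.extend I₀).symm (h.domChart.extend I₀ n) := by
    have h1 := contMDiffOn_extend_symm (I := I₀) (n := ∞) h.domChart_mem_maximalAtlas
    refine h1.contMDiffAt ?_
    rw [I₀.image_eq]
    exact ((h.domChart.open_target.preimage I₀.continuous_symm).inter
      (by rw [I₀.range_eq_univ]; exact isOpen_univ)).mem_nhds
      ⟨by simp [h.domChart.map_source h.mem_domChart_source], Set.mem_range_self _⟩
  have hds1 : MDifferentiableAt 𝓘(ℝ, E₀) I₀ (h.domChart.extend I₀).symm (h.domChart.extend I₀ n) :=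
    hds.mdifferentiableAt (by simp)
  have hd1 := (hd.mdifferentiableAt (n := ∞) (by simp)).hasMFDerivAt
  have hc1 := (hc.mdifferentiableAt (n := ∞) (by simp)).hasMFDerivAt
  have hf1 := (h.contMDiffAt.mdifferentiableAt (n := ∞) (by simp)).hasMFDerivAt
  have hnear : ∀ᶠ x in 𝓝 n, x ∈ h.domChart.source :=
    h.domChart.open_source.mem_nhds h.mem_domChart_source
  have hleft := HasMFDerivAt.comp n hds1.hasMFDerivAt hd1
  have hid : (fun x => (h.domChart.extend I₀).symm (h.domChart.extend I₀ x)) =ᶠ[𝓝 n] id := by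
    filter_upwards [hnear] with x hx
    exact h.domChart.extend_left_inv hx
  have hleft' := hasMFDerivAt_unique (hleft.congr_of_eventuallyEq hid.symm) (hasMFDerivAt_id n)
  have hcf := HasMFDerivAt.comp n hc1 hf1
  let B : E₀ →L[ℝ] E₁ := (h.equiv : _ →L[ℝ] E₁) ∘L (ContinuousLinearMap.inl ℝ E₀ h.complement)
  have hB := HasMFDerivAt.comp n (B.hasFDerivAt (x := h.domChart.extend I₀ n)).hasMFDerivAt hd1
  have heq : (fun x => B (h.domChart.extend I₀ x)) =ᶠ[𝓝 n]
      fun x => h.codChart.extend I₁ (f x) := by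
    filter_upwards [hnear] with x hx
    have := h.writtenInCharts ((h.domChart.extend I₀).map_source (by simpa using hx))
    simp only [Function.comp_apply, h.domChart.extend_left_inv hx] at this
    exact this.symm
  have hcomp := hasMFDerivAt_unique (hcf.congr_of_eventuallyEq heq) hB
  have hBinj : Function.Injective B := h.equiv.injective.comp
    (fun a b hab => congrArg Prod.fst hab)
  have hdinj : Function.Injective
      (mfderiv I₀ 𝓘(ℝ, E₀) (h.domChart.extend I₀) n : E₀ →L[ℝ] E₀) := by
    refine Function.LeftInverse.injective (g := (mfderiv 𝓘(ℝ, E₀) I₀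
      (h.domChart.extend I₀).symm (h.domChart.extend I₀ n) : E₀ →L[ℝ] E₀)) fun z => ?_
    exact congrArg (fun l : E₀ →L[ℝ] E₀ => l z) hleft'
  intro a b hab
  refine hdinj (hBinj ?_)
  have h1 := congrArg (fun l : E₀ →L[ℝ] E₁ => l a) hcomp
  have h2 := congrArg (fun l : E₀ →L[ℝ] E₁ => l b) hcomp
  refine h1.symm.trans (Eq.trans ?_ h2)
  exact congrArg (mfderiv I₁ 𝓘(ℝ, E₁) (h.codChart.extend I₁) (f n)) hab

end LevelSet

end

noncomputable section

/-! ### Orbits -/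

/-- `X` is `T` followed by a left inverse of `S`. The connection forms, the horizontal lifts and the
tensors on `N_μ` are all produced by such factorizations. -/
lemma exists_comp_eq_of_forall_mem_range {E₀ E₁ E₂ : Type*} [NormedAddCommGroup E₀]
    [NormedSpace ℝ E₀] [NormedAddCommGroup E₁] [NormedSpace ℝ E₁] [NormedAddCommGroup E₂]
    [NormedSpace ℝ E₂] [FiniteDimensional ℝ E₂] {S : E₁ →L[ℝ] E₂} (hS : Function.Injective S)
    {T : E₀ →L[ℝ] E₂} (h : ∀ w, ∃ z, S z = T w) : ∃ X : E₀ →L[ℝ] E₁, S ∘L X = T := by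
  obtain ⟨R, hR⟩ := (S : E₁ →ₗ[ℝ] E₂).exists_leftInverse_of_injective (LinearMap.ker_eq_bot.2 hS)
  refine ⟨(LinearMap.toContinuousLinearMap R) ∘L T, ContinuousLinearMap.ext fun w => ?_⟩
  obtain ⟨z, hz⟩ := h w
  have h1 : R (S z) = z := LinearMap.congr_fun hR z
  change S (R (T w)) = T w
  rw [← hz, h1]

/-- The derivative of a map does not see how the base point is written. -/
lemma mfderiv_apply_congr_point {E₀ : Type*} [NormedAddCommGroup E₀] [NormedSpace ℝ E₀]
    {H₀ : Type*} [TopologicalSpace H₀] {I₀ : ModelWithCorners ℝ E₀ H₀}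
    {N : Type*} [TopologicalSpace N] [ChartedSpace H₀ N]
    {E₁ : Type*} [NormedAddCommGroup E₁] [NormedSpace ℝ E₁]
    {H₁ : Type*} [TopologicalSpace H₁] {I₁ : ModelWithCorners ℝ E₁ H₁}
    {P : Type*} [TopologicalSpace P] [ChartedSpace H₁ P] {f : N → P} {x y : N} (h : x = y)
    (w : E₀) : (mfderiv I₀ I₁ f x : E₀ →L[ℝ] E₁) w = (mfderiv I₀ I₁ f y : E₀ →L[ℝ] E₁) w := by
  subst h; rfl

section Orbits

variable {E : Type*} [NormedAddCommGroup E] [NormedSpace ℝ E]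
  {M : Type*} [TopologicalSpace M] [T2Space M] [ChartedSpace E M] [IsManifold 𝓘(ℝ, E) ∞ M]
  {F : Type*} [NormedAddCommGroup F] [NormedSpace ℝ F]
  {G : Type*} [TopologicalSpace G] [ChartedSpace F G] [Group G]
  [LieGroup 𝓘(ℝ, F) ∞ G] [MulAction G M] [ContMDiffSMul 𝓘(ℝ, F) 𝓘(ℝ, E) ∞ G M]
  {EB : Type*} [NormedAddCommGroup EB] [NormedSpace ℝ EB]
  [ChartedSpace EB (OrbitSpace G M)] [IsManifold 𝓘(ℝ, EB) ∞ (OrbitSpace G M)]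

omit [ChartedSpace E M] [ChartedSpace F G] [IsManifold 𝓘(ℝ, E) ∞ M] [LieGroup 𝓘(ℝ, F) ∞ G]
  [ContMDiffSMul 𝓘(ℝ, F) 𝓘(ℝ, E) ∞ G M] in
/-- The orbits of a free proper action carry the topology of the group. -/
lemma isInducing_orbitMap (hfree : ∀ (g : G) (m : M), g • m = m → g = 1) (hp : ProperSMul G M)
    (m : M) : Topology.IsInducing (fun g : G => g • m) := by
  have hc : Continuous fun g : G => g • m :=
    (continuous_fst.comp hp.isProperMap_smul_pair.continuous).comp (Continuous.prodMk_left m)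
  refine (Topology.IsClosedEmbedding.of_continuous_injective_isClosedMap hc ?_ ?_).isInducing
  · intro a b hab
    have h1 : (b⁻¹ * a) • m = m := by
      change a • m = b • m at hab
      rw [mul_smul, hab, inv_smul_smul]
    exact (inv_mul_eq_one.1 (hfree _ _ h1)).symm
  -- The proper map `(g, x) ↦ (g • x, x)` sends `S × {m}` to a closed set, whose slice at `m` is the
  -- image of `S` in the orbit.
  · intro S hS
    have h1 := hp.isProperMap_smul_pair.isClosedMap _ (hS.prod (isClosed_singleton (x := m)))
    have h2 := h1.preimage (Continuous.prodMk_left m)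
    convert h2 using 1
    ext x
    constructor
    · rintro ⟨g, hg, rfl⟩
      exact ⟨(g, m), ⟨hg, rfl⟩, rfl⟩
    · rintro ⟨⟨g, m'⟩, ⟨hg, hm⟩, hgm⟩
      have hm' : m' = m := hm
      subst hm'
      exact ⟨g, hg, congrArg Prod.fst hgm⟩

/-- The projection is constant along the orbit map `g ↦ g • m`. -/
lemma mfderiv_orbitProj_infAction (hπ : ContMDiff 𝓘(ℝ, E) 𝓘(ℝ, EB) ∞ (orbitProj G : M → _))
    (m : M) (ξ : GroupLieAlgebra 𝓘(ℝ, F) G) :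
    mfderiv 𝓘(ℝ, E) 𝓘(ℝ, EB) (orbitProj G) m (infAction G m ξ) = 0 := by
  have h1 := HasMFDerivAt.comp (1 : G) (f := fun g : G => g • m)
    ((hπ.mdifferentiable (by simp) ((1 : G) • m)).hasMFDerivAt)
    (((contMDiff_orbitMap (E := E) (F := F) m).mdifferentiable (by simp) 1).hasMFDerivAt)
  have h2 : (orbitProj G ∘ fun g : G => g • m) = fun _ => orbitProj G m :=
    funext fun g => Quotient.sound ⟨g, rfl⟩
  rw [h2] at h1
  have h3 := hasMFDerivAt_unique h1 (hasMFDerivAt_const _ _)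
  have h4 := congrArg (fun l : F →L[ℝ] EB => l ξ) h3
  refine Eq.trans ?_ h4
  exact (mfderiv_apply_congr_point (E₀ := E) (E₁ := EB) (one_smul G m) _).symm

/-- The tangent spaces of the orbits are the kernels of the derivative of the projection. -/
lemma exists_infAction_eq [FiniteDimensional ℝ E] [FiniteDimensional ℝ F]
    [FiniteDimensional ℝ EB] (hfree : ∀ (g : G) (m : M), g • m = m → g = 1) (hp : ProperSMul G M)
    (hπ : ContMDiff 𝓘(ℝ, E) 𝓘(ℝ, EB) ∞ (orbitProj G : M → _))
    (hsurj : ∀ m : M, Function.Surjective (mfderiv 𝓘(ℝ, E) 𝓘(ℝ, EB) (orbitProj G) m))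
    {m : M} (hσ : Function.Injective (infAction (E := E) (F := F) G m)) {w : TangentSpace 𝓘(ℝ, E) m}
    (hw : mfderiv 𝓘(ℝ, E) 𝓘(ℝ, EB) (orbitProj G : M → OrbitSpace G M) m w = 0) :
    ∃ ξ : GroupLieAlgebra 𝓘(ℝ, F) G, infAction G m ξ = w := by
  have := isManifold_of_lieGroup F G
  -- The orbit is a level set of the submersion `π`, parametrized by the immersion `g ↦ g • m`.
  have h := ker_mfderiv_le_range_of_level (I₀ := 𝓘(ℝ, F)) (I₁ := 𝓘(ℝ, E)) (I₂ := 𝓘(ℝ, EB))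
    (ι := fun g : G => g • m) (f := orbitProj G) (n := 1)
    (contMDiff_orbitMap (E := E) (F := F) m).contMDiffAt hσ (isInducing_orbitMap hfree hp m) hπ.contMDiffAt
    (hsurj _) (fun q hq => by
      obtain ⟨g, hg⟩ := Quotient.exact hq
      exact ⟨g, by simpa using hg⟩)
  exact h (x := w) ((mfderiv_apply_congr_point (E₀ := E) (E₁ := EB) (one_smul G m) _).trans hw)

end Orbits

end

noncomputable section

/-! ### The momentum map -/

section Invertible

variable {V W : Type*} [NormedAddCommGroup V] [NormedSpace ℝ V] [FiniteDimensional ℝ V]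

lemma exists_equiv_of_injective_dual {γ : V →L[ℝ] V →L[ℝ] ℝ} (hγ : Function.Injective γ) :
    ∃ e : V ≃L[ℝ] (V →L[ℝ] ℝ), (e : V →L[ℝ] V →L[ℝ] ℝ) = γ := by
  have hdim : Module.finrank ℝ V = Module.finrank ℝ (V →L[ℝ] ℝ) := by
    rw [← (LinearMap.toContinuousLinearMap (𝕜 := ℝ) (E := V) (F' := ℝ)).finrank_eq,
      Subspace.dual_finrank_eq]
  exact ⟨(LinearEquiv.ofInjectiveOfFinrankEq (γ : V →ₗ[ℝ] V →L[ℝ] ℝ) hγ hdim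
    ).toContinuousLinearEquiv, by ext; rfl⟩

/-- An injective map into the dual is invertible by dimension count, so `inverse` is a true inverse
and not its default value `0`. -/
lemma apply_inverse_of_injective_dual {γ : V →L[ℝ] V →L[ℝ] ℝ} (hγ : Function.Injective γ)
    (α : V →L[ℝ] ℝ) : γ (γ.inverse α) = α := by
  obtain ⟨e, rfl⟩ := exists_equiv_of_injective_dual hγ
  rw [ContinuousLinearMap.inverse_equiv]
  exact e.apply_symm_apply α

end Invertible

/-- With a constant base point the source coordinates differ from the identity by the fixed map `C`.
-/
lemma SmoothHomAt.contMDiffAt_of_const {E : Type*} [NormedAddCommGroup E] [NormedSpace ℝ E]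
    {H : Type*} [TopologicalSpace H] {I : ModelWithCorners ℝ E H}
    {M : Type*} [TopologicalSpace M] [ChartedSpace H M] [IsManifold I ∞ M]
    {EN : Type*} [NormedAddCommGroup EN] [NormedSpace ℝ EN]
    {HN : Type*} [TopologicalSpace HN] {J : ModelWithCorners ℝ EN HN}
    {N : Type*} [TopologicalSpace N] [ChartedSpace HN N]
    {E' : Type*} [NormedAddCommGroup E'] [NormedSpace ℝ E'] {b : M} {g : N → E'}
    {A : N → E →L[ℝ] E'} {x₀ : N}
    (h : SmoothHomAt J I 𝓘(ℝ, E') (fun _ => b) g (fun x => A x) x₀) :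
    ContMDiffAt J 𝓘(ℝ, E →L[ℝ] E') ∞ A x₀ := by
  let C : E →L[ℝ] E := (trivializationAt E (TangentSpace I) b).continuousLinearMapAt ℝ b
  refine (ContMDiffAt.clm_comp h (contMDiffAt_const (c := C))).congr_of_eventuallyEq
    (.of_forall fun x => ContinuousLinearMap.ext fun w => ?_)
  have h1 : (trivializationAt E (TangentSpace I) b).symmL ℝ b (C w) = w :=
    Trivialization.symmL_continuousLinearMapAt (R := ℝ) (trivializationAt E (TangentSpace I) b)
      (mem_chart_source H b) (w : E)
  change A x w = (trivializationAt E' (TangentSpace 𝓘(ℝ, E')) (g x₀)).continuousLinearMapAt ℝ (g x)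
    (A x ((trivializationAt E (TangentSpace I) b).symmL ℝ b (C w)))
  rw [h1]
  erw [TangentBundle.continuousLinearMapAt_model_space]
  rfl

section Momentum

variable {E : Type*} [NormedAddCommGroup E] [NormedSpace ℝ E]
  {M : Type*} [TopologicalSpace M] [ChartedSpace E M] [IsManifold 𝓘(ℝ, E) ∞ M]
  {F : Type*} [NormedAddCommGroup F] [NormedSpace ℝ F]
  {G : Type*} [TopologicalSpace G] [ChartedSpace F G] [Group G]
  [LieGroup 𝓘(ℝ, F) ∞ G] [MulAction G M] [ContMDiffSMul 𝓘(ℝ, F) 𝓘(ℝ, E) ∞ G M]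
  {L : TangentBundle 𝓘(ℝ, E) M → ℝ}

lemma contDiff_comp_fibreIncl (hL : ContMDiff 𝓘(ℝ, E).tangent 𝓘(ℝ, ℝ) ∞ L) (m : M) :
    ContDiff ℝ ∞ (fun y : E => L (fibreIncl m y)) :=
  contMDiff_iff_contDiff.1 (hL.comp (contMDiff_fibreIncl m))

/-- Chain rule for `L` restricted to a fibre. It expresses the momentum through the derivative of
`L`, the vertical lift and the infinitesimal action, so that smoothness and equivariance of `p`
follow from theirs. -/
lemma fibreDeriv_eq_mfderiv_vlift (hL : ContMDiff 𝓘(ℝ, E).tangent 𝓘(ℝ, ℝ) ∞ L)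
    (v : TangentBundle 𝓘(ℝ, E) M) (w : TangentSpace 𝓘(ℝ, E) v.proj) :
    fibreDeriv L v w = (mfderiv 𝓘(ℝ, E).tangent 𝓘(ℝ, ℝ) L v (vlift v w) : ℝ) := by
  obtain ⟨m, y⟩ := v
  change E at y
  have h1 := HasMFDerivAt.comp y (f := fibreIncl (E := E) m) (g := L)
    ((hL.mdifferentiable (by simp) _).hasMFDerivAt) (hasMFDerivAt_fibreIncl m y)
  let D : E →L[ℝ] ℝ := (mfderiv 𝓘(ℝ, E).tangent 𝓘(ℝ, ℝ) L (fibreIncl m y) : E × E →L[ℝ] ℝ) ∘L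
    fibreInclDeriv (E := E) m y
  have h2 : HasFDerivAt (fun z : E => L (fibreIncl m z)) D y := hasMFDerivAt_iff_hasFDerivAt.1 h1
  exact congrArg (fun l : E →L[ℝ] ℝ => l w) h2.fderiv

lemma contMDiff_bundleProj : ContMDiff 𝓘(ℝ, E).tangent 𝓘(ℝ, E) ∞
    (fun v : TangentBundle 𝓘(ℝ, E) M => v.proj) := contMDiff_proj (TangentSpace 𝓘(ℝ, E))

lemma smoothHomAt_vlift_infAction (v₀ : TangentBundle 𝓘(ℝ, E) M) :
    SmoothHomAt 𝓘(ℝ, E).tangent 𝓘(ℝ, F) 𝓘(ℝ, E).tangent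
      (fun _ : TangentBundle 𝓘(ℝ, E) M => (1 : G)) id
      (fun v => vlift v ∘L infAction (F := F) G v.proj) v₀ :=
  have := isManifold_of_lieGroup F G
  (smoothHomAt_vlift v₀).comp
    ((smoothHomAt_infAction (F := F) (G := G) v₀.proj).precomp
      (φ := fun v : TangentBundle 𝓘(ℝ, E) M => v.proj) contMDiff_bundleProj.contMDiffAt)
    contMDiff_bundleProj.continuous.continuousAt

/-- The momentum map is smooth. -/
lemma contMDiff_momentum (hL : ContMDiff 𝓘(ℝ, E).tangent 𝓘(ℝ, ℝ) ∞ L) :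
    ContMDiff (M' := F →L[ℝ] ℝ) 𝓘(ℝ, E).tangent 𝓘(ℝ, F →L[ℝ] ℝ) ∞
      (fun v => momentum (F := F) G L v) := by
  have := isManifold_of_lieGroup F G
  intro v₀
  have h3 := (SmoothHomAt.mfderiv_const (hL v₀)).comp
    (smoothHomAt_vlift_infAction (F := F) (G := G) v₀) continuousAt_id
  refine SmoothHomAt.contMDiffAt_of_const (b := (1 : G)) (I := 𝓘(ℝ, F)) (g := L)
    (A := fun v => momentum (F := F) G L v) ?_
  refine SmoothHomAt.congr h3 (.of_forall fun v => ?_)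
  refine ContinuousLinearMap.ext fun ξ => ?_
  exact fibreDeriv_eq_mfderiv_vlift hL v _

/-- Along a fibre the infinitesimal action is constant, so only the fibre derivative of `L` varies,
and its derivative is the Hessian. -/
lemma momentumDeriv_vlift (hL : ContMDiff 𝓘(ℝ, E).tangent 𝓘(ℝ, ℝ) ∞ L)
    (v : TangentBundle 𝓘(ℝ, E) M) (w : TangentSpace 𝓘(ℝ, E) v.proj)
    (ξ : GroupLieAlgebra 𝓘(ℝ, F) G) :
    momentumDeriv G L v (vlift v w) ξ = hessian L v w (infAction G v.proj ξ) := by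
  obtain ⟨m, y⟩ := v
  change E at y
  have h1 := HasMFDerivAt.comp y (f := fibreIncl (E := E) m)
    (M'' := F →L[ℝ] ℝ)
    (g := fun u => momentum (F := F) G L u)
    (((contMDiff_momentum hL).mdifferentiable (by simp) _).hasMFDerivAt)
    (hasMFDerivAt_fibreIncl m y)
  let D : E →L[ℝ] F →L[ℝ] ℝ := (momentumDeriv G L (fibreIncl m y) : E × E →L[ℝ] F →L[ℝ] ℝ) ∘L
    fibreInclDeriv (E := E) m y
  have h2 : HasFDerivAt (F := F →L[ℝ] ℝ) (fun z : E => momentum (F := F) G L (fibreIncl m z)) D y :=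
    hasMFDerivAt_iff_hasFDerivAt.1 h1
  let σ : F →L[ℝ] E := infAction G m
  have h3 : HasFDerivAt (fun x : E => fderiv ℝ (fun z : E => L (fibreIncl m z)) x)
      (fderiv ℝ (fun x : E => fderiv ℝ (fun z : E => L (fibreIncl m z)) x) y) y :=
    (((contDiff_comp_fibreIncl hL m).fderiv_right (m := 1)
      (by norm_num; exact ENat.LEInfty.out)).differentiable (by simp) y).hasFDerivAt
  have h4 : HasFDerivAt (fun x : E => (fderiv ℝ (fun z : E => L (fibreIncl m z)) x) ∘L σ)
      _ y := ((ContinuousLinearMap.compL ℝ F E ℝ).flip σ).hasFDerivAt.comp y h3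
  have h5 := h2.unique h4
  exact congrArg (fun l : E →L[ℝ] F →L[ℝ] ℝ => l w ξ) h5

lemma hessian_symm (hL : ContMDiff 𝓘(ℝ, E).tangent 𝓘(ℝ, ℝ) ∞ L)
    (v : TangentBundle 𝓘(ℝ, E) M) (u w : TangentSpace 𝓘(ℝ, E) v.proj) :
    hessian L v u w = hessian L v w u := by
  obtain ⟨m, y⟩ := v
  change E at y u w
  have h := ((contDiff_comp_fibreIncl hL m).contDiffAt (x := y)).isSymmSndFDerivAt
    (by simpa using ENat.LEInfty.out)
  exact h u w

lemma lockedHessian_apply (v : TangentBundle 𝓘(ℝ, E) M) (ξ η : GroupLieAlgebra 𝓘(ℝ, F) G) :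
    lockedHessian G L v ξ η =
      hessian L v (infAction G v.proj ξ) (infAction G v.proj η) := rfl

/-- The identity behind everything on `N_μ`: it makes `p` a submersion and shows that the vertical
lifts of orbit directions are complementary to `ker dp`. -/
lemma lockedHessian_eq_momentumDeriv (hL : ContMDiff 𝓘(ℝ, E).tangent 𝓘(ℝ, ℝ) ∞ L)
    (v : TangentBundle 𝓘(ℝ, E) M) :
    lockedHessian (F := F) G L v =
      momentumDeriv G L v ∘L vlift v ∘L infAction (F := F) G v.proj := by
  refine ContinuousLinearMap.ext fun ξ => ContinuousLinearMap.ext fun η => ?_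
  exact (momentumDeriv_vlift hL v _ η).symm

variable (F G L) in
/-- The solution `η` of `g(η̃, ζ̃) = W(p_ζ)`, `ζ ∈ 𝔤`. -/
def momentumSolution (v : TangentBundle 𝓘(ℝ, E) M) :
    TangentSpace 𝓘(ℝ, E).tangent v →L[ℝ] GroupLieAlgebra 𝓘(ℝ, F) G :=
  (lockedHessian (F := F) G L v).inverse ∘L momentumDeriv G L v

variable (F G L) in
/-- The linear map `barVector`. -/
def barMap (v : TangentBundle 𝓘(ℝ, E) M) :
    TangentSpace 𝓘(ℝ, E).tangent v →L[ℝ] TangentSpace 𝓘(ℝ, E).tangent v :=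
  ContinuousLinearMap.id ℝ _ + -(vlift v ∘L infAction (F := F) G v.proj ∘L momentumSolution F G L v)

lemma barMap_apply (v : TangentBundle 𝓘(ℝ, E) M) (W : TangentSpace 𝓘(ℝ, E).tangent v) :
    barMap F G L v W =
      W - vlift v (infAction (F := F) G v.proj (momentumSolution F G L v W)) :=
  (sub_eq_add_neg _ _).symm

lemma barVector_eq_barMap (v : TangentBundle 𝓘(ℝ, E) M) (W : TangentSpace 𝓘(ℝ, E).tangent v) :
    barVector F G L v W = barMap F G L v W := by
  rw [barVector, verticalLift_eq_vlift, map_neg, map_neg, barMap_apply, sub_eq_add_neg]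
  rfl

lemma mfderiv_proj_barMap (v : TangentBundle 𝓘(ℝ, E) M)
    (W : TangentSpace 𝓘(ℝ, E).tangent v) :
    mfderiv 𝓘(ℝ, E).tangent 𝓘(ℝ, E) (fun u : TangentBundle 𝓘(ℝ, E) M => u.proj) v
      (barMap F G L v W) = mfderiv 𝓘(ℝ, E).tangent 𝓘(ℝ, E)
        (fun u : TangentBundle 𝓘(ℝ, E) M => u.proj) v W := by
  rw [barMap_apply, map_sub, mfderiv_proj_vlift, sub_zero]

/-! ### Consequences of the non-degeneracy of `γ` -/

section Regular

variable [FiniteDimensional ℝ E] [FiniteDimensional ℝ F]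

lemma lockedHessian_injective
    (hreg : ∀ v (ξ : GroupLieAlgebra 𝓘(ℝ, F) G), (∀ η, lockedHessian G L v ξ η = 0) → ξ = 0)
    (v : TangentBundle 𝓘(ℝ, E) M) :
    Function.Injective (lockedHessian (F := F) G L v : F →L[ℝ] F →L[ℝ] ℝ) :=
  (injective_iff_map_eq_zero _).2 fun ξ hξ => hreg v ξ fun η =>
    congrArg (fun l : F →L[ℝ] ℝ => l η) hξ

/-- If `ξ̃` vanishes at `m`, then `ξ` is in the kernel of `γ` at every `v` over `m`; the zero vector
serves as `v`. -/
lemma infAction_injective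
    (hreg : ∀ v (ξ : GroupLieAlgebra 𝓘(ℝ, F) G), (∀ η, lockedHessian G L v ξ η = 0) → ξ = 0)
    (m : M) : Function.Injective (infAction (E := E) (F := F) G m) := by
  refine (injective_iff_map_eq_zero _).2 fun ξ hξ => ?_
  refine hreg (⟨m, (0 : E)⟩ : TangentBundle 𝓘(ℝ, E) M) ξ fun η => ?_
  rw [lockedHessian_apply]
  have : hessian L (⟨m, (0 : E)⟩ : TangentBundle 𝓘(ℝ, E) M) (infAction G m ξ) = 0 := by
    rw [hξ, map_zero]
  exact congrArg (fun l : E →L[ℝ] ℝ => l (infAction G m η)) this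

lemma lockedHessian_momentumSolution
    (hreg : ∀ v (ξ : GroupLieAlgebra 𝓘(ℝ, F) G), (∀ η, lockedHessian G L v ξ η = 0) → ξ = 0)
    (v : TangentBundle 𝓘(ℝ, E) M) (W : TangentSpace 𝓘(ℝ, E).tangent v) :
    lockedHessian G L v (momentumSolution F G L v W) = momentumDeriv G L v W :=
  apply_inverse_of_injective_dual (V := F) (lockedHessian_injective hreg v) _

/-- The correction subtracts a vector on which `dp` takes the value `γ(γ⁻¹ dp(W)) = dp(W)`. With the
next two lemmas, `barMap` is the projection onto `ker dp` along the vertical lifts of orbit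
directions. -/
lemma momentumDeriv_barMap (hL : ContMDiff 𝓘(ℝ, E).tangent 𝓘(ℝ, ℝ) ∞ L)
    (hreg : ∀ v (ξ : GroupLieAlgebra 𝓘(ℝ, F) G), (∀ η, lockedHessian G L v ξ η = 0) → ξ = 0)
    (v : TangentBundle 𝓘(ℝ, E) M) (W : TangentSpace 𝓘(ℝ, E).tangent v) :
    momentumDeriv (F := F) G L v (barMap F G L v W) = 0 := by
  rw [barMap_apply, map_sub, sub_eq_zero, ← lockedHessian_momentumSolution hreg,
    lockedHessian_eq_momentumDeriv hL]
  rfl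

lemma barMap_of_momentumDeriv_eq_zero
    (hreg : ∀ v (ξ : GroupLieAlgebra 𝓘(ℝ, F) G), (∀ η, lockedHessian G L v ξ η = 0) → ξ = 0)
    {v : TangentBundle 𝓘(ℝ, E) M} {W : TangentSpace 𝓘(ℝ, E).tangent v}
    (hW : momentumDeriv (F := F) G L v W = 0) : barMap F G L v W = W := by
  have h1 : momentumSolution F G L v W = 0 := by
    refine hreg v _ fun η => ?_
    rw [lockedHessian_momentumSolution hreg, hW]
    rfl
  rw [barMap_apply, h1, map_zero, map_zero, sub_zero]

lemma barMap_vlift_infAction (hL : ContMDiff 𝓘(ℝ, E).tangent 𝓘(ℝ, ℝ) ∞ L)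
    (hreg : ∀ v (ξ : GroupLieAlgebra 𝓘(ℝ, F) G), (∀ η, lockedHessian G L v ξ η = 0) → ξ = 0)
    (v : TangentBundle 𝓘(ℝ, E) M) (η : GroupLieAlgebra 𝓘(ℝ, F) G) :
    barMap F G L v (vlift v (infAction G v.proj η)) = 0 := by
  have h1 : momentumSolution F G L v (vlift v (infAction G v.proj η)) = η := by
    refine lockedHessian_injective hreg v ?_
    refine (lockedHessian_momentumSolution hreg v _).trans ?_
    rw [lockedHessian_eq_momentumDeriv hL]
    rfl
  rw [barMap_apply, h1, sub_self]

/-- Recognizes the corrected vector by its two defining properties; used to prove equivariance of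
the correction. -/
lemma barMap_eq_of_sub {v : TangentBundle 𝓘(ℝ, E) M}
    (hL : ContMDiff 𝓘(ℝ, E).tangent 𝓘(ℝ, ℝ) ∞ L)
    (hreg : ∀ v (ξ : GroupLieAlgebra 𝓘(ℝ, F) G), (∀ η, lockedHessian G L v ξ η = 0) → ξ = 0)
    {W W' : TangentSpace 𝓘(ℝ, E).tangent v} (hW' : momentumDeriv (F := F) G L v W' = 0)
    {η : GroupLieAlgebra 𝓘(ℝ, F) G} (h : W = W' + vlift v (infAction G v.proj η)) :
    barMap F G L v W = W' := by
  rw [h, map_add, barMap_vlift_infAction hL hreg, add_zero,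
    barMap_of_momentumDeriv_eq_zero hreg hW']

/-- Vertical lifts of orbit directions already reach every covector, because `γ` is onto. -/
lemma momentumDeriv_surjective (hL : ContMDiff 𝓘(ℝ, E).tangent 𝓘(ℝ, ℝ) ∞ L)
    (hreg : ∀ v (ξ : GroupLieAlgebra 𝓘(ℝ, F) G), (∀ η, lockedHessian G L v ξ η = 0) → ξ = 0)
    (v : TangentBundle 𝓘(ℝ, E) M) :
    Function.Surjective (momentumDeriv (F := F) G L v) := by
  intro α
  refine ⟨vlift v (infAction G v.proj ((lockedHessian (F := F) G L v).inverse α)), ?_⟩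
  have h1 := apply_inverse_of_injective_dual (V := F) (lockedHessian_injective hreg v) α
  refine Eq.trans ?_ h1
  exact (congrArg (fun l : F →L[ℝ] F →L[ℝ] ℝ => l _) (lockedHessian_eq_momentumDeriv hL v)).symm

lemma smoothHomAt_momentumDeriv (hL : ContMDiff 𝓘(ℝ, E).tangent 𝓘(ℝ, ℝ) ∞ L)
    (v₀ : TangentBundle 𝓘(ℝ, E) M) :
    SmoothHomAt 𝓘(ℝ, E).tangent 𝓘(ℝ, E).tangent 𝓘(ℝ, F →L[ℝ] ℝ) id
      (fun _ => (0 : F →L[ℝ] ℝ))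
      (fun v => (momentumDeriv (F := F) G L v : E × E →L[ℝ] F →L[ℝ] ℝ)) v₀ :=
  (SmoothHomAt.mfderiv_const (contMDiff_momentum hL v₀)).target_model _

/-- The solution `X` of `γ ∘ X = dp`, with `γ` smooth and injective. -/
lemma smoothHomAt_momentumSolution (hL : ContMDiff 𝓘(ℝ, E).tangent 𝓘(ℝ, ℝ) ∞ L)
    (hreg : ∀ v (ξ : GroupLieAlgebra 𝓘(ℝ, F) G), (∀ η, lockedHessian G L v ξ η = 0) → ξ = 0)
    (v₀ : TangentBundle 𝓘(ℝ, E) M) :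
    SmoothHomAt 𝓘(ℝ, E).tangent 𝓘(ℝ, E).tangent 𝓘(ℝ, F) id
      (fun _ : TangentBundle 𝓘(ℝ, E) M => (1 : G)) (momentumSolution F G L) v₀ := by
  have := isManifold_of_lieGroup F G
  have hp := smoothHomAt_momentumDeriv (F := F) (G := G) hL v₀
  have hγ := hp.comp (smoothHomAt_vlift_infAction (F := F) (G := G) v₀) continuousAt_id
  refine SmoothHomAt.of_comp_injective hγ hp continuousAt_const ?_ (.of_forall fun v => ?_)
  · have h1 := lockedHessian_injective hreg v₀
    rw [lockedHessian_eq_momentumDeriv hL] at h1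
    exact h1
  · refine ContinuousLinearMap.ext fun W => ?_
    refine Eq.trans ?_ (lockedHessian_momentumSolution hreg v W)
    rw [lockedHessian_eq_momentumDeriv hL]
    rfl

lemma smoothHomAt_id (v₀ : TangentBundle 𝓘(ℝ, E) M) :
    SmoothHomAt 𝓘(ℝ, E).tangent 𝓘(ℝ, E).tangent 𝓘(ℝ, E).tangent id id
      (fun v : TangentBundle 𝓘(ℝ, E) M =>
        ContinuousLinearMap.id ℝ (TangentSpace 𝓘(ℝ, E).tangent v)) v₀ :=
  (SmoothHomAt.mfderiv_const (contMDiffAt_id (x := v₀))).congr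
    (.of_forall fun _ => mfderiv_id.symm)

/-- The correction to vectors tangent to the level sets of momentum is smooth. -/
lemma smoothHomAt_barMap (hL : ContMDiff 𝓘(ℝ, E).tangent 𝓘(ℝ, ℝ) ∞ L)
    (hreg : ∀ v (ξ : GroupLieAlgebra 𝓘(ℝ, F) G), (∀ η, lockedHessian G L v ξ η = 0) → ξ = 0)
    (v₀ : TangentBundle 𝓘(ℝ, E) M) :
    SmoothHomAt 𝓘(ℝ, E).tangent 𝓘(ℝ, E).tangent 𝓘(ℝ, E).tangent id id (barMap F G L) v₀ := by
  have := isManifold_of_lieGroup F G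
  have h1 := (smoothHomAt_vlift_infAction (F := F) (G := G) v₀).comp
    (smoothHomAt_momentumSolution hL hreg v₀) continuousAt_const
  exact (smoothHomAt_id v₀).add h1.neg

end Regular

end Momentum

end

noncomputable section

/-! ### Equivariance -/

section Adjoint

variable {F : Type*} [NormedAddCommGroup F] [NormedSpace ℝ F]
  {G : Type*} [TopologicalSpace G] [ChartedSpace F G] [Group G] [LieGroup 𝓘(ℝ, F) ∞ G]

lemma contMDiff_conj (g : G) : ContMDiff 𝓘(ℝ, F) 𝓘(ℝ, F) ∞ (fun h : G => g * h * g⁻¹) :=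
  (contMDiff_const.mul contMDiff_id).mul contMDiff_const

lemma hasMFDerivAt_conj (g : G) {h : G} (hh : h = 1) :
    HasMFDerivAt 𝓘(ℝ, F) 𝓘(ℝ, F) (fun h : G => g * h * g⁻¹) h
      (adjointMap (F := F) g : F →L[ℝ] F) := by
  subst hh
  exact ((contMDiff_conj g).mdifferentiable (by simp) 1).hasMFDerivAt

lemma adjointMap_one : adjointMap (F := F) (1 : G) = ContinuousLinearMap.id ℝ _ := by
  have h1 : (fun h : G => 1 * h * 1⁻¹) = id := by funext h; simp
  have h2 := hasMFDerivAt_conj (F := F) (1 : G) rfl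
  rw [h1] at h2
  exact hasMFDerivAt_unique h2 (hasMFDerivAt_id 1)

lemma adjointMap_mul (g h : G) :
    adjointMap (F := F) (g * h) = adjointMap (F := F) g ∘L adjointMap (F := F) h := by
  have h1 : (fun k : G => g * h * k * (g * h)⁻¹) =
      (fun k => g * k * g⁻¹) ∘ (fun k => h * k * h⁻¹) := by funext k; simp [mul_assoc]
  have h2 := hasMFDerivAt_conj (F := F) (g * h) rfl
  rw [h1] at h2
  exact hasMFDerivAt_unique h2 (HasMFDerivAt.comp (1 : G)
    (hasMFDerivAt_conj (F := F) g (by simp)) (hasMFDerivAt_conj (F := F) h rfl))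

lemma adjointMap_inv_apply (g : G) (ξ : GroupLieAlgebra 𝓘(ℝ, F) G) :
    adjointMap g (adjointMap g⁻¹ ξ) = ξ := by
  have h := adjointMap_mul (F := F) g g⁻¹
  rw [mul_inv_cancel, adjointMap_one] at h
  exact (congrArg (fun l : F →L[ℝ] F => l ξ) h).symm

lemma mul_mem_isotropyGroup {μ : GroupLieAlgebra 𝓘(ℝ, F) G →L[ℝ] ℝ} {g h : G}
    (hg : g ∈ isotropyGroup μ) (hh : h ∈ isotropyGroup μ) : g * h ∈ isotropyGroup μ := fun ξ => by
  rw [adjointMap_mul]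
  exact (hg _).trans (hh ξ)

lemma inv_mem_isotropyGroup {μ : GroupLieAlgebra 𝓘(ℝ, F) G →L[ℝ] ℝ} {g : G}
    (hg : g ∈ isotropyGroup μ) : g⁻¹ ∈ isotropyGroup μ := fun ξ => by
  rw [← hg, adjointMap_inv_apply]

lemma one_mem_isotropyGroup {μ : GroupLieAlgebra 𝓘(ℝ, F) G →L[ℝ] ℝ} :
    (1 : G) ∈ isotropyGroup μ := fun ξ => by
  rw [adjointMap_one]; rfl

variable (μ : GroupLieAlgebra 𝓘(ℝ, F) G →L[ℝ] ℝ)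

lemma zero_mem_isotropyAlgebra : (0 : GroupLieAlgebra 𝓘(ℝ, F) G) ∈ isotropyAlgebra μ := by
  refine ⟨fun _ => 1, contMDiff_const, rfl, fun _ => one_mem_isotropyGroup, ?_⟩
  rw [mfderiv_const]; rfl

variable {μ}

/-- `𝔤_μ` consists of velocities of curves in `G_μ`, so each closure property comes from an
operation on curves: the product for sums, and below a change of parameter for multiples and
conjugation for the adjoint action. -/
lemma add_mem_isotropyAlgebra {ξ η : GroupLieAlgebra 𝓘(ℝ, F) G} (hξ : ξ ∈ isotropyAlgebra μ)
    (hη : η ∈ isotropyAlgebra μ) : ξ + η ∈ isotropyAlgebra μ := by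
  obtain ⟨c, hc, hc0, hcμ, rfl⟩ := hξ
  obtain ⟨d, hd, hd0, hdμ, rfl⟩ := hη
  refine ⟨fun t => c t * d t, hc.mul hd, by simp [hc0, hd0],
    fun t => mul_mem_isotropyGroup (hcμ t) (hdμ t), ?_⟩
  -- The product curve is the diagonal of a map of two parameters, whose partial maps at the origin
  -- are `c` and `d`.
  have hq : ContMDiff (𝓘(ℝ, ℝ).prod 𝓘(ℝ, ℝ)) 𝓘(ℝ, F) ∞ (fun q : ℝ × ℝ => c q.1 * d q.2) :=
    (hc.comp contMDiff_fst).mul (hd.comp contMDiff_snd)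
  have h1 := HasMFDerivAt.comp (0 : ℝ) (f := fun t : ℝ => (t, t))
    ((hq.mdifferentiable (by simp) (0, 0)).hasMFDerivAt)
    ((hasMFDerivAt_id (I := 𝓘(ℝ, ℝ)) (0 : ℝ)).prodMk (hasMFDerivAt_id (I := 𝓘(ℝ, ℝ)) (0 : ℝ)))
  have h2 := mfderiv_prod_eq_add ((hq.mdifferentiable (by simp) (0, 0)))
  have h3 : (fun z : ℝ × ℝ => c z.1 * d ((0 : ℝ), (0 : ℝ)).2) = fun z => c z.1 := by
    simp [hd0]
  have h4 : (fun z : ℝ × ℝ => c ((0 : ℝ), (0 : ℝ)).1 * d z.2) = fun z => d z.2 := by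
    simp [hc0]
  have h5 := HasMFDerivAt.comp ((0 : ℝ), (0 : ℝ)) (g := c) (f := Prod.fst)
    ((hc.mdifferentiable (by simp) 0).hasMFDerivAt) (hasMFDerivAt_fst (I := 𝓘(ℝ, ℝ)) (I' := 𝓘(ℝ, ℝ)) _)
  have h6 := HasMFDerivAt.comp ((0 : ℝ), (0 : ℝ)) (g := d) (f := Prod.snd)
    ((hd.mdifferentiable (by simp) 0).hasMFDerivAt) (hasMFDerivAt_snd (I := 𝓘(ℝ, ℝ)) (I' := 𝓘(ℝ, ℝ)) _)
  have h7 := congrArg (fun l : ℝ →L[ℝ] F => l 1) h1.mfderiv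
  refine h7.trans ?_
  refine (congrArg (fun l : ℝ × ℝ →L[ℝ] F => l (1, 1)) h2).trans ?_
  rw [h3, h4]
  exact congrArg₂ (fun a b : ℝ × ℝ →L[ℝ] F => a (1, 1) + b (1, 1)) h5.mfderiv h6.mfderiv

lemma smul_mem_isotropyAlgebra (a : ℝ) {ξ : GroupLieAlgebra 𝓘(ℝ, F) G}
    (hξ : ξ ∈ isotropyAlgebra μ) : a • ξ ∈ isotropyAlgebra μ := by
  obtain ⟨c, hc, hc0, hcμ, rfl⟩ := hξ
  have hl : HasDerivAt (fun t : ℝ => a * t) a 0 := by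
    simpa using (hasDerivAt_id (0 : ℝ)).const_mul a
  have h0 : HasMFDerivAt 𝓘(ℝ, ℝ) 𝓘(ℝ, F) c (a * 0)
      (mfderiv 𝓘(ℝ, ℝ) 𝓘(ℝ, F) c 0 : ℝ →L[ℝ] F) := by
    rw [mul_zero]; exact (hc.mdifferentiable (by simp) 0).hasMFDerivAt
  have h1 := HasMFDerivAt.comp (0 : ℝ) (f := fun t : ℝ => a * t) h0 hl.hasFDerivAt.hasMFDerivAt
  refine ⟨fun t => c (a * t), hc.comp (contDiff_const.mul contDiff_id).contMDiff, by simp [hc0],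
    fun t => hcμ _, ?_⟩
  refine (congrArg (fun l : ℝ →L[ℝ] F => l 1) h1.mfderiv).trans ?_
  refine Eq.trans ?_ ((mfderiv 𝓘(ℝ, ℝ) 𝓘(ℝ, F) c 0 : ℝ →L[ℝ] F).map_smul a 1)
  exact congrArg (mfderiv 𝓘(ℝ, ℝ) 𝓘(ℝ, F) c 0 : ℝ →L[ℝ] F)
    (by simp : (1 : ℝ) • a = a • (1 : ℝ))

lemma adjointMap_mem_isotropyAlgebra {g : G} (hg : g ∈ isotropyGroup μ)
    {ξ : GroupLieAlgebra 𝓘(ℝ, F) G} (hξ : ξ ∈ isotropyAlgebra μ) :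
    adjointMap g ξ ∈ isotropyAlgebra μ := by
  obtain ⟨c, hc, hc0, hcμ, rfl⟩ := hξ
  refine ⟨fun t => g * c t * g⁻¹, (contMDiff_const.mul hc).mul contMDiff_const, by simp [hc0],
    fun t => mul_mem_isotropyGroup (mul_mem_isotropyGroup hg (hcμ t)) (inv_mem_isotropyGroup hg),
    ?_⟩
  have h1 := HasMFDerivAt.comp (0 : ℝ) (f := c) (hasMFDerivAt_conj (F := F) g hc0)
    ((hc.mdifferentiable (by simp) 0).hasMFDerivAt)
  exact congrArg (fun l : ℝ →L[ℝ] F => l 1) h1.mfderiv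

variable (μ) in
/-- The isotropy algebra as a subspace. -/
def isotropySubspace : Submodule ℝ F where
  carrier := isotropyAlgebra μ
  zero_mem' := zero_mem_isotropyAlgebra μ
  add_mem' := add_mem_isotropyAlgebra
  smul_mem' := smul_mem_isotropyAlgebra

variable {EX : Type*} [NormedAddCommGroup EX] [NormedSpace ℝ EX] {HX : Type*} [TopologicalSpace HX]
  {I : ModelWithCorners ℝ EX HX} {X : Type*} [TopologicalSpace X] [ChartedSpace HX X]

/-- The infinitesimal generators of a smooth action are equivariant. -/
lemma mfderiv_generator_eq {α : G → X → X}
    (hα : ContMDiff (𝓘(ℝ, F).prod I) I ∞ (fun q : G × X => α q.1 q.2))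
    (h1 : ∀ x, α 1 x = x) (hmul : ∀ g h x, α (g * h) x = α g (α h x)) (h : G) (x : X) (ξ : F) :
    (mfderiv I I (α h) x : EX →L[ℝ] EX)
        ((mfderiv 𝓘(ℝ, F) I (fun g => α g x) 1 : F →L[ℝ] EX) ξ) =
      (mfderiv 𝓘(ℝ, F) I (fun g => α g (α h x)) 1 : F →L[ℝ] EX)
        ((adjointMap (F := F) h : F →L[ℝ] F) ξ) := by
  have e1 : ∀ x, ContMDiff 𝓘(ℝ, F) I ∞ (fun g => α g x) := fun x =>
    hα.comp (contMDiff_id.prodMk contMDiff_const)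
  have e2 : ContMDiff I I ∞ (α h) := hα.comp (contMDiff_const.prodMk contMDiff_id)
  have k1 := HasMFDerivAt.comp (1 : G) (f := fun g => α g x) (g := α h)
    ((e2.mdifferentiable (by simp) _).hasMFDerivAt) ((e1 x).mdifferentiable (by simp) 1).hasMFDerivAt
  have k2 := HasMFDerivAt.comp (1 : G) (f := fun g => h * g * h⁻¹) (g := fun g => α g (α h x))
    (((e1 (α h x)).mdifferentiable (by simp) _).hasMFDerivAt) (hasMFDerivAt_conj (F := F) h rfl)
  -- The identity `h (g x) = (h g h⁻¹) (h x)`, to be differentiated at `g = 1`.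
  have e3 : (α h ∘ fun g => α g x) =
      ((fun g => α g (α h x)) ∘ fun g => h * g * h⁻¹) := by
    funext g
    simp only [Function.comp_apply, ← hmul]
    simp [mul_assoc]
  rw [e3] at k1
  have k3 := congrArg (fun l : F →L[ℝ] EX => l ξ) (hasMFDerivAt_unique k1 k2)
  refine Eq.trans ?_ (k3.trans ?_)
  · exact (mfderiv_apply_congr_point (E₀ := EX) (E₁ := EX) (h1 x) _).symm
  · exact mfderiv_apply_congr_point (E₀ := F) (E₁ := EX) (by simp) _

lemma hasMFDerivAt_curve {α : G → X} (hα : ContMDiff 𝓘(ℝ, F) I ∞ α) {c : ℝ → G}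
    (hc : ContMDiff 𝓘(ℝ, ℝ) 𝓘(ℝ, F) ∞ c) (hc0 : c 0 = 1) :
    HasMFDerivAt 𝓘(ℝ, ℝ) I (fun t => α (c t)) 0 ((mfderiv 𝓘(ℝ, F) I α 1 : F →L[ℝ] EX) ∘L
      (mfderiv 𝓘(ℝ, ℝ) 𝓘(ℝ, F) c 0 : ℝ →L[ℝ] F)) := by
  have h1 : HasMFDerivAt 𝓘(ℝ, F) I α (c 0) (mfderiv 𝓘(ℝ, F) I α 1 : F →L[ℝ] EX) := by
    rw [hc0]; exact (hα.mdifferentiable (by simp) 1).hasMFDerivAt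
  exact HasMFDerivAt.comp (0 : ℝ) h1 (hc.mdifferentiable (by simp) 0).hasMFDerivAt

end Adjoint

end

noncomputable section

/-- The infinitesimal form of an equivariance `C ∘ p ∘ θ = p`; applied to the momentum, with `C` the
transpose of the adjoint map. -/
lemma mfderiv_of_comp_comp_eq {EX : Type*} [NormedAddCommGroup EX] [NormedSpace ℝ EX]
    {HX : Type*} [TopologicalSpace HX] {I : ModelWithCorners ℝ EX HX} {X : Type*}
    [TopologicalSpace X] [ChartedSpace HX X] {V : Type*} [NormedAddCommGroup V] [NormedSpace ℝ V]
    {θ : X → X} {p : X → V} {C : V →L[ℝ] V} {x : X} (hp : MDifferentiable I 𝓘(ℝ, V) p)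
    (hθ : MDifferentiable I I θ) (h : ∀ x, C (p (θ x)) = p x) (W : EX) :
    C ((mfderiv I 𝓘(ℝ, V) p (θ x) : EX →L[ℝ] V) ((mfderiv I I θ x : EX →L[ℝ] EX) W)) =
      (mfderiv I 𝓘(ℝ, V) p x : EX →L[ℝ] V) W := by
  have h1 := HasMFDerivAt.comp x (hp _).hasMFDerivAt (hθ x).hasMFDerivAt
  have h2 := HasMFDerivAt.comp x (g := C) (C.hasFDerivAt (x := p (θ x))).hasMFDerivAt h1
  have h3 : C ∘ p ∘ θ = p := funext h
  rw [h3] at h2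
  exact congrArg (fun l : EX →L[ℝ] V => l W) (hasMFDerivAt_unique h2 (hp x).hasMFDerivAt)

/-! ### Equivariance of the momentum, the Hessian and the correction -/

section Equivariance

variable {E : Type*} [NormedAddCommGroup E] [NormedSpace ℝ E]
  {M : Type*} [TopologicalSpace M] [ChartedSpace E M] [IsManifold 𝓘(ℝ, E) ∞ M]
  {F : Type*} [NormedAddCommGroup F] [NormedSpace ℝ F]
  {G : Type*} [TopologicalSpace G] [ChartedSpace F G] [Group G]
  [LieGroup 𝓘(ℝ, F) ∞ G] [MulAction G M] [ContMDiffSMul 𝓘(ℝ, F) 𝓘(ℝ, E) ∞ G M]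
  {L : TangentBundle 𝓘(ℝ, E) M → ℝ}

lemma mfderiv_smul_infAction (h : G) (m : M) (ξ : GroupLieAlgebra 𝓘(ℝ, F) G) :
    mfderiv 𝓘(ℝ, E) 𝓘(ℝ, E) (fun x : M => h • x) m (infAction G m ξ) =
      infAction G (h • m) (adjointMap h ξ) :=
  mfderiv_generator_eq (F := F) (I := 𝓘(ℝ, E)) (α := fun (g : G) (x : M) => g • x)
    (contMDiff_action F E G M) (one_smul G) mul_smul h m ξ

lemma mfderiv_tangentAction_generator (h : G) (v : TangentBundle 𝓘(ℝ, E) M)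
    (ξ : GroupLieAlgebra 𝓘(ℝ, F) G) :
    mfderiv 𝓘(ℝ, E).tangent 𝓘(ℝ, E).tangent (tangentAction h) v (generator G v ξ) =
      generator G (tangentAction h v) (adjointMap h ξ) :=
  mfderiv_generator_eq (F := F) (I := 𝓘(ℝ, E).tangent)
    (α := fun (g : G) (x : TangentBundle 𝓘(ℝ, E) M) => tangentAction g x)
    contMDiff_tangentAction_uncurry tangentAction_one (tangentAction_mul (F := F)) h v ξ

include F in
lemma mfderiv_tangentAction_vlift (h : G) (v : TangentBundle 𝓘(ℝ, E) M)
    (w : TangentSpace 𝓘(ℝ, E) v.proj) :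
    mfderiv 𝓘(ℝ, E).tangent 𝓘(ℝ, E).tangent (tangentAction h) v (vlift v w) =
      vlift (tangentAction h v) (mfderiv 𝓘(ℝ, E) 𝓘(ℝ, E) (fun x : M => h • x) v.proj w) :=
  mfderiv_tangentMap_vlift (contMDiff_smul_left F h) v w

include F in
lemma mfderiv_proj_tangentAction (h : G) (v : TangentBundle 𝓘(ℝ, E) M)
    (W : TangentSpace 𝓘(ℝ, E).tangent v) :
    mfderiv 𝓘(ℝ, E).tangent 𝓘(ℝ, E) (fun u : TangentBundle 𝓘(ℝ, E) M => u.proj)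
        (tangentAction h v)
        (mfderiv 𝓘(ℝ, E).tangent 𝓘(ℝ, E).tangent (tangentAction h) v W) =
      mfderiv 𝓘(ℝ, E) 𝓘(ℝ, E) (fun x : M => h • x) v.proj (mfderiv 𝓘(ℝ, E).tangent 𝓘(ℝ, E)
        (fun u : TangentBundle 𝓘(ℝ, E) M => u.proj) v W) :=
  mfderiv_proj_tangentMap (contMDiff_smul_left F h) v W

lemma mfderiv_proj_generator (v : TangentBundle 𝓘(ℝ, E) M) (ξ : GroupLieAlgebra 𝓘(ℝ, F) G) :
    mfderiv 𝓘(ℝ, E).tangent 𝓘(ℝ, E) (fun u : TangentBundle 𝓘(ℝ, E) M => u.proj) v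
      (generator G v ξ) = infAction G v.proj ξ := by
  have hs : ContMDiff 𝓘(ℝ, F) 𝓘(ℝ, E).tangent ∞ (fun g : G => tangentAction g v) :=
    contMDiff_tangentAction_uncurry.comp (contMDiff_id.prodMk contMDiff_const)
  have h1 := HasMFDerivAt.comp (1 : G) (f := fun g : G => tangentAction g v)
    ((contMDiff_bundleProj.mdifferentiable (by simp) _).hasMFDerivAt)
    ((hs.mdifferentiable (by simp) 1).hasMFDerivAt)
  have h2 := congrArg (fun l : F →L[ℝ] E => l ξ) h1.mfderiv
  refine Eq.trans ?_ h2.symm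
  exact (mfderiv_apply_congr_point (E₀ := E × E) (E₁ := E) (tangentAction_one v) _).symm

/-- Differentiate the invariance of `L` along the vertical lift of `ξ̃`: the tangent action carries
it to the vertical lift of the fundamental field of `Ad_h ξ`. -/
lemma momentum_tangentAction (hL : ContMDiff 𝓘(ℝ, E).tangent 𝓘(ℝ, ℝ) ∞ L)
    (hinv : ∀ (g : G) v, L (tangentAction g v) = L v) (h : G) (v : TangentBundle 𝓘(ℝ, E) M)
    (ξ : GroupLieAlgebra 𝓘(ℝ, F) G) :
    momentum G L (tangentAction h v) (adjointMap h ξ) = momentum G L v ξ := by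
  have h1 := HasMFDerivAt.comp v (f := tangentAction h) (g := L)
    ((hL.mdifferentiable (by simp) _).hasMFDerivAt)
    (((contMDiff_tangentAction (F := F) h).mdifferentiable (by simp) v).hasMFDerivAt)
  have h2 : L ∘ tangentAction h = L := funext (hinv h)
  rw [h2] at h1
  have h3 := hasMFDerivAt_unique h1 ((hL.mdifferentiable (by simp) v).hasMFDerivAt)
  have h4 := congrArg (fun l : E × E →L[ℝ] ℝ => l (vlift v (infAction G v.proj ξ))) h3
  refine (fibreDeriv_eq_mfderiv_vlift hL _ _).trans (Eq.trans ?_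
    (h4.trans (fibreDeriv_eq_mfderiv_vlift hL v (infAction G v.proj ξ)).symm))
  have h5 := mfderiv_tangentAction_vlift (F := F) h v (infAction G v.proj ξ)
  rw [mfderiv_smul_infAction] at h5
  exact congrArg (mfderiv 𝓘(ℝ, E).tangent 𝓘(ℝ, ℝ) L (tangentAction h v) : E × E →L[ℝ] ℝ) h5.symm

lemma tangentAction_mem_momentumLevel (hL : ContMDiff 𝓘(ℝ, E).tangent 𝓘(ℝ, ℝ) ∞ L)
    (hinv : ∀ (g : G) v, L (tangentAction g v) = L v)
    {μ : GroupLieAlgebra 𝓘(ℝ, F) G →L[ℝ] ℝ} {h : G} (hh : h ∈ isotropyGroup μ)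
    {v : TangentBundle 𝓘(ℝ, E) M} (hv : v ∈ momentumLevel L μ) :
    tangentAction h v ∈ momentumLevel L μ := by
  refine ContinuousLinearMap.ext fun ξ => ?_
  have h1 := momentum_tangentAction hL hinv h v (adjointMap h⁻¹ ξ)
  rw [adjointMap_inv_apply] at h1
  refine h1.trans ?_
  have h2 : momentum G L v = μ := hv
  rw [h2]
  exact inv_mem_isotropyGroup hh ξ

lemma momentumDeriv_tangentAction (hL : ContMDiff 𝓘(ℝ, E).tangent 𝓘(ℝ, ℝ) ∞ L)
    (hinv : ∀ (g : G) v, L (tangentAction g v) = L v) (h : G) (v : TangentBundle 𝓘(ℝ, E) M)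
    (W : TangentSpace 𝓘(ℝ, E).tangent v) (ξ : GroupLieAlgebra 𝓘(ℝ, F) G) :
    momentumDeriv G L (tangentAction h v)
        (mfderiv 𝓘(ℝ, E).tangent 𝓘(ℝ, E).tangent (tangentAction h) v W) (adjointMap h ξ) =
      momentumDeriv G L v W ξ := by
  let A : F →L[ℝ] F := adjointMap h
  let C : (F →L[ℝ] ℝ) →L[ℝ] (F →L[ℝ] ℝ) := (ContinuousLinearMap.compL ℝ F F ℝ).flip A
  have h1 := mfderiv_of_comp_comp_eq (V := F →L[ℝ] ℝ) (p := fun u => momentum (F := F) G L u)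
    (C := C) (x := v) ((contMDiff_momentum (F := F) hL).mdifferentiable (by simp))
    ((contMDiff_tangentAction (F := F) h).mdifferentiable (by simp))
    (fun u => ContinuousLinearMap.ext fun ζ => momentum_tangentAction hL hinv h u ζ) W
  exact congrArg (fun l : F →L[ℝ] ℝ => l ξ) h1

lemma momentumDeriv_tangentAction_eq_zero (hL : ContMDiff 𝓘(ℝ, E).tangent 𝓘(ℝ, ℝ) ∞ L)
    (hinv : ∀ (g : G) v, L (tangentAction g v) = L v) (h : G) {v : TangentBundle 𝓘(ℝ, E) M}
    {W : TangentSpace 𝓘(ℝ, E).tangent v} (hW : momentumDeriv (F := F) G L v W = 0) :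
    momentumDeriv (F := F) G L (tangentAction h v)
        (mfderiv 𝓘(ℝ, E).tangent 𝓘(ℝ, E).tangent (tangentAction h) v W) = 0 := by
  refine ContinuousLinearMap.ext fun ξ => ?_
  have h1 := momentumDeriv_tangentAction hL hinv h v W (adjointMap h⁻¹ ξ)
  rw [adjointMap_inv_apply, hW] at h1
  exact h1

/-- The tangent action preserves `ker dp` and maps vertical lifts of orbit directions to such lifts,
so it commutes with the projection along them. -/
lemma mfderiv_tangentAction_barMap [FiniteDimensional ℝ E] [FiniteDimensional ℝ F]
    (hL : ContMDiff 𝓘(ℝ, E).tangent 𝓘(ℝ, ℝ) ∞ L)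
    (hinv : ∀ (g : G) v, L (tangentAction g v) = L v)
    (hreg : ∀ v (ξ : GroupLieAlgebra 𝓘(ℝ, F) G), (∀ η, lockedHessian G L v ξ η = 0) → ξ = 0)
    (h : G) (v : TangentBundle 𝓘(ℝ, E) M) (W : TangentSpace 𝓘(ℝ, E).tangent v) :
    mfderiv 𝓘(ℝ, E).tangent 𝓘(ℝ, E).tangent (tangentAction h) v (barMap F G L v W) =
      barMap F G L (tangentAction h v)
        (mfderiv 𝓘(ℝ, E).tangent 𝓘(ℝ, E).tangent (tangentAction h) v W) := by
  refine (barMap_eq_of_sub hL hreg (momentumDeriv_tangentAction_eq_zero hL hinv h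
    (momentumDeriv_barMap hL hreg v W))
    (η := adjointMap h (momentumSolution F G L v W)) ?_).symm
  have h1 := mfderiv_tangentAction_vlift (F := F) h v
    (infAction G v.proj (momentumSolution F G L v W))
  rw [mfderiv_smul_infAction] at h1
  rw [barMap_apply, map_sub]
  exact ((congrArg (fun z : E × E => _ - _ + z) h1.symm).trans (sub_add_cancel _ _)).symm

-- By invariance, `L` on the fibre at `m` is `L` on the fibre at `h • m` composed with a linear map;
-- differentiate twice.
include F in
lemma hessian_tangentAction (hL : ContMDiff 𝓘(ℝ, E).tangent 𝓘(ℝ, ℝ) ∞ L)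
    (hinv : ∀ (g : G) v, L (tangentAction g v) = L v) (h : G) (v : TangentBundle 𝓘(ℝ, E) M)
    (u w : TangentSpace 𝓘(ℝ, E) v.proj) :
    hessian L (tangentAction h v) (mfderiv 𝓘(ℝ, E) 𝓘(ℝ, E) (fun x : M => h • x) v.proj u)
      (mfderiv 𝓘(ℝ, E) 𝓘(ℝ, E) (fun x : M => h • x) v.proj w) = hessian L v u w := by
  obtain ⟨m, y⟩ := v
  change E at y u w
  let D : E →L[ℝ] E := mfderiv 𝓘(ℝ, E) 𝓘(ℝ, E) (fun x : M => h • x) m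
  let φ : E → ℝ := fun z => L (fibreIncl (h • m) z)
  have hφ : ContDiff ℝ ∞ φ := contDiff_comp_fibreIncl hL (h • m)
  have h1 : (fun z : E => L (fibreIncl m z)) = fun z => φ (D z) :=
    funext fun z => (hinv h (fibreIncl m z)).symm
  have h2 : ∀ x, fderiv ℝ (fun z => φ (D z)) x = (fderiv ℝ φ (D x)) ∘L D := fun x =>
    (((hφ.differentiable (by simp) (D x)).hasFDerivAt).comp x D.hasFDerivAt).fderiv
  have h3 : HasFDerivAt (fderiv ℝ φ) (fderiv ℝ (fderiv ℝ φ) (D y)) (D y) :=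
    ((hφ.fderiv_right (m := 1)
      (by norm_num; exact ENat.LEInfty.out)).differentiable (by simp) _).hasFDerivAt
  have h4 := ((ContinuousLinearMap.compL ℝ E E ℝ).flip D).hasFDerivAt.comp y
    (h3.comp y D.hasFDerivAt)
  have h5 : fderiv ℝ (fun x => fderiv ℝ (fun z : E => L (fibreIncl m z)) x) y =
      (ContinuousLinearMap.compL ℝ E E ℝ).flip D ∘L fderiv ℝ (fderiv ℝ φ) (D y) ∘L D := by
    rw [h1]
    simp_rw [h2]
    exact h4.fderiv
  exact (congrArg (fun l : E →L[ℝ] E →L[ℝ] ℝ => l u w) h5).symm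

/-- If `ξ` is the velocity of a curve `c` in `G_μ`, the momentum is constantly `μ` along `c(t) · v`.
-/
lemma momentumDeriv_generator_eq_zero (hL : ContMDiff 𝓘(ℝ, E).tangent 𝓘(ℝ, ℝ) ∞ L)
    (hinv : ∀ (g : G) v, L (tangentAction g v) = L v)
    {μ : GroupLieAlgebra 𝓘(ℝ, F) G →L[ℝ] ℝ} {v : TangentBundle 𝓘(ℝ, E) M}
    (hv : v ∈ momentumLevel L μ) {ξ : GroupLieAlgebra 𝓘(ℝ, F) G} (hξ : ξ ∈ isotropyAlgebra μ) :
    momentumDeriv (F := F) G L v (generator G v ξ) = 0 := by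
  obtain ⟨c, hc, hc0, hcμ, rfl⟩ := hξ
  have hs : ContMDiff 𝓘(ℝ, F) 𝓘(ℝ, E).tangent ∞ (fun g : G => tangentAction g v) :=
    contMDiff_tangentAction_uncurry.comp (contMDiff_id.prodMk contMDiff_const)
  have h1 := hasMFDerivAt_curve hs hc hc0
  let p : TangentBundle 𝓘(ℝ, E) M → F →L[ℝ] ℝ := fun u => momentum (F := F) G L u
  have h2 : HasMFDerivAt 𝓘(ℝ, E).tangent 𝓘(ℝ, F →L[ℝ] ℝ) p (tangentAction (c 0) v)
      (momentumDeriv (F := F) G L v : E × E →L[ℝ] F →L[ℝ] ℝ) := by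
    rw [hc0, tangentAction_one]
    exact ((contMDiff_momentum hL).mdifferentiable (by simp) v).hasMFDerivAt
  have h3 := HasMFDerivAt.comp (0 : ℝ) (M' := TangentBundle 𝓘(ℝ, E) M)
    (f := fun t => tangentAction (c t) v) h2 h1
  let ν : F →L[ℝ] ℝ := μ
  have h4 : p ∘ (fun t => tangentAction (c t) v) = fun _ => ν :=
    funext fun t => tangentAction_mem_momentumLevel hL hinv (hcμ t) hv
  rw [h4] at h3
  have h5 := hasMFDerivAt_unique h3 (hasMFDerivAt_const ν (0 : ℝ))
  exact congrArg (fun l : ℝ →L[ℝ] F →L[ℝ] ℝ => l 1) h5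

end Equivariance

end

noncomputable section

/-! ### Families of linear maps on a Lie algebra -/

/-- A family of linear maps on a fixed tangent space is a family of linear maps on the model
space. -/
lemma SmoothHomAt.source_const_model {E : Type*} [NormedAddCommGroup E] [NormedSpace ℝ E]
    {H : Type*} [TopologicalSpace H] {I : ModelWithCorners ℝ E H}
    {M : Type*} [TopologicalSpace M] [ChartedSpace H M] [IsManifold I ∞ M]
    {EN : Type*} [NormedAddCommGroup EN] [NormedSpace ℝ EN]
    {HN : Type*} [TopologicalSpace HN] {J : ModelWithCorners ℝ EN HN}
    {N : Type*} [TopologicalSpace N] [ChartedSpace HN N]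
    {E' : Type*} [NormedAddCommGroup E'] [NormedSpace ℝ E']
    {H' : Type*} [TopologicalSpace H'] {I' : ModelWithCorners ℝ E' H'}
    {M' : Type*} [TopologicalSpace M'] [ChartedSpace H' M'] [IsManifold I' ∞ M']
    {b : M} {g : N → M'} {A : ∀ x, E →L[ℝ] TangentSpace I' (g x)} {x₀ : N}
    (h : SmoothHomAt J I I' (fun _ => b) g (fun x => A x) x₀) (f : N → E) :
    SmoothHomAt J 𝓘(ℝ, E) I' f g (fun x => A x) x₀ := by
  let C : E →L[ℝ] E := (trivializationAt E (TangentSpace I) b).continuousLinearMapAt ℝ b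
  refine (ContMDiffAt.clm_comp h (contMDiffAt_const (c := C))).congr_of_eventuallyEq
    (.of_forall fun x => ContinuousLinearMap.ext fun w => ?_)
  have h1 : (trivializationAt E (TangentSpace I) b).symmL ℝ b (C w) = w :=
    Trivialization.symmL_continuousLinearMapAt (R := ℝ) (trivializationAt E (TangentSpace I) b)
      (mem_chart_source H b) (w : E)
  change (trivializationAt E' (TangentSpace I') (g x₀)).continuousLinearMapAt ℝ (g x)
      (A x ((trivializationAt E (TangentSpace 𝓘(ℝ, E)) (f x₀)).symmL ℝ (f x) w)) =
    (trivializationAt E' (TangentSpace I') (g x₀)).continuousLinearMapAt ℝ (g x)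
    (A x ((trivializationAt E (TangentSpace I) b).symmL ℝ b (C w)))
  rw [h1]
  erw [TangentBundle.symmL_model_space]
  rfl

/-- Two projections with the same image and the same kernel agree. -/
lemma eq_of_projections {V : Type*} [AddCommGroup V] [Module ℝ V] [TopologicalSpace V]
    {P Q : V →L[ℝ] V} (hP : P ∘L P = P) (hQ : Q ∘L Q = Q)
    (hr : ∀ w, ∃ z, P w = Q z) (hk : ∀ w, P w = 0 → Q w = 0) : P = Q := by
  have eP : ∀ w, P (P w) = P w := fun w => congrArg (fun l : V →L[ℝ] V => l w) hP
  have eQ : ∀ w, Q (Q w) = Q w := fun w => congrArg (fun l : V →L[ℝ] V => l w) hQ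
  refine ContinuousLinearMap.ext fun w => ?_
  obtain ⟨z, hz⟩ := hr w
  have h1 : Q (w - P w) = 0 := hk _ (by rw [map_sub, eP, sub_self])
  rw [map_sub, sub_eq_zero, hz, eQ, ← hz] at h1
  exact h1.symm

section Routh

variable {E : Type*} [NormedAddCommGroup E] [NormedSpace ℝ E] [FiniteDimensional ℝ E]
  {M : Type*} [TopologicalSpace M] [T2Space M] [ChartedSpace E M] [IsManifold 𝓘(ℝ, E) ∞ M]
  {F : Type*} [NormedAddCommGroup F] [NormedSpace ℝ F] [FiniteDimensional ℝ F]
  {G : Type*} [TopologicalSpace G] [ChartedSpace F G] [Group G]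
  [LieGroup 𝓘(ℝ, F) ∞ G] [MulAction G M] [ContMDiffSMul 𝓘(ℝ, F) 𝓘(ℝ, E) ∞ G M]
  {EB : Type*} [NormedAddCommGroup EB] [NormedSpace ℝ EB] [FiniteDimensional ℝ EB]
  [ChartedSpace EB (OrbitSpace G M)] [IsManifold 𝓘(ℝ, EB) ∞ (OrbitSpace G M)]
  {L : TangentBundle 𝓘(ℝ, E) M → ℝ} {μ : GroupLieAlgebra 𝓘(ℝ, F) G →L[ℝ] ℝ}
  {EN : Type*} [NormedAddCommGroup EN] [NormedSpace ℝ EN] [FiniteDimensional ℝ EN]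
  [ChartedSpace EN (momentumLevel L μ)] [IsManifold 𝓘(ℝ, EN) ∞ (momentumLevel L μ)]
  {ωM : TensorField11 E M}

lemma smoothHomAt_infAction_model (m₀ : M) :
    SmoothHomAt 𝓘(ℝ, E) 𝓘(ℝ, F) 𝓘(ℝ, E) (fun _ : M => (0 : F)) id
      (fun m => infAction (F := F) G m) m₀ :=
  have := isManifold_of_lieGroup F G
  (smoothHomAt_infAction m₀).source_const_model _

lemma smoothHomAt_generator_model (v₀ : TangentBundle 𝓘(ℝ, E) M) :
    SmoothHomAt 𝓘(ℝ, E).tangent 𝓘(ℝ, F) 𝓘(ℝ, E).tangent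
      (fun _ : TangentBundle 𝓘(ℝ, E) M => (0 : F)) id (fun v => generator (F := F) G v) v₀ :=
  have := isManifold_of_lieGroup F G
  (smoothHomAt_generator v₀).source_const_model _

namespace IsRouthSystem

/-! ### The connection form -/

section ConnForm

variable (h : IsRouthSystem EB EN L μ ωM)

include h

lemma infAction_injective (m : M) : Function.Injective (infAction (E := E) (F := F) G m) :=
  _root_.infAction_injective h.locked_regular m

lemma mfderiv_orbitProj_eq_zero_iff (m : M) (w : TangentSpace 𝓘(ℝ, E) m) :
    mfderiv 𝓘(ℝ, E) 𝓘(ℝ, EB) (orbitProj G : M → OrbitSpace G M) m w = 0 ↔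
      ∃ ξ : GroupLieAlgebra 𝓘(ℝ, F) G, infAction G m ξ = w := by
  constructor
  · exact exists_infAction_eq h.free h.proper h.connection.smooth_map h.connection.submersion
      (h.infAction_injective m)
  · rintro ⟨ξ, rfl⟩
    exact mfderiv_orbitProj_infAction h.connection.smooth_map m ξ

lemma connection_infAction (m : M) (ξ : GroupLieAlgebra 𝓘(ℝ, F) G) :
    ωM m (infAction G m ξ) = infAction G m ξ := by
  have h1 : infAction G m ξ ∈ (ωM m).range := by
    rw [h.connection.range_eq]
    exact mfderiv_orbitProj_infAction h.connection.smooth_map m ξ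
  obtain ⟨w, hw⟩ := h1
  have h2 := congrArg (fun l : TangentSpace 𝓘(ℝ, E) m →L[ℝ] TangentSpace 𝓘(ℝ, E) m => l w)
    (h.connection.projection m)
  have h3 : ωM m w = infAction G m ξ := hw
  rw [← h3]
  exact h2

lemma exists_infAction_eq_connection (m : M) (w : TangentSpace 𝓘(ℝ, E) m) :
    ∃ ξ : GroupLieAlgebra 𝓘(ℝ, F) G, infAction G m ξ = ωM m w := by
  rw [← h.mfderiv_orbitProj_eq_zero_iff]
  have h1 : ωM m w ∈ (ωM m).range := ⟨w, rfl⟩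
  rw [h.connection.range_eq] at h1
  exact h1

lemma exists_connForm (m : M) : ∃ ρ : TangentSpace 𝓘(ℝ, E) m →L[ℝ] GroupLieAlgebra 𝓘(ℝ, F) G,
    infAction (F := F) G m ∘L ρ = ωM m :=
  exists_comp_eq_of_forall_mem_range (E₀ := E) (E₁ := F) (E₂ := E) (h.infAction_injective m)
    (h.exists_infAction_eq_connection m)

/-- The connection form, with values in the Lie algebra. -/
def connForm (m : M) : TangentSpace 𝓘(ℝ, E) m →L[ℝ] GroupLieAlgebra 𝓘(ℝ, F) G :=
  (h.exists_connForm m).choose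

lemma infAction_connForm (m : M) (w : TangentSpace 𝓘(ℝ, E) m) :
    infAction G m (h.connForm m w) = ωM m w :=
  congrArg (fun l : TangentSpace 𝓘(ℝ, E) m →L[ℝ] TangentSpace 𝓘(ℝ, E) m => l w)
    (h.exists_connForm m).choose_spec

lemma connForm_infAction (m : M) (ξ : GroupLieAlgebra 𝓘(ℝ, F) G) :
    h.connForm m (infAction G m ξ) = ξ :=
  h.infAction_injective m (by rw [infAction_connForm, h.connection_infAction])

lemma connForm_eq_zero_iff (m : M) (w : TangentSpace 𝓘(ℝ, E) m) :
    h.connForm m w = 0 ↔ ωM m w = 0 := by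
  rw [← h.infAction_connForm]
  exact (map_eq_zero_iff _ (h.infAction_injective m)).symm

/-- After applying the injective infinitesimal action this is the invariance of `ω`. -/
lemma connForm_smul (g : G) (m : M) (w : TangentSpace 𝓘(ℝ, E) m) :
    h.connForm (g • m) (mfderiv 𝓘(ℝ, E) 𝓘(ℝ, E) (fun x : M => g • x) m w) =
      adjointMap g (h.connForm m w) := by
  refine h.infAction_injective (g • m) ?_
  rw [infAction_connForm, ← mfderiv_smul_infAction, infAction_connForm]
  exact (congrArg (fun l : E →L[ℝ] E => l w) (h.connection_invariant g m)).symm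

lemma smoothHomAt_connForm (m₀ : M) :
    SmoothHomAt 𝓘(ℝ, E) 𝓘(ℝ, E) 𝓘(ℝ, F) id (fun _ => (0 : F)) (fun m => h.connForm m) m₀ :=
  SmoothHomAt.of_comp_injective (smoothHomAt_infAction_model (F := F) (G := G) m₀)
    (SmoothHomAt.of_tensor h.connection.smooth m₀) continuousAt_const (h.infAction_injective m₀)
    (.of_forall fun m => (h.exists_connForm m).choose_spec)

end ConnForm

end IsRouthSystem

end Routh

end

noncomputable section

section Routh

variable {E : Type*} [NormedAddCommGroup E] [NormedSpace ℝ E] [FiniteDimensional ℝ E]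
  {M : Type*} [TopologicalSpace M] [T2Space M] [ChartedSpace E M] [IsManifold 𝓘(ℝ, E) ∞ M]
  {F : Type*} [NormedAddCommGroup F] [NormedSpace ℝ F] [FiniteDimensional ℝ F]
  {G : Type*} [TopologicalSpace G] [ChartedSpace F G] [Group G]
  [LieGroup 𝓘(ℝ, F) ∞ G] [MulAction G M] [ContMDiffSMul 𝓘(ℝ, F) 𝓘(ℝ, E) ∞ G M]
  {EB : Type*} [NormedAddCommGroup EB] [NormedSpace ℝ EB] [FiniteDimensional ℝ EB]
  [ChartedSpace EB (OrbitSpace G M)] [IsManifold 𝓘(ℝ, EB) ∞ (OrbitSpace G M)]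
  {L : TangentBundle 𝓘(ℝ, E) M → ℝ} {μ : GroupLieAlgebra 𝓘(ℝ, F) G →L[ℝ] ℝ}
  {EN : Type*} [NormedAddCommGroup EN] [NormedSpace ℝ EN] [FiniteDimensional ℝ EN]
  [ChartedSpace EN (momentumLevel L μ)] [IsManifold 𝓘(ℝ, EN) ∞ (momentumLevel L μ)]
  {ωM : TensorField11 E M}

namespace IsRouthSystem

/-! ### Local standard frames -/

section Frame

variable (h : IsRouthSystem EB EN L μ ωM)

include h

lemma connection_idem (m : M) (w : TangentSpace 𝓘(ℝ, E) m) : ωM m (ωM m w) = ωM m w :=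
  congrArg (fun l : E →L[ℝ] E => l w) (h.connection.projection m)

lemma mfderiv_orbitProj_connection (m : M) (w : TangentSpace 𝓘(ℝ, E) m) :
    mfderiv 𝓘(ℝ, E) 𝓘(ℝ, EB) (orbitProj G : M → OrbitSpace G M) m (ωM m w) = 0 :=
  (h.mfderiv_orbitProj_eq_zero_iff m _).2 (h.exists_infAction_eq_connection m w)

lemma eq_zero_of_horizontal (m : M) {w : TangentSpace 𝓘(ℝ, E) m}
    (h1 : mfderiv 𝓘(ℝ, E) 𝓘(ℝ, EB) (orbitProj G : M → OrbitSpace G M) m w = 0)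
    (h2 : h.connForm m w = 0) : w = 0 := by
  obtain ⟨ξ, rfl⟩ := (h.mfderiv_orbitProj_eq_zero_iff m w).1 h1
  rw [connForm_infAction] at h2
  rw [h2, map_zero]

variable (b : OrbitSpace G M)

omit h in
/-- The coordinates of the orbit of a point in the chart at `b`. -/
def orbitCoord (EB : Type*) [NormedAddCommGroup EB] [NormedSpace ℝ EB]
    [ChartedSpace EB (OrbitSpace G M)] (b : OrbitSpace G M) (m : M) : EB :=
  extChartAt 𝓘(ℝ, EB) b (orbitProj G m)

lemma contMDiffAt_orbitCoord {m : M} (hm : orbitProj G m ∈ (chartAt EB b).source) :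
    ContMDiffAt 𝓘(ℝ, E) 𝓘(ℝ, EB) ∞ (orbitCoord EB b) m :=
  (contMDiffAt_extChartAt' hm).comp m h.connection.smooth_map.contMDiffAt

lemma mfderiv_orbitCoord {m : M} (hm : orbitProj G m ∈ (chartAt EB b).source) :
    (mfderiv 𝓘(ℝ, E) 𝓘(ℝ, EB) (orbitCoord EB b) m : E →L[ℝ] EB) =
      (mfderiv 𝓘(ℝ, EB) 𝓘(ℝ, EB) (extChartAt 𝓘(ℝ, EB) b) (orbitProj G m) : EB →L[ℝ] EB) ∘L
        (mfderiv 𝓘(ℝ, E) 𝓘(ℝ, EB) (orbitProj G) m : E →L[ℝ] EB) :=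
  (HasMFDerivAt.comp m (mdifferentiableAt_extChartAt hm).hasMFDerivAt
    (h.connection.smooth_map.mdifferentiable (by simp) m).hasMFDerivAt).mfderiv

/-- The derivative of the orbit coordinates together with the connection form. -/
def splitting (b : OrbitSpace G M) (m : M) : TangentSpace 𝓘(ℝ, E) m →L[ℝ] EB × F :=
  ((ContinuousLinearMap.inl ℝ EB F) ∘L
      (mfderiv 𝓘(ℝ, E) 𝓘(ℝ, EB) (orbitCoord EB b) m : E →L[ℝ] EB) +
    (ContinuousLinearMap.inr ℝ EB F) ∘L (h.connForm m : E →L[ℝ] F) : E →L[ℝ] EB × F)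

lemma splitting_apply (m : M) (w : TangentSpace 𝓘(ℝ, E) m) :
    h.splitting b m w =
      ((mfderiv 𝓘(ℝ, E) 𝓘(ℝ, EB) (orbitCoord EB b) m w : EB), (h.connForm m w : F)) := by
  refine Prod.ext ?_ ?_
  · exact add_zero _
  · exact zero_add _

lemma splitting_injective {m : M} (hm : orbitProj G m ∈ (chartAt EB b).source) :
    Function.Injective (h.splitting b m) := by
  refine (injective_iff_map_eq_zero (h.splitting b m)).2 fun w hw => ?_
  rw [splitting_apply] at hw
  refine h.eq_zero_of_horizontal m ?_ (congrArg Prod.snd hw)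
  have hinj : Function.Injective
      (mfderiv 𝓘(ℝ, EB) 𝓘(ℝ, EB) (extChartAt 𝓘(ℝ, EB) b) (orbitProj G m) : EB →L[ℝ] EB) :=
    (isInvertible_mfderiv_extChartAt (by simpa using hm)).injective
  refine hinj ?_
  refine Eq.trans ?_ (map_zero _).symm
  exact (congrArg (fun l : E →L[ℝ] EB => l w) (h.mfderiv_orbitCoord b hm)).symm.trans
    (congrArg Prod.fst hw)

lemma exists_horizontal_lift {m : M} (hm : orbitProj G m ∈ (chartAt EB b).source) (e : EB) :
    ∃ w : TangentSpace 𝓘(ℝ, E) m, h.splitting b m w = (e, 0) := by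
  have hsurj : Function.Surjective
      (mfderiv 𝓘(ℝ, EB) 𝓘(ℝ, EB) (extChartAt 𝓘(ℝ, EB) b) (orbitProj G m) : EB →L[ℝ] EB) :=
    (isInvertible_mfderiv_extChartAt (by simpa using hm)).surjective
  obtain ⟨e', he'⟩ := hsurj e
  obtain ⟨w, hw⟩ := h.connection.submersion m e'
  -- Removing the vertical part makes `w` horizontal without changing its image in the orbit space.
  refine ⟨w - ωM m w, ?_⟩
  rw [splitting_apply]
  refine Prod.ext ?_ ?_
  · refine (congrArg (fun l : E →L[ℝ] EB => l (w - ωM m w)) (h.mfderiv_orbitCoord b hm)).trans ?_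
    refine Eq.trans (congrArg (mfderiv 𝓘(ℝ, EB) 𝓘(ℝ, EB) (extChartAt 𝓘(ℝ, EB) b)
      (orbitProj G m) : EB →L[ℝ] EB) ?_) he'
    refine (map_sub (mfderiv 𝓘(ℝ, E) 𝓘(ℝ, EB) (orbitProj G : M → OrbitSpace G M) m) _ _).trans ?_
    rw [h.mfderiv_orbitProj_connection, sub_zero]
    exact hw
  · refine (h.connForm_eq_zero_iff m _).2 ?_
    rw [map_sub, h.connection_idem, sub_self]

lemma smoothHomAt_splitting {m : M} (hm : orbitProj G m ∈ (chartAt EB b).source) :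
    SmoothHomAt 𝓘(ℝ, E) 𝓘(ℝ, E) 𝓘(ℝ, EB × F) id (fun _ => (0 : EB × F))
      (fun m => h.splitting b m) m := by
  have h1 := (smoothHomAt_const (J := 𝓘(ℝ, E)) (f := orbitCoord EB b) (g := fun _ => (0 : EB × F))
    (ContinuousLinearMap.inl ℝ EB F) (x₀ := m)).comp
    (SmoothHomAt.mfderiv_const (h.contMDiffAt_orbitCoord b hm))
    (h.contMDiffAt_orbitCoord b hm).continuousAt
  have h2 := (smoothHomAt_const (J := 𝓘(ℝ, E)) (f := fun _ : M => (0 : F))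
    (g := fun _ => (0 : EB × F)) (ContinuousLinearMap.inr ℝ EB F) (x₀ := m)).comp
    (h.smoothHomAt_connForm m) continuousAt_const
  exact h1.add h2

omit h in
lemma orbitProj_smul (g : G) (m : M) : orbitProj G (g • m) = orbitProj G m :=
  Quotient.sound ⟨g, rfl⟩

/-- Orbit coordinates are invariant, and the equivariant connection form keeps the value `0`.
Injectivity of the splitting then makes horizontal lifts invariant fields. -/
lemma splitting_smul (g : G) {m : M} (hm : orbitProj G m ∈ (chartAt EB b).source)
    {w : TangentSpace 𝓘(ℝ, E) m} {e : EB} (hw : h.splitting b m w = (e, 0)) :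
    h.splitting b (g • m) (mfderiv 𝓘(ℝ, E) 𝓘(ℝ, E) (fun x : M => g • x) m w) = (e, 0) := by
  rw [splitting_apply] at hw ⊢
  have hgm : orbitProj G (g • m) ∈ (chartAt EB b).source := by rwa [orbitProj_smul]
  refine Prod.ext ?_ ?_
  · have h1 := HasMFDerivAt.comp m (f := fun x : M => g • x) (g := orbitCoord EB b)
      (((h.contMDiffAt_orbitCoord b hgm).mdifferentiableAt (by simp)).hasMFDerivAt)
      (((contMDiff_smul_left (E := E) F g).mdifferentiable (by simp) m).hasMFDerivAt)
    have h2 : (orbitCoord EB b ∘ fun x : M => g • x) = orbitCoord EB b :=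
      funext fun x => congrArg (extChartAt 𝓘(ℝ, EB) b) (orbitProj_smul g x)
    rw [h2] at h1
    have h3 := hasMFDerivAt_unique h1
      ((h.contMDiffAt_orbitCoord b hm).mdifferentiableAt (by simp)).hasMFDerivAt
    exact (congrArg (fun l : E →L[ℝ] EB => l w) h3).trans (congrArg Prod.fst hw)
  · have h1 : h.connForm m w = 0 := congrArg Prod.snd hw
    change h.connForm (g • m) (mfderiv 𝓘(ℝ, E) 𝓘(ℝ, E) (fun x : M => g • x) m w) = 0
    rw [connForm_smul, h1, map_zero]

lemma exists_horizontalLift (m : M) : ∃ X : EB →L[ℝ] TangentSpace 𝓘(ℝ, E) m,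
    orbitProj G m ∈ (chartAt EB b).source → h.splitting b m ∘L X = ContinuousLinearMap.inl ℝ EB F := by
  by_cases hm : orbitProj G m ∈ (chartAt EB b).source
  · obtain ⟨X, hX⟩ := exists_comp_eq_of_forall_mem_range (E₀ := EB) (E₁ := E) (E₂ := EB × F)
      (h.splitting_injective b hm) (T := ContinuousLinearMap.inl ℝ EB F)
      (h.exists_horizontal_lift b hm)
    exact ⟨X, fun _ => hX⟩
  -- A default value outside the domain of the chart, where nothing is required.
  · exact ⟨0, fun hm' => absurd hm' hm⟩

/-- Horizontal lift of coordinate vectors of the orbit space. -/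
def horizontalLift (b : OrbitSpace G M) (m : M) : EB →L[ℝ] TangentSpace 𝓘(ℝ, E) m :=
  (h.exists_horizontalLift b m).choose

lemma splitting_horizontalLift {m : M} (hm : orbitProj G m ∈ (chartAt EB b).source) (e : EB) :
    h.splitting b m (h.horizontalLift b m e) = (e, 0) :=
  congrArg (fun l : EB →L[ℝ] EB × F => l e) ((h.exists_horizontalLift b m).choose_spec hm)

lemma isOpen_preimage_chart : IsOpen {m : M | orbitProj G m ∈ (chartAt EB b).source} :=
  (chartAt EB b).open_source.preimage h.connection.smooth_map.continuous

lemma smoothHomAt_horizontalLift {m : M} (hm : orbitProj G m ∈ (chartAt EB b).source) :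
    SmoothHomAt 𝓘(ℝ, E) 𝓘(ℝ, EB) 𝓘(ℝ, E) (fun _ => (0 : EB)) id
      (fun m => h.horizontalLift b m) m :=
  SmoothHomAt.of_comp_injective (h.smoothHomAt_splitting b hm)
    (smoothHomAt_const (ContinuousLinearMap.inl ℝ EB F)) continuousAt_id
    (h.splitting_injective b hm) (by
      filter_upwards [(h.isOpen_preimage_chart b).mem_nhds hm] with m' hm'
      exact (h.exists_horizontalLift b m').choose_spec hm')

/-- The horizontal lifts of the coordinate fields of the orbit space form a local standard
frame. -/
lemma isStandardFrame_horizontalLift :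
    IsStandardFrame G ωM {m : M | orbitProj G m ∈ (chartAt EB b).source}
      (fun i m => h.horizontalLift b m (Module.finBasis ℝ EB i)) where
  isOpen := h.isOpen_preimage_chart b
  smul_mem g m hm := by
    change orbitProj G (g • m) ∈ (chartAt EB b).source
    rwa [orbitProj_smul]
  smooth i m hm := ((h.smoothHomAt_horizontalLift b hm).apply_model contMDiffAt_id
    (Module.finBasis ℝ EB i)).contMDiffWithinAt
  invariant i g m hm := by
    have hgm : orbitProj G (g • m) ∈ (chartAt EB b).source := by rwa [orbitProj_smul]
    refine h.splitting_injective b hgm ?_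
    rw [h.splitting_horizontalLift b hgm]
    exact h.splitting_smul b g hm (h.splitting_horizontalLift b hm _)
  linearIndependent m hm := by
    have hinj : Function.Injective (h.horizontalLift b m : EB →ₗ[ℝ] TangentSpace 𝓘(ℝ, E) m) := by
      intro e e' he
      have h1 := congrArg (h.splitting b m) he
      exact congrArg Prod.fst ((h.splitting_horizontalLift b hm e).symm.trans
        (h1.trans (h.splitting_horizontalLift b hm e')))
    exact (Module.finBasis ℝ EB).linearIndependent.map' _ (LinearMap.ker_eq_bot.2 hinj)
  span_eq m hm := by
    have h1 : Submodule.span ℝ (Set.range fun i => h.horizontalLift b m (Module.finBasis ℝ EB i)) =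
        (h.horizontalLift b m : EB →ₗ[ℝ] TangentSpace 𝓘(ℝ, E) m).range := by
      rw [LinearMap.range_eq_map, ← (Module.finBasis ℝ EB).span_eq, Submodule.map_span,
        ← Set.range_comp]
      rfl
    rw [h1]
    ext w
    constructor
    · rintro ⟨e, rfl⟩
      refine (h.connForm_eq_zero_iff m _).1 ?_
      have h2 := h.splitting_horizontalLift b hm e
      rw [splitting_apply] at h2
      exact congrArg Prod.snd h2
    · intro hw
      -- A horizontal vector is the lift of its own derivative in orbit coordinates.
      refine ⟨mfderiv 𝓘(ℝ, E) 𝓘(ℝ, EB) (orbitCoord EB b) m w, ?_⟩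
      refine h.splitting_injective b hm ?_
      refine (h.splitting_horizontalLift b hm _).trans ?_
      rw [splitting_apply, (h.connForm_eq_zero_iff m w).2 hw]
      rfl

end Frame

end IsRouthSystem

end Routh

end

noncomputable section

section Routh

variable {E : Type*} [NormedAddCommGroup E] [NormedSpace ℝ E] [FiniteDimensional ℝ E]
  {M : Type*} [TopologicalSpace M] [T2Space M] [ChartedSpace E M] [IsManifold 𝓘(ℝ, E) ∞ M]
  {F : Type*} [NormedAddCommGroup F] [NormedSpace ℝ F] [FiniteDimensional ℝ F]
  {G : Type*} [TopologicalSpace G] [ChartedSpace F G] [Group G]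
  [LieGroup 𝓘(ℝ, F) ∞ G] [MulAction G M] [ContMDiffSMul 𝓘(ℝ, F) 𝓘(ℝ, E) ∞ G M]
  {EB : Type*} [NormedAddCommGroup EB] [NormedSpace ℝ EB] [FiniteDimensional ℝ EB]
  [ChartedSpace EB (OrbitSpace G M)] [IsManifold 𝓘(ℝ, EB) ∞ (OrbitSpace G M)]
  {L : TangentBundle 𝓘(ℝ, E) M → ℝ} {μ : GroupLieAlgebra 𝓘(ℝ, F) G →L[ℝ] ℝ}
  {EN : Type*} [NormedAddCommGroup EN] [NormedSpace ℝ EN] [FiniteDimensional ℝ EN]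
  [ChartedSpace EN (momentumLevel L μ)] [IsManifold 𝓘(ℝ, EN) ∞ (momentumLevel L μ)]
  {ωM : TensorField11 E M}

namespace IsRouthSystem

/-! ### The level set of momentum -/

section Level

variable (h : IsRouthSystem EB EN L μ ωM)

include h

lemma contMDiff_incl : ContMDiff 𝓘(ℝ, EN) 𝓘(ℝ, E).tangent ∞
    (Subtype.val : momentumLevel L μ → TangentBundle 𝓘(ℝ, E) M) :=
  h.submanifold.contMDiff

lemma inclDeriv_injective (n : momentumLevel L μ) : Function.Injective (inclDeriv (EN := EN) n) :=
  mfderiv_injective_of_isImmersionAt (h.submanifold.isImmersion.isImmersionAt n)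

lemma baseDeriv_eq (n : momentumLevel L μ) (Z : TangentSpace 𝓘(ℝ, EN) n) :
    baseDeriv n Z = mfderiv 𝓘(ℝ, E).tangent 𝓘(ℝ, E)
      (fun u : TangentBundle 𝓘(ℝ, E) M => u.proj) n.1 (inclDeriv n Z) := by
  have h1 := HasMFDerivAt.comp n ((contMDiff_bundleProj.mdifferentiable (by simp) n.1).hasMFDerivAt)
    ((h.contMDiff_incl.mdifferentiable (by simp) n).hasMFDerivAt)
  exact congrArg (fun l : EN →L[ℝ] E => l Z) h1.mfderiv

lemma momentumDeriv_inclDeriv (n : momentumLevel L μ) (Z : TangentSpace 𝓘(ℝ, EN) n) :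
    momentumDeriv (F := F) G L n.1 (inclDeriv n Z) = 0 := by
  let p : TangentBundle 𝓘(ℝ, E) M → F →L[ℝ] ℝ := fun u => momentum (F := F) G L u
  let ν : F →L[ℝ] ℝ := μ
  have hp : MDifferentiable 𝓘(ℝ, E).tangent 𝓘(ℝ, F →L[ℝ] ℝ) p :=
    (contMDiff_momentum h.smooth).mdifferentiable (by simp)
  have h1 := HasMFDerivAt.comp n (hp n.1).hasMFDerivAt
    ((h.contMDiff_incl.mdifferentiable (by simp) n).hasMFDerivAt)
  have h2 : p ∘ (Subtype.val : momentumLevel L μ → TangentBundle 𝓘(ℝ, E) M) = fun _ => ν :=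
    funext fun x => x.2
  rw [h2] at h1
  exact congrArg (fun l : EN →L[ℝ] F →L[ℝ] ℝ => l Z)
    (hasMFDerivAt_unique h1 (hasMFDerivAt_const ν n))

/-- The tangent spaces of the level set are the kernels of the derivative of momentum. -/
lemma exists_inclDeriv_eq (n : momentumLevel L μ) {W : TangentSpace 𝓘(ℝ, E).tangent n.1}
    (hW : momentumDeriv (F := F) G L n.1 W = 0) :
    ∃ Z : TangentSpace 𝓘(ℝ, EN) n, inclDeriv n Z = W := by
  let p : TangentBundle 𝓘(ℝ, E) M → F →L[ℝ] ℝ := fun u => momentum (F := F) G L u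
  have h1 := ker_mfderiv_le_range_of_level (I₀ := 𝓘(ℝ, EN)) (I₁ := 𝓘(ℝ, E).tangent)
    (I₂ := 𝓘(ℝ, F →L[ℝ] ℝ)) (f := p)
    (ι := (Subtype.val : momentumLevel L μ → TangentBundle 𝓘(ℝ, E) M)) (n := n)
    h.contMDiff_incl.contMDiffAt (h.inclDeriv_injective n) h.submanifold.isEmbedding.isInducing
    (contMDiff_momentum h.smooth).contMDiffAt
    (momentumDeriv_surjective h.smooth h.locked_regular n.1) (fun q hq => by
      have h2 : momentum G L n.1 = μ := n.2
      have h3 : momentum G L q = μ := Eq.trans hq h2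
      exact ⟨⟨q, h3⟩, rfl⟩)
  exact h1 hW

lemma smoothHomAt_inclDeriv (n : momentumLevel L μ) :
    SmoothHomAt 𝓘(ℝ, EN) 𝓘(ℝ, EN) 𝓘(ℝ, E).tangent id Subtype.val
      (fun n : momentumLevel L μ => inclDeriv n) n :=
  SmoothHomAt.mfderiv_const h.contMDiff_incl.contMDiffAt

/-- A smooth family of linear maps `T_n N_μ → T_n TM` with values tangent to `N_μ` is a smooth
tensor field on `N_μ`. -/
lemma exists_tensor {T : ∀ n : momentumLevel L μ,
      TangentSpace 𝓘(ℝ, EN) n →L[ℝ] TangentSpace 𝓘(ℝ, E).tangent n.1}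
    (hT : ∀ n, SmoothHomAt 𝓘(ℝ, EN) 𝓘(ℝ, EN) 𝓘(ℝ, E).tangent id Subtype.val T n)
    (hp : ∀ n Z, momentumDeriv (F := F) G L n.1 (T n Z) = 0) :
    ∃ Ω : TensorField11 EN (momentumLevel L μ), IsSmoothTensor Ω ∧
      ∀ n Z, inclDeriv n (Ω n Z) = T n Z := by
  have h1 : ∀ n, ∃ X : TangentSpace 𝓘(ℝ, EN) n →L[ℝ] TangentSpace 𝓘(ℝ, EN) n,
      inclDeriv n ∘L X = T n := fun n =>
    exists_comp_eq_of_forall_mem_range (E₀ := EN) (E₁ := EN) (E₂ := E × E)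
      (h.inclDeriv_injective n) (fun Z => h.exists_inclDeriv_eq n (hp n Z))
  choose Ω hΩ using h1
  refine ⟨Ω, isSmoothTensor_of_smoothHomAt fun n => ?_, fun n Z => ?_⟩
  · exact SmoothHomAt.of_comp_injective (h.smoothHomAt_inclDeriv n) (hT n) continuousAt_id
      (h.inclDeriv_injective n) (.of_forall hΩ)
  · exact congrArg (fun l : EN →L[ℝ] E × E => l Z) (hΩ n)

/-- The action of an element of the isotropy group on the level set. -/
def levelAction {g : G} (hg : g ∈ isotropyGroup μ) (n : momentumLevel L μ) : momentumLevel L μ :=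
  ⟨tangentAction g n.1, tangentAction_mem_momentumLevel h.smooth h.invariant hg n.2⟩

/-- A map into `N_μ` is smooth if it is continuous and smooth as a map into `TM`, since `ι` is an
immersion; continuity holds since `ι` is an embedding. -/
lemma contMDiff_levelAction {g : G} (hg : g ∈ isotropyGroup μ) :
    ContMDiff 𝓘(ℝ, EN) 𝓘(ℝ, EN) ∞ (h.levelAction hg) := by
  have h1 : ContMDiff 𝓘(ℝ, EN) 𝓘(ℝ, E).tangent ∞
      (Subtype.val ∘ h.levelAction hg) :=
    (contMDiff_tangentAction (F := F) g).comp h.contMDiff_incl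
  have h2 : Continuous (h.levelAction hg) :=
    h.submanifold.isEmbedding.isInducing.continuous_iff.2 h1.continuous
  exact (ContMDiff.iff_comp_isImmersion h.submanifold.isImmersion).2 ⟨h2, h1⟩

lemma inclDeriv_levelAction {g : G} (hg : g ∈ isotropyGroup μ) (n : momentumLevel L μ)
    (Z : TangentSpace 𝓘(ℝ, EN) n) :
    inclDeriv (h.levelAction hg n) (mfderiv 𝓘(ℝ, EN) 𝓘(ℝ, EN) (h.levelAction hg) n Z) =
      mfderiv 𝓘(ℝ, E).tangent 𝓘(ℝ, E).tangent (tangentAction g) n.1 (inclDeriv n Z) := by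
  have h1 := HasMFDerivAt.comp n
    ((h.contMDiff_incl.mdifferentiable (by simp) (h.levelAction hg n)).hasMFDerivAt)
    (((h.contMDiff_levelAction hg).mdifferentiable (by simp) n).hasMFDerivAt)
  have h2 := HasMFDerivAt.comp n
    (((contMDiff_tangentAction (F := F) g).mdifferentiable (by simp) n.1).hasMFDerivAt)
    ((h.contMDiff_incl.mdifferentiable (by simp) n).hasMFDerivAt)
  exact congrArg (fun l : EN →L[ℝ] E × E => l Z) (hasMFDerivAt_unique h1 h2)

lemma baseDeriv_levelAction {g : G} (hg : g ∈ isotropyGroup μ) (n : momentumLevel L μ)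
    (Z : TangentSpace 𝓘(ℝ, EN) n) :
    baseDeriv (h.levelAction hg n) (mfderiv 𝓘(ℝ, EN) 𝓘(ℝ, EN) (h.levelAction hg) n Z) =
      mfderiv 𝓘(ℝ, E) 𝓘(ℝ, E) (fun x : M => g • x) n.1.proj (baseDeriv n Z) := by
  rw [h.baseDeriv_eq, h.baseDeriv_eq, h.inclDeriv_levelAction]
  exact mfderiv_proj_tangentAction (F := F) g n.1 (inclDeriv n Z)

/-- As `Tι` is injective, invariance may be tested in `T(TM)`, where the tensors below have explicit
formulas. -/
lemma isIsotropyInvariant_of_inclDeriv {Ω : TensorField11 EN (momentumLevel L μ)}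
    (hΩ : ∀ (g : G) (hg : g ∈ isotropyGroup μ) (n : momentumLevel L μ)
      (Z : TangentSpace 𝓘(ℝ, EN) n),
      inclDeriv (h.levelAction hg n) (Ω (h.levelAction hg n)
        (mfderiv 𝓘(ℝ, EN) 𝓘(ℝ, EN) (h.levelAction hg) n Z)) =
      mfderiv 𝓘(ℝ, E).tangent 𝓘(ℝ, E).tangent (tangentAction g) n.1 (inclDeriv n (Ω n Z))) :
    IsIsotropyInvariant Ω := by
  intro g hg
  refine ⟨h.levelAction hg, h.contMDiff_levelAction hg, fun n => rfl, fun n => ?_⟩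
  refine ContinuousLinearMap.ext fun Z => ?_
  refine h.inclDeriv_injective (h.levelAction hg n) ?_
  exact (h.inclDeriv_levelAction hg n (Ω n Z)).trans (hΩ g hg n Z).symm

end Level

end IsRouthSystem

end Routh

end

noncomputable section

section Routh

variable {E : Type*} [NormedAddCommGroup E] [NormedSpace ℝ E] [FiniteDimensional ℝ E]
  {M : Type*} [TopologicalSpace M] [T2Space M] [ChartedSpace E M] [IsManifold 𝓘(ℝ, E) ∞ M]
  {F : Type*} [NormedAddCommGroup F] [NormedSpace ℝ F] [FiniteDimensional ℝ F]
  {G : Type*} [TopologicalSpace G] [ChartedSpace F G] [Group G]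
  [LieGroup 𝓘(ℝ, F) ∞ G] [MulAction G M] [ContMDiffSMul 𝓘(ℝ, F) 𝓘(ℝ, E) ∞ G M]
  {EB : Type*} [NormedAddCommGroup EB] [NormedSpace ℝ EB] [FiniteDimensional ℝ EB]
  [ChartedSpace EB (OrbitSpace G M)] [IsManifold 𝓘(ℝ, EB) ∞ (OrbitSpace G M)]
  {L : TangentBundle 𝓘(ℝ, E) M → ℝ} {μ : GroupLieAlgebra 𝓘(ℝ, F) G →L[ℝ] ℝ}
  {EN : Type*} [NormedAddCommGroup EN] [NormedSpace ℝ EN] [FiniteDimensional ℝ EN]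
  [ChartedSpace EN (momentumLevel L μ)] [IsManifold 𝓘(ℝ, EN) ∞ (momentumLevel L μ)]
  {ωM : TensorField11 E M}

namespace IsRouthSystem

/-! ### The vertical lift of the connection -/

section VerticalLift

variable (h : IsRouthSystem EB EN L μ ωM)

include h

lemma momentumDeriv_barMap (v : TangentBundle 𝓘(ℝ, E) M) (W : TangentSpace 𝓘(ℝ, E).tangent v) :
    momentumDeriv (F := F) G L v (barMap F G L v W) = 0 :=
  _root_.momentumDeriv_barMap h.smooth h.locked_regular v W

lemma barMap_inclDeriv (n : momentumLevel L μ) (Z : TangentSpace 𝓘(ℝ, EN) n) :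
    barMap F G L n.1 (inclDeriv n Z) = inclDeriv n Z :=
  barMap_of_momentumDeriv_eq_zero h.locked_regular (h.momentumDeriv_inclDeriv n Z)

lemma smoothHomAt_baseDeriv (n : momentumLevel L μ) :
    SmoothHomAt 𝓘(ℝ, EN) 𝓘(ℝ, EN) 𝓘(ℝ, E) id (fun n : momentumLevel L μ => n.1.proj)
      (fun n : momentumLevel L μ => baseDeriv n) n :=
  SmoothHomAt.mfderiv_const (contMDiff_bundleProj.comp h.contMDiff_incl).contMDiffAt

/-- The generator of the connection form, as a family of maps on the level set. -/
def verticalMap (n : momentumLevel L μ) :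
    TangentSpace 𝓘(ℝ, EN) n →L[ℝ] TangentSpace 𝓘(ℝ, E).tangent n.1 :=
  barMap F G L n.1 ∘L generator (F := F) G n.1 ∘L h.connForm n.1.proj ∘L baseDeriv n

lemma smoothHomAt_verticalMap (n : momentumLevel L μ) :
    SmoothHomAt 𝓘(ℝ, EN) 𝓘(ℝ, EN) 𝓘(ℝ, E).tangent id Subtype.val h.verticalMap n := by
  have hι := h.contMDiff_incl
  have h1 := ((h.smoothHomAt_connForm n.1.proj).precomp
    (φ := fun n : momentumLevel L μ => n.1.proj) (contMDiff_bundleProj.comp hι).contMDiffAt).comp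
    (h.smoothHomAt_baseDeriv n) (contMDiff_bundleProj.comp hι).continuous.continuousAt
  have h2 := ((smoothHomAt_generator_model (F := F) (G := G) n.1).precomp
    (φ := (Subtype.val : momentumLevel L μ → _)) hι.contMDiffAt).comp h1 continuousAt_const
  exact ((smoothHomAt_barMap (F := F) (G := G) h.smooth h.locked_regular n.1).precomp
    (φ := (Subtype.val : momentumLevel L μ → _)) hι.contMDiffAt).comp h2
    hι.continuous.continuousAt

lemma exists_verticalConnection : ∃ Ω : TensorField11 EN (momentumLevel L μ), IsSmoothTensor Ω ∧
    ∀ n Z, inclDeriv n (Ω n Z) = h.verticalMap n Z :=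
  h.exists_tensor h.smoothHomAt_verticalMap fun n _ => h.momentumDeriv_barMap n.1 _

/-- The connection `Ω^V` on the level set of momentum. -/
def verticalConnection : TensorField11 EN (momentumLevel L μ) :=
  h.exists_verticalConnection.choose

lemma isSmoothTensor_verticalConnection : IsSmoothTensor h.verticalConnection :=
  h.exists_verticalConnection.choose_spec.1

lemma inclDeriv_verticalConnection (n : momentumLevel L μ) (Z : TangentSpace 𝓘(ℝ, EN) n) :
    inclDeriv n (h.verticalConnection n Z) =
      barMap F G L n.1 (generator G n.1 (h.connForm n.1.proj (baseDeriv n Z))) :=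
  h.exists_verticalConnection.choose_spec.2 n Z

omit h in
lemma mfderiv_proj_barMap_generator (v : TangentBundle 𝓘(ℝ, E) M)
    (ξ : GroupLieAlgebra 𝓘(ℝ, F) G) :
    mfderiv 𝓘(ℝ, E).tangent 𝓘(ℝ, E) (fun u : TangentBundle 𝓘(ℝ, E) M => u.proj) v
      (barMap F G L v (generator G v ξ)) = infAction G v.proj ξ := by
  rw [mfderiv_proj_barMap, mfderiv_proj_generator]

lemma barMap_generator_injective (v : TangentBundle 𝓘(ℝ, E) M) :
    Function.Injective fun ξ : GroupLieAlgebra 𝓘(ℝ, F) G => barMap F G L v (generator G v ξ) := by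
  intro ξ η hξη
  refine h.infAction_injective v.proj ?_
  rw [← mfderiv_proj_barMap_generator (L := L), ← mfderiv_proj_barMap_generator (L := L)]
  exact congrArg (fun z : E × E => (mfderiv 𝓘(ℝ, E).tangent 𝓘(ℝ, E)
    (fun u : TangentBundle 𝓘(ℝ, E) M => u.proj) v : E × E →L[ℝ] E) z) hξη

/-- The correction is vertical and the generator of `ξ` lies over `ξ̃`. Idempotence and the kernel
of `Ω^V` are read off from this identity. -/
lemma baseDeriv_verticalConnection (n : momentumLevel L μ) (Z : TangentSpace 𝓘(ℝ, EN) n) :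
    baseDeriv n (h.verticalConnection n Z) = ωM n.1.proj (baseDeriv n Z) := by
  rw [h.baseDeriv_eq, h.inclDeriv_verticalConnection, mfderiv_proj_barMap_generator,
    h.infAction_connForm]

/-- `Ω^V(Z)` depends only on the connection form of `τ_* Z`, which is unchanged when `τ_* Z` is
replaced by `ω(τ_* Z)`. -/
lemma verticalConnection_idem (n : momentumLevel L μ) :
    h.verticalConnection n ∘L h.verticalConnection n = h.verticalConnection n := by
  refine ContinuousLinearMap.ext fun Z => h.inclDeriv_injective n ?_
  have h1 : h.connForm n.1.proj (baseDeriv n (h.verticalConnection n Z)) =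
      h.connForm n.1.proj (baseDeriv n Z) := by
    rw [h.baseDeriv_verticalConnection, ← h.infAction_connForm, h.connForm_infAction]
  refine (h.inclDeriv_verticalConnection n (h.verticalConnection n Z)).trans ?_
  rw [h1, ← h.inclDeriv_verticalConnection]

lemma verticalConnection_eq_zero_iff (n : momentumLevel L μ) (Z : TangentSpace 𝓘(ℝ, EN) n) :
    h.verticalConnection n Z = 0 ↔ ωM n.1.proj (baseDeriv n Z) = 0 := by
  constructor
  · intro hZ
    rw [← h.baseDeriv_verticalConnection, hZ, map_zero]
  · intro hZ
    refine h.inclDeriv_injective n ?_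
    rw [h.inclDeriv_verticalConnection, (h.connForm_eq_zero_iff _ _).2 hZ, map_zero, map_zero,
      map_zero]

/-- The corrected generator is itself tangent to `N_μ`, and `Ω^V` fixes it. -/
lemma exists_verticalConnection_eq (n : momentumLevel L μ) (ξ : GroupLieAlgebra 𝓘(ℝ, F) G) :
    ∃ Z, inclDeriv n (h.verticalConnection n Z) = barMap F G L n.1 (generator G n.1 ξ) := by
  obtain ⟨Z, hZ⟩ := h.exists_inclDeriv_eq n (h.momentumDeriv_barMap n.1 (generator G n.1 ξ))
  refine ⟨Z, ?_⟩
  have h1 : baseDeriv n Z = infAction G n.1.proj ξ := by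
    rw [h.baseDeriv_eq, hZ, mfderiv_proj_barMap_generator]
  rw [h.inclDeriv_verticalConnection, h1, h.connForm_infAction]

/-- The third assertion on `Ω^V`. -/
lemma inclDeriv_verticalConnection_iff (n : momentumLevel L μ) (Z : TangentSpace 𝓘(ℝ, EN) n) :
    (∃! ξ : GroupLieAlgebra 𝓘(ℝ, F) G,
      ωM n.1.proj (baseDeriv n Z) = fundamentalField ξ n.1.proj) ∧
    ∀ ξ : GroupLieAlgebra 𝓘(ℝ, F) G,
      inclDeriv n (h.verticalConnection n Z) =
        barVector F G L n.1 (completeLift (fundamentalField ξ) n.1) ↔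
      ωM n.1.proj (baseDeriv n Z) = fundamentalField ξ n.1.proj := by
  refine ⟨⟨h.connForm n.1.proj (baseDeriv n Z), (h.infAction_connForm _ _).symm, fun ξ hξ => ?_⟩,
    fun ξ => ?_⟩
  · exact h.infAction_injective _ (hξ.symm.trans (h.infAction_connForm _ _).symm)
  · rw [completeLift_fundamentalField, barVector_eq_barMap, h.inclDeriv_verticalConnection,
      ← h.infAction_connForm]
    constructor
    · intro h1
      exact congrArg (infAction G n.1.proj) (h.barMap_generator_injective n.1 h1)
    · intro h1
      rw [h.infAction_injective _ h1]

/-- `Ω^V` is composed of equivariant maps: the projection to `TM`, the connection form, the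
generator and the correction. The adjoint factor of the connection form is absorbed by the
generator. -/
lemma isIsotropyInvariant_verticalConnection : IsIsotropyInvariant h.verticalConnection := by
  refine h.isIsotropyInvariant_of_inclDeriv fun g hg n Z => ?_
  rw [h.inclDeriv_verticalConnection, h.inclDeriv_verticalConnection, h.baseDeriv_levelAction]
  refine Eq.trans ?_ (mfderiv_tangentAction_barMap h.smooth h.invariant h.locked_regular g n.1
    _).symm
  have h1 := h.connForm_smul g n.1.proj (baseDeriv n Z)
  have h2 := mfderiv_tangentAction_generator g n.1 (h.connForm n.1.proj (baseDeriv n Z))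
  rw [← h1] at h2
  exact (congrArg (fun z : E × E => (barMap F G L (tangentAction g n.1) : E × E →L[ℝ] E × E) z)
    h2.symm)

end VerticalLift

end IsRouthSystem

end Routh

end

noncomputable section

section Routh

variable {E : Type*} [NormedAddCommGroup E] [NormedSpace ℝ E] [FiniteDimensional ℝ E]
  {M : Type*} [TopologicalSpace M] [T2Space M] [ChartedSpace E M] [IsManifold 𝓘(ℝ, E) ∞ M]
  {F : Type*} [NormedAddCommGroup F] [NormedSpace ℝ F] [FiniteDimensional ℝ F]
  {G : Type*} [TopologicalSpace G] [ChartedSpace F G] [Group G]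
  [LieGroup 𝓘(ℝ, F) ∞ G] [MulAction G M] [ContMDiffSMul 𝓘(ℝ, F) 𝓘(ℝ, E) ∞ G M]
  {EB : Type*} [NormedAddCommGroup EB] [NormedSpace ℝ EB] [FiniteDimensional ℝ EB]
  [ChartedSpace EB (OrbitSpace G M)] [IsManifold 𝓘(ℝ, EB) ∞ (OrbitSpace G M)]
  {L : TangentBundle 𝓘(ℝ, E) M → ℝ} {μ : GroupLieAlgebra 𝓘(ℝ, F) G →L[ℝ] ℝ}
  {EN : Type*} [NormedAddCommGroup EN] [NormedSpace ℝ EN] [FiniteDimensional ℝ EN]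
  [ChartedSpace EN (momentumLevel L μ)] [IsManifold 𝓘(ℝ, EN) ∞ (momentumLevel L μ)]
  {ωM : TensorField11 E M}

namespace IsRouthSystem

/-! ### Characterization of `Ω^V` by its image and kernel -/

section Splitting

variable (h : IsRouthSystem EB EN L μ ωM)

include h

omit h in
lemma mfderiv_proj_completeLift (Z : ∀ m : M, TangentSpace 𝓘(ℝ, E) m)
    (v : TangentBundle 𝓘(ℝ, E) M) :
    mfderiv 𝓘(ℝ, E).tangent 𝓘(ℝ, E) (fun u : TangentBundle 𝓘(ℝ, E) M => u.proj) v
      (completeLift Z v) = Z v.proj :=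
  mfderiv_tangentBundle_proj v _

lemma map_range_verticalConnection (n : momentumLevel L μ) {r : ℕ}
    (b : Module.Basis (Fin r) ℝ (GroupLieAlgebra 𝓘(ℝ, F) G)) :
    (h.verticalConnection n).range.map (inclDeriv n).toLinearMap = verticalSpan L b n.1 := by
  have h1 : verticalSpan L b n.1 =
      (barMap F G L n.1 ∘L generator (F := F) G n.1 : GroupLieAlgebra 𝓘(ℝ, F) G →ₗ[ℝ] _).range := by
    rw [LinearMap.range_eq_map, ← b.span_eq, Submodule.map_span, ← Set.range_comp, verticalSpan]
    congr 2
    funext a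
    rw [completeLift_fundamentalField, barVector_eq_barMap]
    rfl
  rw [h1]
  ext W
  constructor
  · rintro ⟨_, ⟨Z, rfl⟩, rfl⟩
    exact ⟨h.connForm n.1.proj (baseDeriv n Z), (h.inclDeriv_verticalConnection n Z).symm⟩
  · rintro ⟨ξ, rfl⟩
    obtain ⟨Z, hZ⟩ := h.exists_verticalConnection_eq n ξ
    exact ⟨_, ⟨Z, rfl⟩, hZ⟩

/-- The kernel consists of the `Z` with horizontal velocity in `M`. Corrected lifts of the frame
have velocity `X i` or `0`, so they belong to it; conversely, such a `Z` is expanded in two stages,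
first its velocity and then the remaining vertical vector. -/
lemma map_ker_verticalConnection {k : ℕ} {U : Set M} {X : Fin k → ∀ m : M, TangentSpace 𝓘(ℝ, E) m}
    (hX : IsStandardFrame G ωM U X) (n : momentumLevel L μ) (hn : n.1.proj ∈ U) :
    (h.verticalConnection n).ker.map (inclDeriv n).toLinearMap = horizontalSpan F G L X n.1 := by
  have hXω : ∀ i, ωM n.1.proj (X i n.1.proj) = 0 := fun i => by
    have h1 : X i n.1.proj ∈ Submodule.span ℝ (Set.range fun i => X i n.1.proj) :=
      Submodule.subset_span ⟨i, rfl⟩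
    rw [hX.span_eq _ hn] at h1
    exact h1
  apply le_antisymm
  · rintro _ ⟨Z, hZ, rfl⟩
    have hZ1 : ωM n.1.proj (baseDeriv n Z) = 0 := (h.verticalConnection_eq_zero_iff n Z).1 hZ
    have hmem : ∀ w, ωM n.1.proj w = 0 → ∃ c : Fin k → ℝ, ∑ i, c i • X i n.1.proj = w :=
      fun w hw => by
      have h1 : w ∈ (ωM n.1.proj).ker := hw
      rw [← hX.span_eq _ hn] at h1
      exact (Submodule.mem_span_range_iff_exists_fun ℝ).1 h1
    obtain ⟨c, hc⟩ := hmem _ hZ1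
    -- The coefficients `c` match velocities in `M`, so `W` is vertical.
    let W : TangentSpace 𝓘(ℝ, E).tangent n.1 :=
      inclDeriv n Z - ∑ i, c i • completeLift (X i) n.1
    have hW : mfderiv 𝓘(ℝ, E).tangent 𝓘(ℝ, E)
        (fun u : TangentBundle 𝓘(ℝ, E) M => u.proj) n.1 W = 0 := by
      rw [map_sub, ← h.baseDeriv_eq, map_sum, sub_eq_zero, ← hc]
      refine Finset.sum_congr rfl fun i _ => ?_
      rw [map_smul, mfderiv_proj_completeLift]
    obtain ⟨w, hw⟩ := exists_vlift_of_mfderiv_proj_eq_zero _ _ hW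
    -- Only the horizontal part of `w` needs the frame: the lift of its orbit part is annihilated by
    -- the correction.
    obtain ⟨d, hd⟩ := hmem (w - ωM n.1.proj w) (by rw [map_sub, h.connection_idem, sub_self])
    have hw2 : w = ∑ i, d i • X i n.1.proj +
        infAction (F := F) G n.1.proj (h.connForm n.1.proj w) := by
      rw [hd, h.infAction_connForm, sub_add_cancel]
    have h3 : barMap F G L n.1 (vlift n.1 w) =
        ∑ i, d i • barMap F G L n.1 (vlift n.1 (X i n.1.proj)) := by
      conv_lhs => rw [hw2]
      rw [map_add, map_add, barMap_vlift_infAction h.smooth h.locked_regular, add_zero, map_sum,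
        map_sum]
      refine Finset.sum_congr rfl fun i _ => ?_
      rw [map_smul, map_smul]
    have h4 : inclDeriv n Z = ∑ i, c i • barMap F G L n.1 (completeLift (X i) n.1) +
        ∑ i, d i • barMap F G L n.1 (vlift n.1 (X i n.1.proj)) := by
      rw [← h3, ← hw, ← h.barMap_inclDeriv n Z, map_sub, map_sum, h.barMap_inclDeriv]
      simp only [map_smul]
      exact (add_sub_cancel _ _).symm
    change inclDeriv n Z ∈ _
    rw [h4]
    refine add_mem (sum_mem fun i _ => Submodule.smul_mem _ _ (Submodule.subset_span (.inl ⟨i, ?_⟩)))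
      (sum_mem fun i _ => Submodule.smul_mem _ _ (Submodule.subset_span (.inr ⟨i, ?_⟩)))
    · exact barVector_eq_barMap _ _
    · exact (barVector_eq_barMap _ _).trans
        (congrArg (fun z : E × E => (barMap F G L n.1 : E × E →L[ℝ] E × E) z)
          (verticalLift_eq_vlift n.1 (X i n.1.proj)))
  · refine Submodule.span_le.2 ?_
    have key : ∀ W : TangentSpace 𝓘(ℝ, E).tangent n.1, ωM n.1.proj (mfderiv 𝓘(ℝ, E).tangent 𝓘(ℝ, E)
        (fun u : TangentBundle 𝓘(ℝ, E) M => u.proj) n.1 W) = 0 →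
        barVector F G L n.1 W ∈
          (h.verticalConnection n).ker.map (inclDeriv (EN := EN) n).toLinearMap := by
      intro W hW
      rw [barVector_eq_barMap]
      obtain ⟨Z, hZ⟩ := h.exists_inclDeriv_eq n (h.momentumDeriv_barMap n.1 W)
      refine ⟨Z, (h.verticalConnection_eq_zero_iff n Z).2 ?_, hZ⟩
      rw [h.baseDeriv_eq, hZ, mfderiv_proj_barMap, hW]
    rintro _ (⟨i, rfl⟩ | ⟨i, rfl⟩)
    · refine key _ ?_
      rw [mfderiv_proj_completeLift, hXω]
    · refine key _ ?_
      rw [verticalLift_eq_vlift, mfderiv_proj_vlift, map_zero]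

lemma isVerticalLiftSplitting_verticalConnection :
    IsVerticalLiftSplitting ωM h.verticalConnection where
  projection := h.verticalConnection_idem
  map_range n _ b := h.map_range_verticalConnection n b
  map_ker _ _ hX n hn := h.map_ker_verticalConnection hX n hn

lemma eq_verticalConnection {Ω : TensorField11 EN (momentumLevel L μ)}
    (hΩ : IsVerticalLiftSplitting ωM Ω) : Ω = h.verticalConnection := by
  funext n
  have hmap : Function.Injective (Submodule.map (inclDeriv (EN := EN) n).toLinearMap) :=
    Submodule.map_injective_of_injective (h.inclDeriv_injective n)
  let b : Module.Basis (Fin (Module.finrank ℝ F)) ℝ (GroupLieAlgebra 𝓘(ℝ, F) G) :=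
    Module.finBasis ℝ F
  have hr := hmap ((hΩ.map_range n b).trans (h.map_range_verticalConnection n b).symm)
  -- The hypothesis on the kernel says something at `n` only because a standard frame exists near
  -- its base point.
  have hX := h.isStandardFrame_horizontalLift (orbitProj G n.1.proj)
  have hn : n.1.proj ∈ {m : M | orbitProj G m ∈ (chartAt EB (orbitProj G n.1.proj)).source} :=
    mem_chart_source EB _
  have hk := hmap ((hΩ.map_ker _ _ hX n hn).trans (h.map_ker_verticalConnection hX n hn).symm)
  refine eq_of_projections (hΩ.projection n) (h.verticalConnection_idem n) (fun Z => ?_)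
    fun Z hZ => ?_
  · have h1 : Ω n Z ∈ (Ω n).range := ⟨Z, rfl⟩
    rw [hr] at h1
    obtain ⟨Z', hZ'⟩ := h1
    exact ⟨Z', hZ'.symm⟩
  · have h1 : Z ∈ (Ω n).ker := hZ
    rw [hk] at h1
    exact h1

end Splitting

/-! ### The projection to the tangent bundle of the orbit space -/

section LevelProj

variable (h : IsRouthSystem EB EN L μ ωM)

include h

lemma contMDiff_tangentMap_orbitProj : ContMDiff 𝓘(ℝ, E).tangent 𝓘(ℝ, EB).tangent ∞
    (tangentMap 𝓘(ℝ, E) 𝓘(ℝ, EB) (orbitProj G : M → OrbitSpace G M)) :=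
  h.connection.smooth_map.contMDiff_tangentMap (by simp)

/-- By naturality the image is the vertical lift of `π_* ξ̃ = 0`. Hence the correction is invisible
in `T(M/G)`. -/
lemma mfderiv_tangentMap_orbitProj_vlift (v : TangentBundle 𝓘(ℝ, E) M)
    (ξ : GroupLieAlgebra 𝓘(ℝ, F) G) :
    mfderiv 𝓘(ℝ, E).tangent 𝓘(ℝ, EB).tangent
      (tangentMap 𝓘(ℝ, E) 𝓘(ℝ, EB) (orbitProj G : M → OrbitSpace G M)) v
      (vlift v (infAction G v.proj ξ)) = 0 := by
  rw [mfderiv_tangentMap_vlift h.connection.smooth_map,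
    mfderiv_orbitProj_infAction h.connection.smooth_map]
  exact map_zero (vlift (tangentMap 𝓘(ℝ, E) 𝓘(ℝ, EB) (orbitProj G : M → OrbitSpace G M) v))

lemma mfderiv_tangentMap_orbitProj_barMap (v : TangentBundle 𝓘(ℝ, E) M)
    (W : TangentSpace 𝓘(ℝ, E).tangent v) :
    mfderiv 𝓘(ℝ, E).tangent 𝓘(ℝ, EB).tangent
      (tangentMap 𝓘(ℝ, E) 𝓘(ℝ, EB) (orbitProj G : M → OrbitSpace G M)) v (barMap F G L v W) =
    mfderiv 𝓘(ℝ, E).tangent 𝓘(ℝ, EB).tangent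
      (tangentMap 𝓘(ℝ, E) 𝓘(ℝ, EB) (orbitProj G : M → OrbitSpace G M)) v W := by
  rw [barMap_apply, map_sub, h.mfderiv_tangentMap_orbitProj_vlift, sub_zero]

lemma tangentMap_orbitProj_tangentAction (g : G) (v : TangentBundle 𝓘(ℝ, E) M) :
    tangentMap 𝓘(ℝ, E) 𝓘(ℝ, EB) (orbitProj G : M → OrbitSpace G M) (tangentAction g v) =
      tangentMap 𝓘(ℝ, E) 𝓘(ℝ, EB) (orbitProj G : M → OrbitSpace G M) v := by
  have h1 : (orbitProj G ∘ fun x : M => g • x) = (orbitProj G : M → OrbitSpace G M) :=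
    funext fun x => orbitProj_smul g x
  have h2 := tangentMap_comp_at (I := 𝓘(ℝ, E)) (I' := 𝓘(ℝ, E)) (I'' := 𝓘(ℝ, EB)) v
    (g := (orbitProj G : M → OrbitSpace G M)) (f := fun x : M => g • x)
    (h.connection.smooth_map.mdifferentiable (by simp) _)
    ((contMDiff_smul_left F g).mdifferentiable (by simp) _)
  rw [h1] at h2
  exact h2.symm

lemma mfderiv_tangentMap_orbitProj_generator (v : TangentBundle 𝓘(ℝ, E) M)
    (ξ : GroupLieAlgebra 𝓘(ℝ, F) G) :
    mfderiv 𝓘(ℝ, E).tangent 𝓘(ℝ, EB).tangent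
      (tangentMap 𝓘(ℝ, E) 𝓘(ℝ, EB) (orbitProj G : M → OrbitSpace G M)) v
      (generator G v ξ) = 0 := by
  have hs : ContMDiff 𝓘(ℝ, F) 𝓘(ℝ, E).tangent ∞ (fun g : G => tangentAction g v) :=
    contMDiff_tangentAction_uncurry.comp (contMDiff_id.prodMk contMDiff_const)
  have h1 := HasMFDerivAt.comp (1 : G) (f := fun g : G => tangentAction g v)
    ((h.contMDiff_tangentMap_orbitProj.mdifferentiable (by simp)
      (tangentAction (1 : G) v)).hasMFDerivAt)
    ((hs.mdifferentiable (by simp) 1).hasMFDerivAt)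
  have h2 : tangentMap 𝓘(ℝ, E) 𝓘(ℝ, EB) (orbitProj G : M → OrbitSpace G M) ∘
      (fun g : G => tangentAction g v) =
      fun _ => tangentMap 𝓘(ℝ, E) 𝓘(ℝ, EB) (orbitProj G : M → OrbitSpace G M) v :=
    funext fun g => h.tangentMap_orbitProj_tangentAction g v
  rw [h2] at h1
  have h3 := congrArg (fun l : F →L[ℝ] EB × EB => l ξ)
    (hasMFDerivAt_unique h1 (hasMFDerivAt_const _ _))
  refine Eq.trans ?_ h3
  exact (mfderiv_apply_congr_point (E₀ := E × E) (E₁ := EB × EB) (tangentAction_one v) _).symm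

lemma mfderiv_levelProj (n : momentumLevel L μ) (Z : TangentSpace 𝓘(ℝ, EN) n) :
    mfderiv 𝓘(ℝ, EN) 𝓘(ℝ, EB).tangent (levelProj EB (L := L) (μ := μ)) n Z =
      mfderiv 𝓘(ℝ, E).tangent 𝓘(ℝ, EB).tangent
        (tangentMap 𝓘(ℝ, E) 𝓘(ℝ, EB) (orbitProj G : M → OrbitSpace G M)) n.1 (inclDeriv n Z) := by
  have h1 := HasMFDerivAt.comp n
    ((h.contMDiff_tangentMap_orbitProj.mdifferentiable (by simp) n.1).hasMFDerivAt)
    ((h.contMDiff_incl.mdifferentiable (by simp) n).hasMFDerivAt)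
  exact congrArg (fun l : EN →L[ℝ] EB × EB => l Z) h1.mfderiv

/-- Lift the base velocity first; the remaining error is vertical and is matched by a vertical lift.
-/
lemma mfderiv_tangentMap_orbitProj_surjective (v : TangentBundle 𝓘(ℝ, E) M) :
    Function.Surjective (mfderiv 𝓘(ℝ, E).tangent 𝓘(ℝ, EB).tangent
      (tangentMap 𝓘(ℝ, E) 𝓘(ℝ, EB) (orbitProj G : M → OrbitSpace G M)) v) := by
  intro V
  obtain ⟨w₀, hw₀⟩ := h.connection.submersion v.proj (mfderiv 𝓘(ℝ, EB).tangent 𝓘(ℝ, EB)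
    (fun u : TangentBundle 𝓘(ℝ, EB) (OrbitSpace G M) => u.proj) _ V)
  obtain ⟨W₀, hW₀⟩ := mfderiv_tangentBundle_proj_surjective v w₀
  have h1 := mfderiv_proj_tangentMap h.connection.smooth_map v W₀
  rw [hW₀, hw₀] at h1
  obtain ⟨u, hu⟩ := exists_vlift_of_mfderiv_proj_eq_zero _ (V - mfderiv 𝓘(ℝ, E).tangent
    𝓘(ℝ, EB).tangent (tangentMap 𝓘(ℝ, E) 𝓘(ℝ, EB) (orbitProj G : M → OrbitSpace G M)) v W₀)
    (by rw [map_sub, h1, sub_self])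
  obtain ⟨w₁, hw₁⟩ := h.connection.submersion v.proj u
  refine ⟨W₀ + vlift v w₁, ?_⟩
  rw [map_add, mfderiv_tangentMap_vlift h.connection.smooth_map, hw₁]
  exact (congrArg (fun z : EB × EB => _ + z) hu.symm).trans (add_sub_cancel _ _)

/-- Generators and corrections are killed by `T(Tπ)`. Conversely, a vector `Z` in the kernel lies
over some `ξ̃`, and its difference from the generator of `ξ` is the vertical lift of an orbit
direction. The correction fixes `Z` and removes this lift, so `Z` is the corrected generator. -/
lemma range_verticalConnection (n : momentumLevel L μ) :
    (h.verticalConnection n).range =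
      (mfderiv 𝓘(ℝ, EN) 𝓘(ℝ, EB).tangent (levelProj EB (L := L) (μ := μ)) n).ker := by
  ext Z
  constructor
  · rintro ⟨Z, rfl⟩
    refine (h.mfderiv_levelProj n _).trans ?_
    refine (congrArg (fun z : E × E => (mfderiv 𝓘(ℝ, E).tangent 𝓘(ℝ, EB).tangent
        (tangentMap 𝓘(ℝ, E) 𝓘(ℝ, EB) (orbitProj G : M → OrbitSpace G M)) n.1 :
          E × E →L[ℝ] EB × EB) z) (h.inclDeriv_verticalConnection n Z)).trans ?_
    exact (h.mfderiv_tangentMap_orbitProj_barMap _ _).trans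
      (h.mfderiv_tangentMap_orbitProj_generator _ _)
  · intro hZ
    have h1 : mfderiv 𝓘(ℝ, E).tangent 𝓘(ℝ, EB).tangent
        (tangentMap 𝓘(ℝ, E) 𝓘(ℝ, EB) (orbitProj G : M → OrbitSpace G M)) n.1 (inclDeriv n Z) = 0 :=
      (h.mfderiv_levelProj n Z).symm.trans hZ
    have h2 := mfderiv_proj_tangentMap h.connection.smooth_map n.1 (inclDeriv n Z)
    rw [h1, map_zero, ← h.baseDeriv_eq] at h2
    obtain ⟨ξ, hξ⟩ := (h.mfderiv_orbitProj_eq_zero_iff _ _).1 h2.symm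
    obtain ⟨w, hw⟩ := exists_vlift_of_mfderiv_proj_eq_zero _ (inclDeriv n Z - generator G n.1 ξ)
      (by rw [map_sub, ← h.baseDeriv_eq, mfderiv_proj_generator, hξ, sub_self])
    have h3 := mfderiv_tangentMap_vlift h.connection.smooth_map n.1 w
    rw [← hw, map_sub, h1, h.mfderiv_tangentMap_orbitProj_generator, sub_zero] at h3
    have h4 : mfderiv 𝓘(ℝ, E) 𝓘(ℝ, EB) (orbitProj G : M → OrbitSpace G M) n.1.proj w = 0 :=
      vlift_injective _ (h3.symm.trans (map_zero _).symm)
    obtain ⟨η, rfl⟩ := (h.mfderiv_orbitProj_eq_zero_iff _ _).1 h4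
    refine ⟨Z, h.inclDeriv_injective n ?_⟩
    refine (h.inclDeriv_verticalConnection n Z).trans ?_
    rw [← hξ, h.connForm_infAction, ← h.barMap_inclDeriv n Z]
    rw [sub_eq_iff_eq_add.1 hw, map_add, barMap_vlift_infAction h.smooth h.locked_regular, zero_add]

lemma isConnection_verticalConnection :
    IsConnection 𝓘(ℝ, EB).tangent (levelProj EB (L := L) (μ := μ)) h.verticalConnection where
  smooth_map := h.contMDiff_tangentMap_orbitProj.comp h.contMDiff_incl
  submersion n V := by
    -- A preimage in `T(TM)` can be corrected to be tangent to `N_μ` without changing its image.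
    obtain ⟨W, hW⟩ := h.mfderiv_tangentMap_orbitProj_surjective n.1 V
    obtain ⟨Z, hZ⟩ := h.exists_inclDeriv_eq n (h.momentumDeriv_barMap n.1 W)
    refine ⟨Z, (h.mfderiv_levelProj n Z).trans ?_⟩
    rw [hZ, h.mfderiv_tangentMap_orbitProj_barMap, hW]
  smooth := h.isSmoothTensor_verticalConnection
  projection := h.verticalConnection_idem
  range_eq := h.range_verticalConnection

end LevelProj

end IsRouthSystem

end Routh

end

noncomputable section

section Routh

variable {E : Type*} [NormedAddCommGroup E] [NormedSpace ℝ E] [FiniteDimensional ℝ E]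
  {M : Type*} [TopologicalSpace M] [T2Space M] [ChartedSpace E M] [IsManifold 𝓘(ℝ, E) ∞ M]
  {F : Type*} [NormedAddCommGroup F] [NormedSpace ℝ F] [FiniteDimensional ℝ F]
  {G : Type*} [TopologicalSpace G] [ChartedSpace F G] [Group G]
  [LieGroup 𝓘(ℝ, F) ∞ G] [MulAction G M] [ContMDiffSMul 𝓘(ℝ, F) 𝓘(ℝ, E) ∞ G M]
  {EB : Type*} [NormedAddCommGroup EB] [NormedSpace ℝ EB] [FiniteDimensional ℝ EB]
  [ChartedSpace EB (OrbitSpace G M)] [IsManifold 𝓘(ℝ, EB) ∞ (OrbitSpace G M)]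
  {L : TangentBundle 𝓘(ℝ, E) M → ℝ} {μ : GroupLieAlgebra 𝓘(ℝ, F) G →L[ℝ] ℝ}
  {EN : Type*} [NormedAddCommGroup EN] [NormedSpace ℝ EN] [FiniteDimensional ℝ EN]
  [ChartedSpace EN (momentumLevel L μ)] [IsManifold 𝓘(ℝ, EN) ∞ (momentumLevel L μ)]
  {ωM : TensorField11 E M}

namespace IsRouthSystem

/-! ### The mechanical connection -/

section Mechanical

variable (h : IsRouthSystem EB EN L μ ωM)

lemma smoothHomAt_momentumDeriv_vlift (hL : ContMDiff 𝓘(ℝ, E).tangent 𝓘(ℝ, ℝ) ∞ L)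
    (v₀ : TangentBundle 𝓘(ℝ, E) M) :
    SmoothHomAt 𝓘(ℝ, E).tangent 𝓘(ℝ, E) 𝓘(ℝ, F →L[ℝ] ℝ)
      (fun v : TangentBundle 𝓘(ℝ, E) M => v.proj) (fun _ => (0 : F →L[ℝ] ℝ))
      (fun v => (momentumDeriv (F := F) G L v : E × E →L[ℝ] F →L[ℝ] ℝ) ∘L (vlift v : E →L[ℝ] E × E))
      v₀ :=
  (smoothHomAt_momentumDeriv (F := F) (G := G) hL v₀).comp (smoothHomAt_vlift v₀) continuousAt_id

include h

/-- The linear forms `g(·, w)` on the isotropy algebra. -/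
def isotropyForm (n : momentumLevel L μ) :
    TangentSpace 𝓘(ℝ, E) n.1.proj →L[ℝ] isotropySubspace μ →L[ℝ] ℝ :=
  ((ContinuousLinearMap.compL ℝ (isotropySubspace μ) F ℝ).flip (isotropySubspace μ).subtypeL) ∘L
    (momentumDeriv (F := F) G L n.1 : E × E →L[ℝ] F →L[ℝ] ℝ) ∘L (vlift n.1 : E →L[ℝ] E × E)

lemma isotropyForm_apply (n : momentumLevel L μ) (w : TangentSpace 𝓘(ℝ, E) n.1.proj)
    (η : isotropySubspace μ) :
    isotropyForm n w η = hessian L n.1 w (infAction (F := F) G n.1.proj η.1) :=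
  momentumDeriv_vlift h.smooth n.1 w η.1

lemma smoothHomAt_isotropyForm (n : momentumLevel L μ) :
    SmoothHomAt 𝓘(ℝ, EN) 𝓘(ℝ, E) 𝓘(ℝ, isotropySubspace μ →L[ℝ] ℝ)
      (fun n : momentumLevel L μ => n.1.proj) (fun _ => (0 : isotropySubspace μ →L[ℝ] ℝ))
      (fun n => isotropyForm n) n := by
  have h1 := (smoothHomAt_momentumDeriv_vlift (F := F) (G := G) h.smooth n.1).precomp
    (φ := (Subtype.val : momentumLevel L μ → _)) h.contMDiff_incl.contMDiffAt
  have h2 := smoothHomAt_const (J := 𝓘(ℝ, EN)) (f := fun _ : momentumLevel L μ => (0 : F →L[ℝ] ℝ))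
    (g := fun _ => (0 : isotropySubspace μ →L[ℝ] ℝ))
    ((ContinuousLinearMap.compL ℝ (isotropySubspace μ) F ℝ).flip (isotropySubspace μ).subtypeL)
    (x₀ := n)
  exact h2.comp h1 continuousAt_const

/-- The infinitesimal action of the isotropy algebra. -/
def isotropyAction (n : momentumLevel L μ) :
    isotropySubspace μ →L[ℝ] TangentSpace 𝓘(ℝ, E) n.1.proj :=
  (infAction (F := F) G n.1.proj : F →L[ℝ] E) ∘L (isotropySubspace μ).subtypeL

lemma smoothHomAt_isotropyAction (n : momentumLevel L μ) :
    SmoothHomAt 𝓘(ℝ, EN) 𝓘(ℝ, isotropySubspace μ) 𝓘(ℝ, E)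
      (fun _ : momentumLevel L μ => (0 : isotropySubspace μ)) (fun n => n.1.proj)
      (fun n => isotropyAction n) n := by
  have h1 := (smoothHomAt_infAction_model (F := F) (G := G) n.1.proj).precomp
    (φ := fun n : momentumLevel L μ => n.1.proj)
    (contMDiff_bundleProj.comp h.contMDiff_incl).contMDiffAt
  have h2 := smoothHomAt_const (J := 𝓘(ℝ, EN))
    (f := fun _ : momentumLevel L μ => (0 : isotropySubspace μ))
    (g := fun _ => (0 : F)) (isotropySubspace μ).subtypeL (x₀ := n)
  exact h1.comp h2 continuousAt_const

lemma isotropyForm_isotropyAction_injective (n : momentumLevel L μ) :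
    Function.Injective
      ((isotropyForm n : E →L[ℝ] isotropySubspace μ →L[ℝ] ℝ) ∘L
        (isotropyAction n : isotropySubspace μ →L[ℝ] E)) := by
  refine (injective_iff_map_eq_zero _).2 fun ξ hξ => Subtype.ext ?_
  refine h.isotropy_regular n.1 n.2 ξ.1 ξ.2 fun η hη => ?_
  refine (lockedHessian_apply (F := F) (G := G) n.1 ξ.1 η).trans ?_
  refine (h.isotropyForm_apply n (isotropyAction n ξ) ⟨η, hη⟩).symm.trans ?_
  exact congrArg (fun l : isotropySubspace μ →L[ℝ] ℝ => l ⟨η, hη⟩) hξ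

/-- `κ(w)` is the element of `𝔤_μ` with `g(κ(w)~, η̃) = g(w, η̃)` for all `η ∈ 𝔤_μ`. It exists
because `g` is non-degenerate on `𝔤_μ` along `N_μ`. -/
lemma exists_mechForm (n : momentumLevel L μ) :
    ∃ κ : TangentSpace 𝓘(ℝ, E) n.1.proj →L[ℝ] isotropySubspace μ,
      (isotropyForm n ∘L isotropyAction n) ∘L κ = isotropyForm n := by
  have hinj := h.isotropyForm_isotropyAction_injective n
  refine exists_comp_eq_of_forall_mem_range (E₀ := E) (E₁ := isotropySubspace μ)
    (E₂ := isotropySubspace μ →L[ℝ] ℝ) hinj fun w => ?_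
  exact ⟨_, apply_inverse_of_injective_dual hinj _⟩

/-- The connection form of the mechanical connection. -/
def mechForm (n : momentumLevel L μ) : TangentSpace 𝓘(ℝ, E) n.1.proj →L[ℝ] isotropySubspace μ :=
  (h.exists_mechForm n).choose

/-- The value of the connection form of the mechanical connection, in the Lie algebra. -/
def mechValue (n : momentumLevel L μ) (w : TangentSpace 𝓘(ℝ, E) n.1.proj) :
    GroupLieAlgebra 𝓘(ℝ, F) G :=
  (h.mechForm n w).1

lemma mechValue_mem (n : momentumLevel L μ) (w : TangentSpace 𝓘(ℝ, E) n.1.proj) :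
    h.mechValue n w ∈ isotropyAlgebra μ :=
  (h.mechForm n w).2

lemma hessian_mechForm (n : momentumLevel L μ) (w : TangentSpace 𝓘(ℝ, E) n.1.proj)
    {η : GroupLieAlgebra 𝓘(ℝ, F) G} (hη : η ∈ isotropyAlgebra μ) :
    hessian L n.1 (infAction (F := F) G n.1.proj (h.mechValue n w)) (infAction G n.1.proj η) =
      hessian L n.1 w (infAction G n.1.proj η) := by
  have h1 := congrArg (fun l : E →L[ℝ] isotropySubspace μ →L[ℝ] ℝ => l w ⟨η, hη⟩)
    (h.exists_mechForm n).choose_spec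
  exact (h.isotropyForm_apply n (isotropyAction n (h.mechForm n w)) ⟨η, hη⟩).symm.trans
    (h1.trans (h.isotropyForm_apply n w ⟨η, hη⟩))

lemma mechForm_eq (n : momentumLevel L μ) {w : TangentSpace 𝓘(ℝ, E) n.1.proj}
    {ξ : GroupLieAlgebra 𝓘(ℝ, F) G} (hξ : ξ ∈ isotropyAlgebra μ)
    (hw : ∀ η ∈ isotropyAlgebra μ, hessian L n.1 (infAction G n.1.proj ξ) (infAction G n.1.proj η) =
      hessian L n.1 w (infAction G n.1.proj η)) : h.mechForm n w = ⟨ξ, hξ⟩ := by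
  refine h.isotropyForm_isotropyAction_injective n (ContinuousLinearMap.ext fun η => ?_)
  refine (h.isotropyForm_apply n (isotropyAction n (h.mechForm n w)) η).trans ?_
  refine Eq.trans ?_ (h.isotropyForm_apply n (isotropyAction n ⟨ξ, hξ⟩) η).symm
  exact (h.hessian_mechForm n w η.2).trans (hw η.1 η.2).symm

lemma mechValue_eq (n : momentumLevel L μ) {w : TangentSpace 𝓘(ℝ, E) n.1.proj}
    {ξ : GroupLieAlgebra 𝓘(ℝ, F) G} (hξ : ξ ∈ isotropyAlgebra μ)
    (hw : ∀ η ∈ isotropyAlgebra μ, hessian L n.1 (infAction G n.1.proj ξ) (infAction G n.1.proj η) =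
      hessian L n.1 w (infAction G n.1.proj η)) : h.mechValue n w = ξ :=
  congrArg Subtype.val (h.mechForm_eq n hξ hw)

lemma smoothHomAt_mechForm (n : momentumLevel L μ) :
    SmoothHomAt 𝓘(ℝ, EN) 𝓘(ℝ, E) 𝓘(ℝ, isotropySubspace μ)
      (fun n : momentumLevel L μ => n.1.proj) (fun _ => (0 : isotropySubspace μ))
      (fun n => h.mechForm n) n := by
  have h1 := (h.smoothHomAt_isotropyForm n).comp (h.smoothHomAt_isotropyAction n)
    (contMDiff_bundleProj.comp h.contMDiff_incl).continuous.continuousAt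
  exact SmoothHomAt.of_comp_injective h1 (h.smoothHomAt_isotropyForm n) continuousAt_const
    (h.isotropyForm_isotropyAction_injective n)
    (.of_forall fun n => (h.exists_mechForm n).choose_spec)

/-- The generators of the isotropy algebra. -/
def isotropyGenerator (n : momentumLevel L μ) :
    isotropySubspace μ →L[ℝ] TangentSpace 𝓘(ℝ, E).tangent n.1 :=
  (generator (F := F) G n.1 : F →L[ℝ] E × E) ∘L (isotropySubspace μ).subtypeL

/-- The generator of the mechanical connection form, as a family of maps on the level set. -/
def mechMap (n : momentumLevel L μ) :
    TangentSpace 𝓘(ℝ, EN) n →L[ℝ] TangentSpace 𝓘(ℝ, E).tangent n.1 :=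
  isotropyGenerator n ∘L h.mechForm n ∘L baseDeriv n

lemma smoothHomAt_mechMap (n : momentumLevel L μ) :
    SmoothHomAt 𝓘(ℝ, EN) 𝓘(ℝ, EN) 𝓘(ℝ, E).tangent id Subtype.val h.mechMap n := by
  have h1 := (h.smoothHomAt_mechForm n).comp (h.smoothHomAt_baseDeriv n)
    (contMDiff_bundleProj.comp h.contMDiff_incl).continuous.continuousAt
  have h2 := smoothHomAt_const (J := 𝓘(ℝ, EN))
    (f := fun _ : momentumLevel L μ => (0 : isotropySubspace μ))
    (g := fun _ => (0 : F)) (isotropySubspace μ).subtypeL (x₀ := n)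
  have h3 := ((smoothHomAt_generator_model (F := F) (G := G) n.1).precomp
    (φ := (Subtype.val : momentumLevel L μ → _)) h.contMDiff_incl.contMDiffAt).comp h2
      continuousAt_const
  exact h3.comp h1 continuousAt_const

lemma exists_mechConnection : ∃ Ω : TensorField11 EN (momentumLevel L μ), IsSmoothTensor Ω ∧
    ∀ n Z, inclDeriv n (Ω n Z) = h.mechMap n Z :=
  h.exists_tensor h.smoothHomAt_mechMap fun n Z =>
    momentumDeriv_generator_eq_zero h.smooth h.invariant n.2 (h.mechValue_mem n (baseDeriv n Z))

/-- The mechanical connection on the level set of momentum. -/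
def mechConnection : TensorField11 EN (momentumLevel L μ) :=
  h.exists_mechConnection.choose

lemma isSmoothTensor_mechConnection : IsSmoothTensor h.mechConnection :=
  h.exists_mechConnection.choose_spec.1

lemma inclDeriv_mechConnection (n : momentumLevel L μ) (Z : TangentSpace 𝓘(ℝ, EN) n) :
    inclDeriv n (h.mechConnection n Z) =
      generator (F := F) G n.1 (h.mechValue n (baseDeriv n Z)) :=
  h.exists_mechConnection.choose_spec.2 n Z

lemma baseDeriv_mechConnection (n : momentumLevel L μ) (Z : TangentSpace 𝓘(ℝ, EN) n) :
    baseDeriv n (h.mechConnection n Z) =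
      infAction (F := F) G n.1.proj (h.mechValue n (baseDeriv n Z)) := by
  rw [h.baseDeriv_eq, h.inclDeriv_mechConnection, mfderiv_proj_generator]

/-- For `ξ ∈ 𝔤_μ` the orthogonal projection of `ξ̃` is `ξ` itself. Idempotence and the description
of the image follow. -/
lemma mechConnection_eq_self (n : momentumLevel L μ) {Z : TangentSpace 𝓘(ℝ, EN) n}
    {ξ : GroupLieAlgebra 𝓘(ℝ, F) G} (hξ : ξ ∈ isotropyAlgebra μ)
    (hZ : inclDeriv n Z = generator G n.1 ξ) : h.mechConnection n Z = Z := by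
  refine h.inclDeriv_injective n ?_
  have h1 : baseDeriv n Z = infAction G n.1.proj ξ := by
    rw [h.baseDeriv_eq, hZ, mfderiv_proj_generator]
  have h2 : h.mechValue n (baseDeriv n Z) = ξ := by
    rw [h1]
    exact h.mechValue_eq n hξ fun _ _ => rfl
  rw [h.inclDeriv_mechConnection, h2, hZ]

lemma mechConnection_idem (n : momentumLevel L μ) :
    h.mechConnection n ∘L h.mechConnection n = h.mechConnection n :=
  ContinuousLinearMap.ext fun Z => h.mechConnection_eq_self n (h.mechValue_mem n (baseDeriv n Z))
    (h.inclDeriv_mechConnection n Z)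

lemma image_range_mechConnection (n : momentumLevel L μ) :
    inclDeriv n '' Set.range (h.mechConnection n) =
      (fun ξ => completeLift (fundamentalField ξ) n.1) '' isotropyAlgebra μ := by
  ext W
  constructor
  · rintro ⟨_, ⟨Z, rfl⟩, rfl⟩
    refine ⟨(h.mechValue n (baseDeriv n Z)), (h.mechValue_mem n (baseDeriv n Z)), ?_⟩
    exact (completeLift_fundamentalField _ _).trans (h.inclDeriv_mechConnection n Z).symm
  · rintro ⟨ξ, hξ, rfl⟩
    obtain ⟨Z, hZ⟩ := h.exists_inclDeriv_eq n
      (momentumDeriv_generator_eq_zero h.smooth h.invariant n.2 hξ)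
    refine ⟨Z, ⟨Z, h.mechConnection_eq_self n hξ hZ⟩, ?_⟩
    exact hZ.trans (completeLift_fundamentalField _ _).symm

/-- By non-degeneracy, the element of `𝔤_μ` attached to `τ_* Z` is zero exactly when `τ_* Z` is
orthogonal to the directions of `𝔤_μ`. Symmetry of the Hessian exchanges the arguments. -/
lemma mechConnection_eq_zero_iff (n : momentumLevel L μ) (Z : TangentSpace 𝓘(ℝ, EN) n) :
    h.mechConnection n Z = 0 ↔ ∀ ξ ∈ isotropyAlgebra μ,
      hessian L n.1 (fundamentalField ξ n.1.proj) (baseDeriv n Z) = 0 := by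
  constructor
  · intro hZ ξ hξ
    have h1 : infAction (E := E) (F := F) G n.1.proj (h.mechValue n (baseDeriv n Z)) = 0 := by
      rw [← h.baseDeriv_mechConnection, hZ, map_zero]
    refine (hessian_symm (E := E) (M := M) h.smooth n.1 (infAction (E := E) (F := F) G n.1.proj ξ) (baseDeriv n Z)).trans ?_
    refine (h.hessian_mechForm n (baseDeriv n Z) hξ).symm.trans ?_
    rw [h1]
    exact congrArg (fun l : E →L[ℝ] ℝ => l (infAction (E := E) (F := F) G n.1.proj ξ : E))
      (map_zero (hessian L n.1))
  · intro hZ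
    have h1 := h.mechValue_eq n (w := baseDeriv n Z) (zero_mem_isotropyAlgebra (F := F) (G := G) μ)
      fun η hη => by
        refine Eq.trans ?_ ((hZ η hη).symm.trans
          (hessian_symm (E := E) (M := M) h.smooth n.1 (infAction (E := E) (F := F) G n.1.proj η) (baseDeriv n Z)))
        rw [map_zero]
        exact congrArg (fun l : E →L[ℝ] ℝ => l (infAction (E := E) (F := F) G n.1.proj η : E))
          (map_zero (hessian L n.1))
    refine h.inclDeriv_injective n ?_
    rw [h.inclDeriv_mechConnection, h1]
    exact (map_zero (generator (F := F) G n.1)).trans (map_zero (inclDeriv n)).symm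

/-- The defining equations at `n` are transported by the invariance of the Hessian, and `Ad_g`
preserves `𝔤_μ`; uniqueness of the solution concludes. -/
lemma mechValue_levelAction {g : G} (hg : g ∈ isotropyGroup μ) (n : momentumLevel L μ)
    (w : TangentSpace 𝓘(ℝ, E) n.1.proj) :
    h.mechValue (h.levelAction hg n) (mfderiv 𝓘(ℝ, E) 𝓘(ℝ, E) (fun x : M => g • x) n.1.proj w) =
      adjointMap g (h.mechValue n w) := by
  refine h.mechValue_eq (h.levelAction hg n)
    (adjointMap_mem_isotropyAlgebra hg (h.mechValue_mem n w)) fun η hη => ?_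
  have hη' := adjointMap_mem_isotropyAlgebra (inv_mem_isotropyGroup hg) hη
  have e1 : infAction (E := E) G (g • n.1.proj) η =
      mfderiv 𝓘(ℝ, E) 𝓘(ℝ, E) (fun x : M => g • x) n.1.proj
        (infAction (E := E) G n.1.proj (adjointMap g⁻¹ η)) := by
    rw [mfderiv_smul_infAction, adjointMap_inv_apply]
  have e2 := mfderiv_smul_infAction (E := E) g n.1.proj (h.mechValue n w)
  have h1 := h.hessian_mechForm n w hη'
  rw [← hessian_tangentAction (F := F) h.smooth h.invariant g,
    ← hessian_tangentAction (F := F) h.smooth h.invariant g, ← e1, e2] at h1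
  exact h1

lemma isIsotropyInvariant_mechConnection : IsIsotropyInvariant h.mechConnection := by
  refine h.isIsotropyInvariant_of_inclDeriv fun g hg n Z => ?_
  rw [h.inclDeriv_mechConnection, h.inclDeriv_mechConnection, h.baseDeriv_levelAction,
    h.mechValue_levelAction, mfderiv_tangentAction_generator]
  rfl

lemma isMechanicalConnection_mechConnection : IsMechanicalConnection h.mechConnection where
  smooth := h.isSmoothTensor_mechConnection
  projection := h.mechConnection_idem
  image_range := h.image_range_mechConnection
  invariant := h.isIsotropyInvariant_mechConnection
  ker_iff := h.mechConnection_eq_zero_iff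

lemma eq_mechConnection {Ω : TensorField11 EN (momentumLevel L μ)}
    (hΩ : IsMechanicalConnection Ω) : Ω = h.mechConnection := by
  funext n
  refine eq_of_projections (hΩ.projection n) (h.mechConnection_idem n) (fun Z => ?_) fun Z hZ => ?_
  · have h1 : inclDeriv n (Ω n Z) ∈ inclDeriv n '' Set.range (Ω n) := ⟨_, ⟨Z, rfl⟩, rfl⟩
    rw [hΩ.image_range, ← h.image_range_mechConnection] at h1
    obtain ⟨_, ⟨Z', rfl⟩, hZ'⟩ := h1
    exact ⟨Z', h.inclDeriv_injective n hZ'.symm⟩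
  · exact (h.mechConnection_eq_zero_iff n Z).2 ((hΩ.ker_iff n Z).1 hZ)

/-- `Ω^mech(Z)` is a generator already tangent to `N_μ`, so the correction in `Ω^V` leaves it alone.
This makes the composite a projection with the image of `Ω^mech`. -/
lemma verticalConnection_mechConnection (n : momentumLevel L μ) (Z : TangentSpace 𝓘(ℝ, EN) n) :
    h.verticalConnection n (h.mechConnection n Z) = h.mechConnection n Z := by
  refine h.inclDeriv_injective n ?_
  rw [h.inclDeriv_verticalConnection, h.baseDeriv_mechConnection, h.connForm_infAction,
    ← h.inclDeriv_mechConnection, h.barMap_inclDeriv]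

/-- The composite of the two connections is a principal connection. -/
lemma isPrincipalIsotropyConnection_comp :
    IsPrincipalIsotropyConnection (h.mechConnection.comp h.verticalConnection) where
  smooth := isSmoothTensor_of_smoothHomAt fun n =>
    (SmoothHomAt.of_tensor h.isSmoothTensor_mechConnection n).comp
      (SmoothHomAt.of_tensor h.isSmoothTensor_verticalConnection n) continuousAt_id
  projection n := ContinuousLinearMap.ext fun Z => by
    change h.mechConnection n (h.verticalConnection n (h.mechConnection n
      (h.verticalConnection n Z))) = h.mechConnection n (h.verticalConnection n Z)
    rw [h.verticalConnection_mechConnection]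
    exact congrArg (fun l : EN →L[ℝ] EN => l (h.verticalConnection n Z)) (h.mechConnection_idem n)
  image_range n := by
    rw [← h.image_range_mechConnection]
    congr 1
    ext Z
    constructor
    · rintro ⟨Z, rfl⟩
      exact ⟨_, rfl⟩
    · rintro ⟨Z, rfl⟩
      refine ⟨h.mechConnection n Z, ?_⟩
      change h.mechConnection n (h.verticalConnection n (h.mechConnection n Z)) = _
      rw [h.verticalConnection_mechConnection]
      exact congrArg (fun l : EN →L[ℝ] EN => l Z) (h.mechConnection_idem n)
  invariant g hg := by
    obtain ⟨φ, hφ, hφg, h1⟩ := h.isIsotropyInvariant_mechConnection g hg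
    obtain ⟨ψ, -, hψg, h2⟩ := h.isIsotropyInvariant_verticalConnection g hg
    -- Both maps are the restriction of the tangent action to `N_μ`.
    obtain rfl : ψ = φ := funext fun n => Subtype.ext ((hψg n).trans (hφg n).symm)
    refine ⟨ψ, hφ, hφg, fun n => ?_⟩
    refine ContinuousLinearMap.ext fun Z => ?_
    refine (congrArg (fun l : EN →L[ℝ] EN => l (h.verticalConnection n Z)) (h1 n)).trans ?_
    exact congrArg (h.mechConnection (ψ n)) (congrArg (fun l : EN →L[ℝ] EN => l Z) (h2 n))

end Mechanical

end IsRouthSystem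

/-- The connections on the level set of momentum of a Routh system. -/
theorem routh_connections (h : IsRouthSystem EB EN L μ ωM) :
    ∃ ΩV Ωmech : TensorField11 EN (momentumLevel L μ),
      IsVerticalLiftSplitting ωM ΩV ∧
      (∀ Ω : TensorField11 EN (momentumLevel L μ), IsVerticalLiftSplitting ωM Ω → Ω = ΩV) ∧
      IsConnection 𝓘(ℝ, EB).tangent (levelProj EB (L := L) (μ := μ)) ΩV ∧
      IsIsotropyInvariant ΩV ∧
      (∀ (n : momentumLevel L μ) (Z : TangentSpace 𝓘(ℝ, EN) n),
        (∃! ξ : GroupLieAlgebra 𝓘(ℝ, F) G,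
          ωM n.1.proj (baseDeriv n Z) = fundamentalField ξ n.1.proj) ∧
        ∀ ξ : GroupLieAlgebra 𝓘(ℝ, F) G,
          inclDeriv n (ΩV n Z) = barVector F G L n.1 (completeLift (fundamentalField ξ) n.1) ↔
            ωM n.1.proj (baseDeriv n Z) = fundamentalField ξ n.1.proj) ∧
      IsMechanicalConnection Ωmech ∧
      (∀ Ω : TensorField11 EN (momentumLevel L μ), IsMechanicalConnection Ω → Ω = Ωmech) ∧
      IsPrincipalIsotropyConnection (Ωmech.comp ΩV) :=
  ⟨h.verticalConnection, h.mechConnection, h.isVerticalLiftSplitting_verticalConnection,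
    fun _ => h.eq_verticalConnection, h.isConnection_verticalConnection,
    h.isIsotropyInvariant_verticalConnection, h.inclDeriv_verticalConnection_iff,
    h.isMechanicalConnection_mechConnection, fun _ => h.eq_mechConnection,
    h.isPrincipalIsotropyConnection_comp⟩

end Routh

end

noncomputable section

/-! ### Manifolds with a single global chart -/

section GlobalChart

variable {X : Type*} [TopologicalSpace X] {H : Type*} [NormedAddCommGroup H] [NormedSpace ℝ H]

/-- The charted space structure given by a global homeomorphism to the model space. -/
abbrev globalChartedSpace (e : X ≃ₜ H) : ChartedSpace H X :=
  e.toOpenPartialHomeomorph.singletonChartedSpace rfl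

lemma isManifold_globalChartedSpace (e : X ≃ₜ H) :
    letI := globalChartedSpace e
    IsManifold 𝓘(ℝ, H) ∞ X :=
  e.toOpenPartialHomeomorph.isManifold_singleton rfl

end GlobalChart

/-! ### A system with symmetry group the translations of a line -/

namespace PlanarRouth

/-- The group of translations of the line. -/
def Translations : Type := ℝ

instance : TopologicalSpace Translations := inferInstanceAs (TopologicalSpace ℝ)

instance : ConnectedSpace Translations := inferInstanceAs (ConnectedSpace ℝ)

instance : ChartedSpace ℝ Translations := inferInstanceAs (ChartedSpace ℝ ℝ)

instance : CommGroup Translations := inferInstanceAs (CommGroup (Multiplicative ℝ))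

instance : IsManifold 𝓘(ℝ, ℝ) ∞ Translations := inferInstanceAs (IsManifold 𝓘(ℝ, ℝ) ∞ ℝ)

instance : LieGroup 𝓘(ℝ, ℝ) ∞ Translations where
  contMDiff_mul := contMDiff_add 𝓘(ℝ, ℝ) (G := ℝ) ∞
  contMDiff_inv := contMDiff_neg 𝓘(ℝ, ℝ) (G := ℝ) ∞

/-- The displacement of a translation. -/
def displacement (g : Translations) : ℝ := g

instance : MulAction Translations (ℝ × ℝ) where
  smul g m := (m.1, displacement g + m.2)
  one_smul m := Prod.ext rfl (zero_add m.2)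
  mul_smul g g' m := Prod.ext rfl (add_assoc (displacement g) (displacement g') m.2)

lemma contMDiff_displacement : ContMDiff 𝓘(ℝ, ℝ) 𝓘(ℝ, ℝ) ∞ displacement :=
  contMDiff_id (M := ℝ)

instance : ContMDiffSMul 𝓘(ℝ, ℝ) 𝓘(ℝ, ℝ × ℝ) ∞ Translations (ℝ × ℝ) where
  contMDiff_smul := by
    have h1 : ContMDiff (𝓘(ℝ, ℝ).prod 𝓘(ℝ, ℝ × ℝ)) 𝓘(ℝ, ℝ × ℝ) ∞
        (fun p : Translations × (ℝ × ℝ) => p.2) := contMDiff_snd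
    exact (contDiff_fst.contMDiff.comp h1).prodMk_space
      ((contMDiff_displacement.comp contMDiff_fst).add (contDiff_snd.contMDiff.comp h1))

lemma infAction_apply (m : ℝ × ℝ) (ξ : ℝ) :
    (infAction (E := ℝ × ℝ) (F := ℝ) Translations m : ℝ →L[ℝ] ℝ × ℝ) ξ = (0, ξ) := by
  have h1 : HasFDerivAt (fun t : ℝ => ((m.1, t + m.2) : ℝ × ℝ))
      (ContinuousLinearMap.inr ℝ ℝ ℝ) 0 :=
    (hasFDerivAt_const m.1 (0 : ℝ)).prodMk ((hasFDerivAt_id (𝕜 := ℝ) (0 : ℝ)).add_const m.2)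
  exact congrArg (fun l : ℝ →L[ℝ] ℝ × ℝ => l ξ) h1.hasMFDerivAt.mfderiv

lemma mfderiv_smul (g : Translations) (m : ℝ × ℝ) :
    (mfderiv 𝓘(ℝ, ℝ × ℝ) 𝓘(ℝ, ℝ × ℝ) (fun x : ℝ × ℝ => g • x) m : ℝ × ℝ →L[ℝ] ℝ × ℝ) =
      ContinuousLinearMap.id ℝ (ℝ × ℝ) := by
  have h1 : HasFDerivAt (fun x : ℝ × ℝ => ((x.1, displacement g + x.2) : ℝ × ℝ))
      (ContinuousLinearMap.id ℝ (ℝ × ℝ)) m :=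
    (hasFDerivAt_fst.prodMk (hasFDerivAt_snd.const_add (displacement g))).congr_fderiv rfl
  exact h1.hasMFDerivAt.mfderiv

lemma tangentAction_eq (g : Translations) (v : TangentBundle 𝓘(ℝ, ℝ × ℝ) (ℝ × ℝ)) :
    tangentAction g v = ⟨g • v.proj, (v.2 : ℝ × ℝ)⟩ :=
  congrArg (fun l : ℝ × ℝ →L[ℝ] ℝ × ℝ =>
    (⟨g • v.proj, l v.2⟩ : TangentBundle 𝓘(ℝ, ℝ × ℝ) (ℝ × ℝ))) (mfderiv_smul g v.proj)

/-- The map `(g, m) ↦ (g • m, m)` is a closed embedding: a continuous left inverse recovers `g` as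
the difference of second coordinates. -/
instance : ProperSMul Translations (ℝ × ℝ) where
  isProperMap_smul_pair := by
    have h1 : Function.LeftInverse (fun q : (ℝ × ℝ) × (ℝ × ℝ) => (q.1.2 - q.2.2, q.2))
        (fun p : ℝ × (ℝ × ℝ) => ((p.2.1, p.1 + p.2.2), p.2)) := fun p => by simp
    exact (h1.isClosedEmbedding (by fun_prop) (by fun_prop)).isProperMap

/-! #### The orbit space -/

/-- The orbits are parametrized by the first coordinate. -/
def orbitHomeomorph : OrbitSpace Translations (ℝ × ℝ) ≃ₜ ℝ where
  toFun := Quotient.lift (fun m : ℝ × ℝ => m.1) (by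
    rintro a b ⟨g, rfl⟩
    rfl)
  invFun x := orbitProj Translations (x, 0)
  left_inv := by
    rintro ⟨m⟩
    exact Quotient.sound ⟨(-m.2 : ℝ), Prod.ext rfl (neg_add_cancel m.2)⟩
  right_inv _ := rfl
  continuous_toFun := continuous_fst.quotient_lift _
  continuous_invFun := continuous_quotient_mk'.comp (by fun_prop)

instance : ChartedSpace ℝ (OrbitSpace Translations (ℝ × ℝ)) := globalChartedSpace orbitHomeomorph

instance : IsManifold 𝓘(ℝ, ℝ) ∞ (OrbitSpace Translations (ℝ × ℝ)) :=
  isManifold_globalChartedSpace orbitHomeomorph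

lemma continuous_orbitProj :
    Continuous (orbitProj Translations : ℝ × ℝ → OrbitSpace Translations (ℝ × ℝ)) :=
  continuous_quotient_mk'

lemma contMDiff_orbitProj : ContMDiff 𝓘(ℝ, ℝ × ℝ) 𝓘(ℝ, ℝ) ∞
    (orbitProj Translations : ℝ × ℝ → OrbitSpace Translations (ℝ × ℝ)) :=
  contMDiff_iff.2 ⟨continuous_orbitProj, fun _ _ => contDiff_fst.contDiffOn⟩

lemma mfderiv_orbitProj (m : ℝ × ℝ) :
    (mfderiv 𝓘(ℝ, ℝ × ℝ) 𝓘(ℝ, ℝ)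
      (orbitProj Translations : ℝ × ℝ → OrbitSpace Translations (ℝ × ℝ)) m : ℝ × ℝ →L[ℝ] ℝ) =
      ContinuousLinearMap.fst ℝ ℝ ℝ :=
  HasMFDerivAt.mfderiv ⟨continuous_orbitProj.continuousAt, hasFDerivAt_fst.hasFDerivWithinAt⟩

/-! #### The Lagrangian -/

/-- The symmetric bilinear form with matrix `!![1, 1/2; 1/2, 1]`. -/
def kineticForm : ℝ × ℝ →L[ℝ] ℝ × ℝ →L[ℝ] ℝ :=
  (ContinuousLinearMap.fst ℝ ℝ ℝ).smulRight (ContinuousLinearMap.fst ℝ ℝ ℝ +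
    (2⁻¹ : ℝ) • ContinuousLinearMap.snd ℝ ℝ ℝ) +
  (ContinuousLinearMap.snd ℝ ℝ ℝ).smulRight ((2⁻¹ : ℝ) • ContinuousLinearMap.fst ℝ ℝ ℝ +
    ContinuousLinearMap.snd ℝ ℝ ℝ)

lemma kineticForm_apply (u w : ℝ × ℝ) :
    kineticForm u w = u.1 * (w.1 + 2⁻¹ * w.2) + u.2 * (2⁻¹ * w.1 + w.2) := by
  simp [kineticForm, mul_add]

lemma kineticForm_symm (u w : ℝ × ℝ) : kineticForm u w = kineticForm w u := by
  rw [kineticForm_apply, kineticForm_apply]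
  ring

lemma eq_zero_of_kineticForm_eq_zero {u : ℝ × ℝ} (hu : ∀ w, kineticForm u w = 0) : u = 0 := by
  have h1 := hu (1, 0)
  have h2 := hu (0, 1)
  rw [kineticForm_apply] at h1 h2
  norm_num at h1 h2
  exact Prod.ext (by rw [Prod.fst_zero]; linarith) (by rw [Prod.snd_zero]; linarith)

/-- The kinetic energy of `kineticForm`. -/
def lagrangian (v : TangentBundle 𝓘(ℝ, ℝ × ℝ) (ℝ × ℝ)) : ℝ :=
  2⁻¹ * kineticForm v.2 v.2

lemma contMDiff_lagrangian : ContMDiff 𝓘(ℝ, ℝ × ℝ).tangent 𝓘(ℝ, ℝ) ∞ lagrangian := by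
  have h1 : ContDiff ℝ ∞ (fun y : ℝ × ℝ => 2⁻¹ * kineticForm y y) := by fun_prop
  exact h1.contMDiff.comp (contMDiff_snd_tangentBundle_modelSpace (ℝ × ℝ) 𝓘(ℝ, ℝ × ℝ))

lemma hasFDerivAt_kineticEnergy (y : ℝ × ℝ) :
    HasFDerivAt (fun y : ℝ × ℝ => 2⁻¹ * kineticForm y y) (kineticForm y) y := by
  have h1 := (kineticForm.hasFDerivAt_of_bilinear (hasFDerivAt_id y) (hasFDerivAt_id y)).const_mul
    (2⁻¹ : ℝ)
  refine h1.congr_fderiv (ContinuousLinearMap.ext fun w => ?_)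
  have h2 := kineticForm_symm w y
  simp [ContinuousLinearMap.precompR, ContinuousLinearMap.precompL, h2]
  ring

lemma fibreDeriv_lagrangian (v : TangentBundle 𝓘(ℝ, ℝ × ℝ) (ℝ × ℝ)) :
    (fibreDeriv lagrangian v : ℝ × ℝ →L[ℝ] ℝ) = kineticForm v.2 :=
  (hasFDerivAt_kineticEnergy v.2).fderiv

lemma hessian_lagrangian (v : TangentBundle 𝓘(ℝ, ℝ × ℝ) (ℝ × ℝ)) :
    (hessian lagrangian v : ℝ × ℝ →L[ℝ] ℝ × ℝ →L[ℝ] ℝ) = kineticForm := by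
  have h1 : (fun x : ℝ × ℝ => fderiv ℝ (fun y : ℝ × ℝ =>
      lagrangian (⟨v.proj, y⟩ : TangentBundle 𝓘(ℝ, ℝ × ℝ) (ℝ × ℝ))) x) = kineticForm :=
    funext fun x => (hasFDerivAt_kineticEnergy x).fderiv
  exact (congrArg (fun f => fderiv ℝ f (v.2 : ℝ × ℝ)) h1).trans kineticForm.fderiv

/-- The coefficient `2⁻¹` of `w.1` measures how far the first axis is from being orthogonal to the
orbits; it is what separates the two connections. -/
lemma hessian_lagrangian_infAction (v : TangentBundle 𝓘(ℝ, ℝ × ℝ) (ℝ × ℝ)) (ξ : ℝ) (w : ℝ × ℝ) :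
    (hessian lagrangian v : ℝ × ℝ →L[ℝ] ℝ × ℝ →L[ℝ] ℝ)
      ((infAction (E := ℝ × ℝ) (F := ℝ) Translations v.proj : ℝ →L[ℝ] ℝ × ℝ) ξ) w =
      ξ * (2⁻¹ * w.1 + w.2) := by
  refine (congrArg (fun b : ℝ × ℝ →L[ℝ] ℝ × ℝ →L[ℝ] ℝ =>
    b ((infAction (E := ℝ × ℝ) (F := ℝ) Translations v.proj : ℝ →L[ℝ] ℝ × ℝ) ξ) w)
    (hessian_lagrangian v)).trans ?_
  refine (congrArg (fun y : ℝ × ℝ => kineticForm y w) (infAction_apply v.proj ξ)).trans ?_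
  rw [kineticForm_apply, zero_mul, zero_add]

lemma lockedHessian_lagrangian (v : TangentBundle 𝓘(ℝ, ℝ × ℝ) (ℝ × ℝ)) (ξ η : ℝ) :
    (lockedHessian (F := ℝ) Translations lagrangian v : ℝ →L[ℝ] ℝ →L[ℝ] ℝ) ξ η = ξ * η := by
  refine (hessian_lagrangian_infAction v ξ
    ((infAction (E := ℝ × ℝ) (F := ℝ) Translations v.proj : ℝ →L[ℝ] ℝ × ℝ) η)).trans ?_
  refine (congrArg (fun y : ℝ × ℝ => ξ * (2⁻¹ * y.1 + y.2)) (infAction_apply v.proj η)).trans ?_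
  rw [mul_zero, zero_add]

lemma momentum_lagrangian (v : TangentBundle 𝓘(ℝ, ℝ × ℝ) (ℝ × ℝ)) (ξ : ℝ) :
    (momentum (F := ℝ) Translations lagrangian v : ℝ →L[ℝ] ℝ) ξ =
      (2⁻¹ * (v.2 : ℝ × ℝ).1 + (v.2 : ℝ × ℝ).2) * ξ := by
  refine (congrArg (fun l : ℝ × ℝ →L[ℝ] ℝ =>
      l ((infAction (E := ℝ × ℝ) (F := ℝ) Translations v.proj : ℝ →L[ℝ] ℝ × ℝ) ξ))
      (fibreDeriv_lagrangian v)).trans ?_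
  refine (congrArg (fun y : ℝ × ℝ => kineticForm v.2 y) (infAction_apply v.proj ξ)).trans ?_
  refine (kineticForm_apply v.2 (0, ξ)).trans ?_
  ring

/-- The zero level of the momentum. -/
abbrev zeroLevel : Set (TangentBundle 𝓘(ℝ, ℝ × ℝ) (ℝ × ℝ)) :=
  momentumLevel lagrangian (0 : GroupLieAlgebra 𝓘(ℝ, ℝ) Translations →L[ℝ] ℝ)

lemma mem_zeroLevel_iff (v : TangentBundle 𝓘(ℝ, ℝ × ℝ) (ℝ × ℝ)) :
    v ∈ zeroLevel ↔ (v.2 : ℝ × ℝ).2 = -(2⁻¹ * (v.2 : ℝ × ℝ).1) := by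
  constructor
  · intro hv
    have h1 := congrArg (fun l : ℝ →L[ℝ] ℝ => l (1 : ℝ)) hv
    have h2 := (momentum_lagrangian v 1).symm.trans h1
    rw [mul_one] at h2
    exact (neg_eq_of_add_eq_zero_right h2).symm
  · intro hv
    refine ContinuousLinearMap.ext (R₁ := ℝ) (M₁ := ℝ) fun ξ => (momentum_lagrangian v ξ).trans ?_
    rw [hv, add_neg_cancel, zero_mul]
    rfl

/-! #### The zero level of the momentum -/

/-- The parametrization of the zero level by base point and first velocity component. -/
def levelHomeomorph : zeroLevel ≃ₜ (ℝ × ℝ) × ℝ where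
  toFun n := (n.1.proj, (n.1.2 : ℝ × ℝ).1)
  invFun a := ⟨⟨a.1, ((a.2, -(2⁻¹ * a.2)) : ℝ × ℝ)⟩, (mem_zeroLevel_iff _).2 rfl⟩
  left_inv n := by
    refine Subtype.ext ?_
    have h1 := (mem_zeroLevel_iff n.1).1 n.2
    exact congrArg (fun y : ℝ × ℝ => (⟨n.1.proj, y⟩ : TangentBundle 𝓘(ℝ, ℝ × ℝ) (ℝ × ℝ)))
      (Prod.ext rfl h1.symm)
  right_inv _ := rfl
  continuous_toFun := by
    have h1 := (tangentBundleModelSpaceHomeomorph 𝓘(ℝ, ℝ × ℝ)).continuous.comp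
      (continuous_subtype_val (p := (· ∈ zeroLevel)))
    exact (continuous_fst.comp h1).prodMk (continuous_fst.comp (continuous_snd.comp h1))
  continuous_invFun := by
    refine Continuous.subtype_mk ?_ _
    have h1 : Continuous (fun a : (ℝ × ℝ) × ℝ => ((a.1, (a.2, -(2⁻¹ * a.2))) :
      (ℝ × ℝ) × (ℝ × ℝ))) := by fun_prop
    exact (tangentBundleModelSpaceHomeomorph 𝓘(ℝ, ℝ × ℝ)).symm.continuous.comp h1

instance : ChartedSpace ((ℝ × ℝ) × ℝ) zeroLevel := globalChartedSpace levelHomeomorph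

instance : IsManifold 𝓘(ℝ, (ℝ × ℝ) × ℝ) ∞ zeroLevel :=
  isManifold_globalChartedSpace levelHomeomorph

/-- The linear equivalence straightening the zero level. -/
def straightening : ((((ℝ × ℝ) × ℝ)) × ℝ) ≃L[ℝ] (ℝ × ℝ) × (ℝ × ℝ) :=
  LinearEquiv.toContinuousLinearEquiv
    { toFun := fun p => (p.1.1, (p.1.2, p.2 - 2⁻¹ * p.1.2))
      invFun := fun q => ((q.1, q.2.1), q.2.2 + 2⁻¹ * q.2.1)
      map_add' := fun p q => by ext <;> simp; ring
      map_smul' := fun c p => by ext <;> simp; ring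
      left_inv := fun p => by simp
      right_inv := fun q => by simp }

/-- In the global charts the inclusion is `a ↦ straightening (a, 0)`. -/
lemma isSmoothEmbedding_zeroLevel :
    Manifold.IsSmoothEmbedding 𝓘(ℝ, (ℝ × ℝ) × ℝ) 𝓘(ℝ, ℝ × ℝ).tangent ∞
      (Subtype.val : zeroLevel → TangentBundle 𝓘(ℝ, ℝ × ℝ) (ℝ × ℝ)) where
  isImmersion := ⟨ℝ, inferInstance, inferInstance, fun n =>
    .mk_of_continuousAt continuous_subtype_val.continuousAt straightening
      (chartAt ((ℝ × ℝ) × ℝ) n) (chartAt (ModelProd (ℝ × ℝ) (ℝ × ℝ)) n.1)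
      (mem_chart_source _ n) (mem_chart_source _ n.1)
      (IsManifold.chart_mem_maximalAtlas n) (IsManifold.chart_mem_maximalAtlas n.1) fun a _ => by
        simp [straightening]
        rfl⟩
  isEmbedding := .subtypeVal

lemma baseDeriv_zeroLevel (n : zeroLevel) :
    (baseDeriv n : (ℝ × ℝ) × ℝ →L[ℝ] ℝ × ℝ) = ContinuousLinearMap.fst ℝ (ℝ × ℝ) ℝ :=
  HasMFDerivAt.mfderiv ⟨(FiberBundle.continuous_proj _ _).continuousAt.comp
    continuous_subtype_val.continuousAt, hasFDerivAt_fst.hasFDerivWithinAt⟩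

/-! #### The connection and its failure to be mechanical -/

/-- The projection onto the orbits along the first coordinate axis. -/
def flatConnection : TensorField11 (ℝ × ℝ) (ℝ × ℝ) := fun _ =>
  (ContinuousLinearMap.inr ℝ ℝ ℝ ∘L ContinuousLinearMap.snd ℝ ℝ ℝ : ℝ × ℝ →L[ℝ] ℝ × ℝ)

lemma isConnection_flatConnection :
    IsConnection 𝓘(ℝ, ℝ) (orbitProj Translations : ℝ × ℝ → OrbitSpace Translations (ℝ × ℝ))
      flatConnection where
  smooth_map := contMDiff_orbitProj
  submersion m y := ⟨((y, 0) : ℝ × ℝ),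
    congrArg (fun l : ℝ × ℝ →L[ℝ] ℝ => l ((y, 0) : ℝ × ℝ)) (mfderiv_orbitProj m)⟩
  smooth := isSmoothTensor_of_smoothHomAt fun _ => smoothHomAt_const _
  projection _ := rfl
  range_eq m := by
    have h1 : (ContinuousLinearMap.inr ℝ ℝ ℝ ∘L ContinuousLinearMap.snd ℝ ℝ ℝ :
        ℝ × ℝ →L[ℝ] ℝ × ℝ).range = (ContinuousLinearMap.fst ℝ ℝ ℝ).ker := by
      ext w
      constructor
      · rintro ⟨w, rfl⟩
        rfl
      · intro hw
        exact ⟨w, Prod.ext (Eq.symm hw) rfl⟩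
    exact h1.trans (congrArg (fun l : ℝ × ℝ →L[ℝ] ℝ => l.ker) (mfderiv_orbitProj m).symm)

lemma mem_isotropyGroup (g : Translations) :
    g ∈ isotropyGroup (0 : GroupLieAlgebra 𝓘(ℝ, ℝ) Translations →L[ℝ] ℝ) := fun _ => rfl

/-- At `μ = 0` the isotropy group is the whole group, so the one-parameter group `t ↦ t * ξ` lies in
it. -/
lemma mem_isotropyAlgebra (ξ : ℝ) :
    (ξ : GroupLieAlgebra 𝓘(ℝ, ℝ) Translations) ∈
      isotropyAlgebra (0 : GroupLieAlgebra 𝓘(ℝ, ℝ) Translations →L[ℝ] ℝ) := by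
  have h1 : HasFDerivAt (fun t : ℝ => t * ξ) ((ContinuousLinearMap.id ℝ ℝ).smulRight ξ) 0 :=
    (hasFDerivAt_id (0 : ℝ)).mul_const' ξ
  have h2 : ContDiff ℝ ∞ (fun t : ℝ => t * ξ) := by fun_prop
  refine ⟨fun t : ℝ => (t * ξ : ℝ), h2.contMDiff, zero_mul ξ, fun _ => mem_isotropyGroup _, ?_⟩
  refine (congrArg (fun l : ℝ →L[ℝ] ℝ => l 1) h1.hasMFDerivAt.mfderiv).trans ?_
  simp

lemma isRouthSystem : IsRouthSystem ℝ ((ℝ × ℝ) × ℝ) lagrangian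
    (0 : GroupLieAlgebra 𝓘(ℝ, ℝ) Translations →L[ℝ] ℝ) flatConnection where
  free g m hg := add_eq_right.1 (congrArg Prod.snd hg : displacement g + m.2 = m.2)
  proper := inferInstance
  connection := isConnection_flatConnection
  connection_invariant g m := by
    have h1 := congrArg (fun l : ℝ × ℝ →L[ℝ] ℝ × ℝ => l ∘L flatConnection m) (mfderiv_smul g m)
    have h2 := congrArg (fun l : ℝ × ℝ →L[ℝ] ℝ × ℝ => flatConnection (g • m) ∘L l)
      (mfderiv_smul g m)
    exact h1.trans h2.symm
  smooth := contMDiff_lagrangian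
  invariant g v := (congrArg lagrangian (tangentAction_eq g v)).trans rfl
  regular v u hu := by
    have h1 : ∀ w : ℝ × ℝ, kineticForm u w = 0 := fun w =>
      (congrArg (fun b : ℝ × ℝ →L[ℝ] ℝ × ℝ →L[ℝ] ℝ => b u w) (hessian_lagrangian v)).symm.trans (hu w)
    exact eq_zero_of_kineticForm_eq_zero h1
  locked_regular v ξ hξ := by
    exact (mul_one (M := ℝ) ξ).symm.trans
      ((lockedHessian_lagrangian v ξ 1).symm.trans (hξ (1 : ℝ)))
  isotropy_regular v _ ξ _ hξ := by
    exact (mul_one (M := ℝ) ξ).symm.trans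
      ((lockedHessian_lagrangian v ξ 1).symm.trans (hξ (1 : ℝ) (mem_isotropyAlgebra 1)))
  submanifold := isSmoothEmbedding_zeroLevel

/-- The two principal connections on the zero level differ. -/
lemma mechConnection_comp_verticalConnection_ne :
    isRouthSystem.mechConnection.comp isRouthSystem.verticalConnection ≠
      isRouthSystem.mechConnection := by
  intro heq
  let n : zeroLevel := levelHomeomorph.symm 0
  -- `Z` lies over the first axis direction, which is horizontal for the flat connection, so `Ω^V(Z)
  -- = 0`. Equality of the connections would force `Ω^mech(Z) = 0`, that is `1/2 = 0`.
  let Z : TangentSpace 𝓘(ℝ, (ℝ × ℝ) × ℝ) n := (((1, 0), 0) : (ℝ × ℝ) × ℝ)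
  have hb : (baseDeriv n Z : ℝ × ℝ) = (1, 0) :=
    congrArg (fun l : (ℝ × ℝ) × ℝ →L[ℝ] ℝ × ℝ => l ((1, 0), 0)) (baseDeriv_zeroLevel n)
  have hV : isRouthSystem.verticalConnection n Z = 0 :=
    (isRouthSystem.verticalConnection_eq_zero_iff n Z).2
      (congrArg (flatConnection n.1.proj : ℝ × ℝ →L[ℝ] ℝ × ℝ) hb)
  have hM : isRouthSystem.mechConnection n Z = 0 := by
    rw [← heq]
    exact (congrArg (isRouthSystem.mechConnection n) hV).trans (map_zero _)
  have h1 := (isRouthSystem.mechConnection_eq_zero_iff n Z).1 hM _ (mem_isotropyAlgebra 1)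
  have h2 := (hessian_lagrangian_infAction n.1 1 (baseDeriv n Z)).symm.trans h1
  have h3 := (congrArg (fun y : ℝ × ℝ => (1 : ℝ) * (2⁻¹ * y.1 + y.2)) hb).symm.trans h2
  norm_num at h3

end PlanarRouth

end

theorem mainTheorem5 :
    (∀ {E : Type*} [NormedAddCommGroup E] [NormedSpace ℝ E] [FiniteDimensional ℝ E]
      {M : Type*} [TopologicalSpace M] [T2Space M] [SecondCountableTopology M]
      [ChartedSpace E M] [IsManifold 𝓘(ℝ, E) ∞ M]
      {F : Type*} [NormedAddCommGroup F] [NormedSpace ℝ F] [FiniteDimensional ℝ F]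
      {G : Type*} [TopologicalSpace G] [ConnectedSpace G] [ChartedSpace F G] [Group G]
      [LieGroup 𝓘(ℝ, F) ∞ G] [MulAction G M] [ContMDiffSMul 𝓘(ℝ, F) 𝓘(ℝ, E) ∞ G M]
      {EB : Type*} [NormedAddCommGroup EB] [NormedSpace ℝ EB] [FiniteDimensional ℝ EB]
      [ChartedSpace EB (OrbitSpace G M)] [IsManifold 𝓘(ℝ, EB) ∞ (OrbitSpace G M)]
      (L : TangentBundle 𝓘(ℝ, E) M → ℝ) (μ : GroupLieAlgebra 𝓘(ℝ, F) G →L[ℝ] ℝ)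
      {EN : Type*} [NormedAddCommGroup EN] [NormedSpace ℝ EN] [FiniteDimensional ℝ EN]
      [ChartedSpace EN (momentumLevel L μ)] [IsManifold 𝓘(ℝ, EN) ∞ (momentumLevel L μ)]
      (ωM : TensorField11 E M), IsRouthSystem EB EN L μ ωM →
      ∃ ΩV Ωmech : TensorField11 EN (momentumLevel L μ),
        IsVerticalLiftSplitting ωM ΩV ∧
        (∀ Ω : TensorField11 EN (momentumLevel L μ), IsVerticalLiftSplitting ωM Ω → Ω = ΩV) ∧
        IsConnection 𝓘(ℝ, EB).tangent (levelProj EB (L := L) (μ := μ)) ΩV ∧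
        IsIsotropyInvariant ΩV ∧
        (∀ (n : momentumLevel L μ) (Z : TangentSpace 𝓘(ℝ, EN) n),
          (∃! ξ : GroupLieAlgebra 𝓘(ℝ, F) G,
            ωM n.1.proj (baseDeriv n Z) = fundamentalField ξ n.1.proj) ∧
          ∀ ξ : GroupLieAlgebra 𝓘(ℝ, F) G,
            inclDeriv n (ΩV n Z) = barVector F G L n.1 (completeLift (fundamentalField ξ) n.1) ↔
              ωM n.1.proj (baseDeriv n Z) = fundamentalField ξ n.1.proj) ∧
        IsMechanicalConnection Ωmech ∧
        (∀ Ω : TensorField11 EN (momentumLevel L μ), IsMechanicalConnection Ω → Ω = Ωmech) ∧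
        IsPrincipalIsotropyConnection (Ωmech.comp ΩV)) ∧
    (∃ (E : Type) (_ : NormedAddCommGroup E) (_ : NormedSpace ℝ E) (_ : FiniteDimensional ℝ E)
      (M : Type) (_ : TopologicalSpace M) (_ : T2Space M) (_ : SecondCountableTopology M)
      (_ : ChartedSpace E M) (_ : IsManifold 𝓘(ℝ, E) ∞ M)
      (F : Type) (_ : NormedAddCommGroup F) (_ : NormedSpace ℝ F) (_ : FiniteDimensional ℝ F)
      (G : Type) (_ : TopologicalSpace G) (_ : ConnectedSpace G) (_ : ChartedSpace F G)
      (_ : Group G) (_ : LieGroup 𝓘(ℝ, F) ∞ G) (_ : MulAction G M)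
      (_ : ContMDiffSMul 𝓘(ℝ, F) 𝓘(ℝ, E) ∞ G M)
      (EB : Type) (_ : NormedAddCommGroup EB) (_ : NormedSpace ℝ EB) (_ : FiniteDimensional ℝ EB)
      (_ : ChartedSpace EB (OrbitSpace G M)) (_ : IsManifold 𝓘(ℝ, EB) ∞ (OrbitSpace G M))
      (L : TangentBundle 𝓘(ℝ, E) M → ℝ) (μ : GroupLieAlgebra 𝓘(ℝ, F) G →L[ℝ] ℝ)
      (EN : Type) (_ : NormedAddCommGroup EN) (_ : NormedSpace ℝ EN) (_ : FiniteDimensional ℝ EN)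
      (_ : ChartedSpace EN (momentumLevel L μ)) (_ : IsManifold 𝓘(ℝ, EN) ∞ (momentumLevel L μ))
      (ωM : TensorField11 E M) (ΩV Ωmech : TensorField11 EN (momentumLevel L μ)),
      IsRouthSystem EB EN L μ ωM ∧ IsVerticalLiftSplitting ωM ΩV ∧
        IsMechanicalConnection Ωmech ∧ Ωmech.comp ΩV ≠ Ωmech) :=
  ⟨by intros; exact routh_connections ‹_›,
    ℝ × ℝ, inferInstance, inferInstance, inferInstance, ℝ × ℝ, inferInstance, inferInstance,
    inferInstance, inferInstance, inferInstance, ℝ, inferInstance, inferInstance, inferInstance,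
    PlanarRouth.Translations, inferInstance, inferInstance, inferInstance, inferInstance,
    inferInstance, inferInstance, inferInstance, ℝ, inferInstance, inferInstance, inferInstance,
    inferInstance, inferInstance, PlanarRouth.lagrangian, 0, (ℝ × ℝ) × ℝ, inferInstance,
    inferInstance, inferInstance, inferInstance, inferInstance, PlanarRouth.flatConnection,
    PlanarRouth.isRouthSystem.verticalConnection, PlanarRouth.isRouthSystem.mechConnection,
    PlanarRouth.isRouthSystem, PlanarRouth.isRouthSystem.isVerticalLiftSplitting_verticalConnection,
    PlanarRouth.isRouthSystem.isMechanicalConnection_mechConnection,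
    PlanarRouth.mechConnection_comp_verticalConnection_ne⟩
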